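/- Let $V:\mathbb R\to\mathbb R$ be smooth and even with $V(0)=0$ and $V''(0)>0$, let $f=V'$, and let $d,T>0$. Put $v_k(t)=T^{-1/2}e^{2\pi i k t/T}$. For $M\ge 1$ let $X_M$ be the space of real-valued functions in the complex span of $\{v_k:|k|\le M\}$, with the norm of $L^2([0,T])$, let $P_M$ be the $L^2([0,T])$-orthogonal projection onto $X_M$, and let $X_{M,e}\subset X_M$ be the subspace of even functions. Consider the lattice map on $X_M^2$ (which leaves $X_{M,e}^2$ invariant) $$F_M(u,\tilde u)=\Bigl(2u+\tfrac1d P_Mf(u)+\tfrac1d\partial_t^2u-\tilde u,\;u\Bigr).$$ Assume: (H1) The spectrum of the operator $DF(0)(v,w)=\bigl(\tfrac1d\partial_t^2v+(\tfrac{f'(0)}d+2)v-w,\;v\bigr)$ on $T$-periodic square-integrable functions (domain $H^2_{\rm per}\times L^2_{\rm per}$) is bounded away from the unit circle. (H2) There is $M_0\ge1$ such that for every $M\ge M_0$ the stable and unstable manifolds of $0$ for $F_M$ in $X_{M,e}^2$ intersect transversely in $X_{M,e}^2$ along a nontrivial homoclinic orbit $Q_M(n)$, $n\in\mathbb Z$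 (the primary breather). Let $M\ge M_0$. Let $r_M>1$ be the smallest modulus of an element outside the unit circle of $\{\lambda_k,\lambda_k^{-1}:0\le k\le M\}$, where $\lambda_k=\tfrac12\bigl(r_k+\sqrt{r_k^2-4}\bigr)$ and $r_k=-\frac{4k^2\pi^2}{dT^2}+\frac{f'(0)}d+2$. Then there are a positive integer $N^*$, a number $\delta>0$, constants $B_j$ ($j\ge0$) and constants $C_{D,j}$ ($D,j\ge 0$ integers) such that the following holds for all $m>1$, all integers $N_1,\dots,N_{m-1}\ge N^*$ and all $\sigma_1,\dots,\sigma_m\in\{1,-1\}$. Put $N_i^+=\lfloor N_i/2\rfloor$, $N_i^-=N_i-N_i^+$, $N_0^-=N_m^+=\infty$ and $N=\tfrac12\min_iN_i$, and for a sequence $U(n)$, $n\in\mathbb Z$, put $$\tilde U_i(n)=U\Bigl(n+\sum_{j=1}^{i-1}N_j\Bigr)-\sigma_iQ_M(n),\qquad i=1,\dots,m;$$ write $\tilde U_i^-(n)$ for $-N_{i-1}^-\le n\le 0$, and $\tilde U_i^+(n)$ for $0\le n\le N_i^+$. There is exactly one solution $U(n)\in X_{M,e}^2$, $n\in\mathbb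 Z$, of $U(n+1)=F_M(U(n))$ such that $\|\tilde U_i^\pm(n)\|\le\delta$ for all $i$ and $n$. For this solution and every $j\ge0$: 1. for $1\le i\le m-1$, $$\|\partial_t^j\tilde U_i^+(N_i^+)-\sigma_{i+1}\partial_t^jQ_M(-N_i^-)\|\le B_jr_M^{-2N},\qquad \|\partial_t^j\tilde U_{i+1}^-(-N_i^-)-\sigma_i\partial_t^jQ_M(N_i^+)\|\le B_jr_M^{-2N};$$ 2. $\|\partial_t^j\tilde U_1^-(n)\|\le B_jr_M^{-2N}r_M^{n}$ for $n\le0$, and $\|\partial_t^j\tilde U_m^+(n)\|\le B_jr_M^{-2N}r_M^{-n}$ for $n\ge0$; 3. for $1\le i\le m$ and $-N_{i-1}^-\le n\le N_i^+$, $$\|\partial_t^j\tilde U_i^\pm(n)\|\le B_j\Bigl(r_M^{-N_{i-1}^-}r_M^{-(N_{i-1}^-+n)}+r_M^{-N_i^+}r_M^{-(N_i^+-n)}\Bigr),$$ where the first term is absent for $i=1$ and the second is absent for $i=m$; 4. if $\max_iN_i-\min_iN_i\le D$, then $$\|\partial_t^j\tilde U_i^-(n)\|\le C_{D,j}\,r_M^{-N_{i-1}^-}r_M^{-(N_{i-1}^-+n)}\quad(2\le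 i\le m,\ -N_{i-1}^-\le n\le0),$$ $$\|\partial_t^j\tilde U_i^+(n)\|\le C_{D,j}\,r_M^{-N_i^+}r_M^{-(N_i^+-n)}\quad(1\le i\le m-1,\ 0\le n\le N_i^+).$$ -/

import Mathlib

open Filter Topology MeasureTheory
open scoped ContDiff

noncomputable section

namespace DKG

/-! ### The linearization at the origin on square-integrable periodic functions -/

/-- Complex `T`-periodic square-integrable functions, given by their restriction to one period. -/
abbrev L2per (T : ℝ) : Type := Lp ℂ 2 (volume.restrict (Set.Ioc (0 : ℝ) T))

/-- `w` is the second derivative of the `T`-periodic function `u`, in the weak (periodic) sense;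
`u` lies in the periodic Sobolev space `H²` exactly when such a `w` exists. -/
def IsWeakSecondDeriv (T : ℝ) (u w : L2per T) : Prop :=
  ∀ φ : ℝ → ℂ, ContDiff ℝ ∞ φ → Function.Periodic φ T →
    ∫ t in (0 : ℝ)..T, u t * deriv (deriv φ) t = ∫ t in (0 : ℝ)..T, w t * φ t

/-- The graph of the unbounded operator
`DF(0) (v, w) = (d⁻¹ v'' + (f'(0) / d + 2) v - w, v)`, with domain `H² × L²`, where `f = V'`. -/
def DFZeroGraph (V : ℝ → ℝ) (d T : ℝ) (x y : L2per T × L2per T) : Prop :=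
  ∃ w : L2per T, IsWeakSecondDeriv T x.1 w ∧
    y.1 = ((1 / d : ℝ) : ℂ) • w + ((deriv (deriv V) 0 / d + 2 : ℝ) : ℂ) • x.1 - x.2 ∧
    y.2 = x.1

/-- The resolvent set of `DF(0)`: the `z` for which `DF(0) - z` maps its domain bijectively onto
the whole space, with bounded inverse `R`. -/
def DFZeroResolventSet (V : ℝ → ℝ) (d T : ℝ) : Set ℂ :=
  {z | ∃ R : (L2per T × L2per T) →L[ℂ] (L2per T × L2per T),
    (∀ x y, DFZeroGraph V d T x y → R (y - z • x) = x) ∧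
    ∀ h, ∃ y, DFZeroGraph V d T (R h) y ∧ y - z • R h = h}

/-- The spectrum of `DF(0)`. -/
def DFZeroSpectrum (V : ℝ → ℝ) (d T : ℝ) : Set ℂ := (DFZeroResolventSet V d T)ᶜ

/-- The set `S` has positive distance from the unit circle. -/
def BoundedAwayFromUnitCircle (S : Set ℂ) : Prop :=
  ∃ ε : ℝ, 0 < ε ∧ ∀ z ∈ S, ∀ ζ : ℂ, ‖ζ‖ = 1 → ε ≤ ‖z - ζ‖

/-- `r_k = - 4 k² π² / (d T²) + f'(0) / d + 2`. -/
def rCoeff (V : ℝ → ℝ) (d T : ℝ) (k : ℕ) : ℝ :=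
  -(4 * (k : ℝ) ^ 2 * Real.pi ^ 2 / (d * T ^ 2)) + deriv (deriv V) 0 / d + 2

/-- `λ_k = (r_k + √(r_k² - 4)) / 2`; it is only used when `|r_k| > 2`. -/
def eigenvalueAt (V : ℝ → ℝ) (d T : ℝ) (k : ℕ) : ℝ :=
  (rCoeff V d T k + Real.sqrt (rCoeff V d T k ^ 2 - 4)) / 2

/-- The eigenvalues `λ_k, λ_k⁻¹` (`0 ≤ k ≤ M`) of the truncated linearization. -/
def eigenvalueSet (V : ℝ → ℝ) (d T : ℝ) (M : ℕ) : Set ℝ :=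
  {l | ∃ k ≤ M, l = eigenvalueAt V d T k ∨ l = (eigenvalueAt V d T k)⁻¹}

/-- `r_M`, the smallest modulus of an eigenvalue outside the unit circle (the set is finite). -/
def rate (V : ℝ → ℝ) (d T : ℝ) (M : ℕ) : ℝ :=
  sInf {a | ∃ l ∈ eigenvalueSet V d T M, 1 < |l| ∧ a = |l|}

/-! ### The Fourier truncation -/

/-- The orthonormal Fourier basis function `v_k(t) = T^{-1/2} exp (2 π i k t / T)`. -/
def mode (T : ℝ) (k : ℤ) (t : ℝ) : ℂ :=
  ((1 / Real.sqrt T : ℝ) : ℂ) * Complex.exp (((2 * Real.pi * k * t / T : ℝ) : ℂ) * Complex.I)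

/-- `X_M`: the real-valued functions in the complex span of the `v_k` with `|k| ≤ M`. -/
def trigSpace (T : ℝ) (M : ℕ) : Submodule ℝ (ℝ → ℝ) :=
  ((Submodule.span ℂ (mode T '' Set.Icc (-(M : ℤ)) M)).restrictScalars ℝ).comap
    (Complex.ofRealAm.toLinearMap.compLeft ℝ)

/-- `X_{M,e}`: the even functions in `X_M`. -/
def evenSpace (T : ℝ) (M : ℕ) : Submodule ℝ (ℝ → ℝ) where
  carrier := {u | u ∈ trigSpace T M ∧ ∀ t, u (-t) = u t}
  add_mem' := fun ha hb =>
    ⟨add_mem ha.1 hb.1, fun t => by simp [Pi.add_apply, ha.2 t, hb.2 t]⟩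
  zero_mem' := ⟨zero_mem _, fun _ => rfl⟩
  smul_mem' := fun c _ ha => ⟨Submodule.smul_mem _ c ha.1, fun t => by simp [ha.2 t]⟩

/-- Pairs `(u, ũ)` of functions of time. -/
abbrev State : Type := (ℝ → ℝ) × (ℝ → ℝ)

/-- `X_{M,e}²`. -/
def phaseSpace (T : ℝ) (M : ℕ) : Submodule ℝ State := (evenSpace T M).prod (evenSpace T M)

/-- The projection `P_M w = ∑_{|k| ≤ M} ⟨w, v_k⟩ v_k` (for real `w` the sum is real). -/
def proj (T : ℝ) (M : ℕ) (w : ℝ → ℝ) (t : ℝ) : ℝ :=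
  (∑ k ∈ Finset.Icc (-(M : ℤ)) M,
    (∫ s in (0 : ℝ)..T, (w s : ℂ) * (starRingEnd ℂ) (mode T k s)) * mode T k t).re

/-- `F_M (u, ũ) = (2 u + d⁻¹ P_M f(u) + d⁻¹ ∂ₜ² u - ũ, u)`, where `f = V'`. -/
def latticeMap (V : ℝ → ℝ) (d T : ℝ) (M : ℕ) (U : State) : State :=
  (fun t => 2 * U.1 t + (1 / d) * proj T M (fun s => deriv V (U.1 s)) t
      + (1 / d) * deriv (deriv U.1) t - U.2 t,
    U.1)

/-- The `L²([0,T])` norm of a pair. -/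
def l2norm (T : ℝ) (U : State) : ℝ :=
  Real.sqrt (∫ t in (0 : ℝ)..T, (U.1 t ^ 2 + U.2 t ^ 2))

/-- The `j`-th derivative with respect to time. -/
def timeDeriv (j : ℕ) (U : State) : State := (iteratedDeriv j U.1, iteratedDeriv j U.2)

/-! ### Stable and unstable manifolds of the origin in `X_{M,e}²` -/

/-- `Γ` is a forward orbit in `X_{M,e}²`. -/
def IsForwardOrbit (V : ℝ → ℝ) (d T : ℝ) (M : ℕ) (Γ : ℕ → State) : Prop :=
  ∀ k, Γ k ∈ phaseSpace T M ∧ Γ (k + 1) = latticeMap V d T M (Γ k)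

/-- `Γ` is a backward orbit in `X_{M,e}²`. -/
def IsBackwardOrbit (V : ℝ → ℝ) (d T : ℝ) (M : ℕ) (Γ : ℕ → State) : Prop :=
  ∀ k, Γ k ∈ phaseSpace T M ∧ Γ k = latticeMap V d T M (Γ (k + 1))

/-- The (global) stable manifold of the origin. -/
def stableManifold (V : ℝ → ℝ) (d T : ℝ) (M : ℕ) : Set State :=
  {P | ∃ Γ, IsForwardOrbit V d T M Γ ∧ Γ 0 = P ∧
    Tendsto (fun k => l2norm T (Γ k)) atTop (𝓝 0)}

/-- The (global) unstable manifold of the origin. -/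
def unstableManifold (V : ℝ → ℝ) (d T : ℝ) (M : ℕ) : Set State :=
  {P | ∃ Γ, IsBackwardOrbit V d T M Γ ∧ Γ 0 = P ∧
    Tendsto (fun k => l2norm T (Γ k)) atTop (𝓝 0)}

/-- The curve `γ` has velocity `v` at parameter `0`. -/
def HasVelocity (T : ℝ) (γ : ℝ → State) (v : State) : Prop :=
  Tendsto (fun s : ℝ => l2norm T (s⁻¹ • (γ s - γ 0) - v)) (𝓝[≠] 0) (𝓝 0)

/-- The orbits `Γ s` converge to the origin, uniformly in `s`. -/
def TendstoZeroUniformly (T : ℝ) (Γ : ℝ → ℕ → State) : Prop :=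
  ∀ ε : ℝ, 0 < ε → ∃ K : ℕ, ∀ k, K ≤ k → ∀ s, l2norm T (Γ s k) < ε

/-- The tangent space of the stable manifold at `P`: velocities of curves through `P` in the
stable manifold. The stable manifold is only injectively immersed, as the increasing union of the
preimages of the local stable manifold (an embedded disc). Uniform convergence of the forward
orbits to the origin says that the curve stays in one of these preimages. -/
def stableTangent (V : ℝ → ℝ) (d T : ℝ) (M : ℕ) (P : State) : Set State :=
  {v | v ∈ phaseSpace T M ∧ ∃ Γ : ℝ → ℕ → State, (∀ s, IsForwardOrbit V d T M (Γ s)) ∧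
    TendstoZeroUniformly T Γ ∧ Γ 0 0 = P ∧ HasVelocity T (fun s => Γ s 0) v}

/-- The tangent space of the unstable manifold at `P`, in the same way. -/
def unstableTangent (V : ℝ → ℝ) (d T : ℝ) (M : ℕ) (P : State) : Set State :=
  {v | v ∈ phaseSpace T M ∧ ∃ Γ : ℝ → ℕ → State, (∀ s, IsBackwardOrbit V d T M (Γ s)) ∧
    TendstoZeroUniformly T Γ ∧ Γ 0 0 = P ∧ HasVelocity T (fun s => Γ s 0) v}

/-- `U` is a solution of `U(n+1) = F_M(U(n))` on `ℤ` with values in `X_{M,e}²`. -/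
def IsEvenOrbit (V : ℝ → ℝ) (d T : ℝ) (M : ℕ) (U : ℤ → State) : Prop :=
  ∀ n, U n ∈ phaseSpace T M ∧ U (n + 1) = latticeMap V d T M (U n)

/-- `Q` is a (nontrivial) homoclinic orbit of the origin in `X_{M,e}²`, along which the stable and
unstable manifolds intersect transversely: their tangent spaces span `X_{M,e}²`. -/
structure IsTransverseHomoclinicOrbit (V : ℝ → ℝ) (d T : ℝ) (M : ℕ) (Q : ℤ → State) : Prop where
  orbit : IsEvenOrbit V d T M Q
  nontrivial : ∀ n, Q n ≠ 0
  mem_manifolds : ∀ n, Q n ∈ stableManifold V d T M ∩ unstableManifold V d T M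
  transverse : ∀ n, ∀ w ∈ phaseSpace T M,
    ∃ a ∈ stableTangent V d T M (Q n), ∃ b ∈ unstableTangent V d T M (Q n), w = a + b

/-! ### Chains of copies of the primary breather

There are `m` copies, `i = 1, …, m`; the distances `N i` are used for `i = 1, …, m - 1`. -/

/-- `N_i^+ = ⌊N_i / 2⌋`. -/
def halfPlus (N : ℕ → ℕ) (i : ℕ) : ℤ := ((N i / 2 : ℕ) : ℤ)

/-- `N_i^- = N_i - N_i^+`. -/
def halfMinus (N : ℕ → ℕ) (i : ℕ) : ℤ := (N i : ℤ) - halfPlus N i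

/-- The position `∑_{j=1}^{i-1} N_j` of the `i`-th copy. -/
def center (N : ℕ → ℕ) (i : ℕ) : ℤ := ∑ j ∈ Finset.Ico 1 i, (N j : ℤ)

/-- The smallest distance `2 N = min {N_1, …, N_{m-1}}`. -/
def minDist (m : ℕ) (N : ℕ → ℕ) : ℤ := ((sInf (N '' Set.Icc 1 (m - 1)) : ℕ) : ℤ)

/-- The domain `[-N_{i-1}^-, N_i^+]` of the `i`-th piece, where `N_0^- = N_m^+ = ∞`. -/
def piece (m : ℕ) (N : ℕ → ℕ) (i : ℕ) : Set ℤ :=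
  {n | (1 < i → -halfMinus N (i - 1) ≤ n) ∧ (i < m → n ≤ halfPlus N i)}

/-- The remainder of `U` at the `i`-th copy, `Ũ_i(n) = U(n + ∑_{j<i} N_j) - σ_i Q(n)`; it is
`Ũ_i^-(n)` for `n ≤ 0` and `Ũ_i^+(n)` for `n ≥ 0`. -/
def remainder (Q : ℤ → State) (N : ℕ → ℕ) (σ : ℕ → ℝ) (U : ℤ → State) (i : ℕ) (n : ℤ) : State :=
  U (n + center N i) - σ i • Q n

/-- The bound `r^{-N_{i-1}^-} r^{-(N_{i-1}^- + n)}` coming from the left neighbour. -/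
def leftBound (r : ℝ) (N : ℕ → ℕ) (i : ℕ) (n : ℤ) : ℝ :=
  r ^ (-halfMinus N (i - 1)) * r ^ (-(halfMinus N (i - 1) + n))

/-- The bound `r^{-N_i^+} r^{-(N_i^+ - n)}` coming from the right neighbour. -/
def rightBound (r : ℝ) (N : ℕ → ℕ) (i : ℕ) (n : ℤ) : ℝ :=
  r ^ (-halfPlus N i) * r ^ (-(halfPlus N i - n))

end DKG

end

open DKG

/-!
In coordinates given by cosine coefficients the lattice map on `X_{M,e}²` is an odd diffeomorphism
`F` of a finite-dimensional space, with an explicit inverse since the map is reversible. Its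
linearization at the origin splits into the planar maps `(a, b) ↦ (r_k a - b, a)`. If
`|r_k| ≤ 2`, the corresponding exponential would give `DF(0)` an eigenvalue on the unit circle, so
the spectral hypothesis makes the origin hyperbolic, and in eigencoordinates one step contracts and
expands by at least the factor `r = r_M` (`two_lt_abs_rCoeff`, `exists_trigChart`). The rest takes
place in this abstract setting (`HypDiffeo`), and only the last part returns to functions of time,
where all norms of `u` and of its derivatives are bounded by the norm of the coefficients.

The estimates hold at the exact rate `r`, not at an arbitrarily smaller one. The reason is that a
homoclinic orbit `Q` decays like `r ^ (-|n|)`, so the linearization along `Q` differs from that at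
the origin by a summable sequence; Green's function of the constant coefficient equation and a
Gronwall lemma for kernels `r ^ (-|n - m|)` with summable weights then lose only a constant
(`gronwall_of_sum_le`, `green_perturbed`).

Velocities of curves in the stable manifold are initial values of bounded solutions of the
linearized equation (`IsHomoclinic.mem_stableSpace`). Transversality together with the count of
dimensions excludes solutions that are bounded in both directions (`IsHomoclinic.inf_eq_bot`). By
compactness this turns into an a priori estimate for approximate solutions on long intervals around
the center of `Q` (`IsHomoclinic.exists_dichotomy`).

A chain of copies of `±Q` is an orbit up to small jumps. The dichotomy on the pieces and Green's
function between them give an a priori estimate along the whole chain, uniform in the chain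
(`IsHomoclinic.exists_chain_bound`). It makes the linearized boundary value problem on a bounded
interval, a square linear system, uniformly invertible; this yields an orbit near the chain on every
bounded interval, hence by compactness on `ℤ`, and the same estimate applied to the difference of
two orbits gives uniqueness (`exists_orbit`, `exists_unique_orbit`).

Between two neighbouring copies the orbit stays near the origin and decays from both at the full
rate. This gives the size of the remainder at the ends of each piece, and the dichotomy spreads it
to the interior. At an interface, the deviation of the orbit from the sum of the two adjacent copies
solves the equation at the origin with a quadratic right-hand side of size `r ^ (-N_i)`
(`exists_remainder_bounds`, `IsHomoclinic.exists_multipulse`).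
-/

namespace DKG

/-! ### Exponential weights and Gronwall lemmas without loss of rate -/

/-- The two-sided exponential weight `r^{-|n|}`. -/
noncomputable def decay (r : ℝ) (n : ℤ) : ℝ := r ^ (-|n|)

/-- The mass `∑_{n ∈ ℤ} r^{-|n|}` of the exponential weight. -/
noncomputable def decaySum (r : ℝ) : ℝ := ∑' n : ℤ, decay r n

section decay
variable {r : ℝ}

theorem decay_pos (hr : 1 < r) (n : ℤ) : 0 < decay r n := zpow_pos (by linarith) _

theorem decay_nonneg (hr : 1 < r) (n : ℤ) : 0 ≤ decay r n := (decay_pos hr n).le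

@[simp] theorem decay_zero : decay r 0 = 1 := by simp [decay]

theorem decay_neg (n : ℤ) : decay r (-n) = decay r n := by simp [decay]

theorem decay_sub_comm (m n : ℤ) : decay r (m - n) = decay r (n - m) := by
  rw [← decay_neg, neg_sub]

theorem decay_of_nonneg {n : ℤ} (hn : 0 ≤ n) : decay r n = r ^ (-n) := by
  rw [decay, abs_of_nonneg hn]

theorem decay_of_nonpos {n : ℤ} (hn : n ≤ 0) : decay r n = r ^ n := by
  rw [decay, abs_of_nonpos hn, neg_neg]

theorem decay_anti (hr : 1 < r) {m n : ℤ} (h : |m| ≤ |n|) : decay r n ≤ decay r m :=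
  zpow_le_zpow_right₀ hr.le (by omega)

theorem decay_le_one (hr : 1 < r) (n : ℤ) : decay r n ≤ 1 := by
  simpa using decay_anti hr (m := 0) (n := n) (by simp)

theorem decay_mul_le (hr : 1 < r) (m n : ℤ) : decay r m * decay r n ≤ decay r (m + n) := by
  rw [decay, decay, decay, ← zpow_add₀ (by linarith)]
  have := abs_add_le m n
  exact zpow_le_zpow_right₀ hr.le (by omega)

theorem decay_le_mul (hr : 1 < r) (m n : ℤ) : decay r (m + n) ≤ r ^ |n| * decay r m := by
  rw [decay, decay, ← zpow_add₀ (by linarith)]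
  have := abs_sub_abs_le_abs_sub m (-n)
  rw [abs_neg, sub_neg_eq_add] at this
  exact zpow_le_zpow_right₀ hr.le (by omega)

theorem decay_natCast (k : ℕ) : decay r k = r⁻¹ ^ k := by
  rw [decay_of_nonneg (by positivity), zpow_neg, zpow_natCast, inv_pow]

theorem tendsto_decay_natCast (hr : 1 < r) : Tendsto (fun k : ℕ => decay r k) atTop (𝓝 0) := by
  simp_rw [decay_natCast]
  exact tendsto_pow_atTop_nhds_zero_of_lt_one (by positivity) (inv_lt_one_of_one_lt₀ hr)

theorem exists_decay_le (hr : 1 < r) {ε : ℝ} (hε : 0 < ε) :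
    ∃ k : ℕ, ∀ n : ℤ, (k : ℤ) ≤ |n| → decay r n ≤ ε := by
  obtain ⟨k, hk⟩ := ((tendsto_decay_natCast hr).eventually (ge_mem_nhds hε)).exists
  exact ⟨k, fun n hn => (decay_anti hr (by simpa using hn)).trans hk⟩

/-- A bound with an error that decays in a free parameter holds without the error. -/
theorem le_of_forall_decay (hr : 1 < r) {x y c : ℝ} (n : ℤ)
    (h : ∀ᶠ k : ℕ in atTop, x ≤ y + c * decay r (n - k)) : x ≤ y := by
  have h1 : Tendsto (fun k : ℕ => decay r (n - k)) atTop (𝓝 0) := by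
    have h2 : Tendsto (fun k : ℕ => r ^ |n| * decay r k) atTop (𝓝 0) := by
      simpa using (tendsto_decay_natCast hr).const_mul (r ^ |n|)
    refine squeeze_zero (fun k => decay_nonneg hr _) (fun k => ?_) h2
    have := decay_le_mul hr (-(k : ℤ)) n
    rwa [decay_neg, neg_add_eq_sub] at this
  have h2 : Tendsto (fun k : ℕ => y + c * decay r (n - k)) atTop (𝓝 (y + c * 0)) :=
    (h1.const_mul c).const_add y
  simpa using ge_of_tendsto h2 h

theorem summable_decay (hr : 1 < r) : Summable (decay r) := by
  have h : Summable (fun k : ℕ => decay r k) := by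
    simp_rw [decay_natCast]
    exact summable_geometric_of_lt_one (by positivity) (inv_lt_one_of_one_lt₀ hr)
  exact Summable.of_nat_of_neg h (by simpa [decay_neg] using h)

theorem decaySum_pos (hr : 1 < r) : 0 < decaySum r :=
  (summable_decay hr).tsum_pos (decay_nonneg hr) 0 (decay_pos hr 0)

theorem sum_decay_sub_right_le (hr : 1 < r) (S : Finset ℤ) (m : ℤ) :
    ∑ n ∈ S, decay r (n - m) ≤ decaySum r := by
  have h := (summable_decay hr)
  have h2 := ((Equiv.subRight m).summable_iff (f := decay r)).2 h
  have h3 := (Equiv.subRight m).tsum_eq (decay r)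
  rw [decaySum, ← h3]
  exact h2.sum_le_tsum S (fun n _ => decay_nonneg hr _)

theorem sum_decay_sub_left_le (hr : 1 < r) (S : Finset ℤ) (n : ℤ) :
    ∑ m ∈ S, decay r (n - m) ≤ decaySum r := by
  simp_rw [decay_sub_comm n]
  exact sum_decay_sub_right_le hr S n

/-- Far from the origin the weight has small mass. -/
theorem sum_decay_le_of_far (hr : 1 < r) (S : Finset ℤ) (k : ℕ) (hS : ∀ n ∈ S, (k : ℤ) ≤ n) :
    ∑ n ∈ S, decay r n ≤ decaySum r * decay r k := by
  have h : ∀ n ∈ S, decay r n = decay r (n - k) * decay r k := fun n hn => by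
    have := hS n hn
    rw [decay_of_nonneg (by omega), decay_of_nonneg (by omega), decay_of_nonneg (by omega),
      ← zpow_add₀ (by linarith)]
    congr 1; ring
  rw [Finset.sum_congr rfl h, ← Finset.sum_mul]
  exact mul_le_mul_of_nonneg_right (sum_decay_sub_right_le hr S k) (decay_nonneg hr _)

end decay

/-- A nonnegative function on `ℤ` that changes at most by the factor `r` per step. -/
def SlowlyVarying (r : ℝ) (φ : ℤ → ℝ) : Prop :=
  (∀ n, 0 ≤ φ n) ∧ ∀ n m, decay r (n - m) * φ m ≤ φ n

section SlowlyVarying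
variable {r : ℝ} {φ ψ : ℤ → ℝ}

theorem SlowlyVarying.add (hφ : SlowlyVarying r φ) (hψ : SlowlyVarying r ψ) :
    SlowlyVarying r (fun n => φ n + ψ n) :=
  ⟨fun n => add_nonneg (hφ.1 n) (hψ.1 n), fun n m => by
    rw [mul_add]; exact add_le_add (hφ.2 n m) (hψ.2 n m)⟩

theorem SlowlyVarying.const_mul (hφ : SlowlyVarying r φ) {c : ℝ} (hc : 0 ≤ c) :
    SlowlyVarying r (fun n => c * φ n) :=
  ⟨fun n => mul_nonneg hc (hφ.1 n), fun n m => by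
    rw [mul_left_comm]; exact mul_le_mul_of_nonneg_left (hφ.2 n m) hc⟩

theorem slowlyVarying_const (hr : 1 < r) {c : ℝ} (hc : 0 ≤ c) : SlowlyVarying r (fun _ => c) :=
  ⟨fun _ => hc, fun _ _ => mul_le_of_le_one_left hc (decay_le_one hr _)⟩

theorem slowlyVarying_decay (hr : 1 < r) (a : ℤ) : SlowlyVarying r (fun n => decay r (n - a)) :=
  ⟨fun _ => decay_nonneg hr _, fun n m => by simpa using decay_mul_le hr (n - m) (m - a)⟩

theorem slowlyVarying_sum (hr : 1 < r) (S : Finset ℤ) {g : ℤ → ℝ} (hg : ∀ m, 0 ≤ g m) :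
    SlowlyVarying r (fun n => ∑ m ∈ S, decay r (n - m) * g m) := by
  refine ⟨fun n => Finset.sum_nonneg fun m _ => mul_nonneg (decay_nonneg hr _) (hg m),
    fun n m => ?_⟩
  rw [Finset.mul_sum]
  refine Finset.sum_le_sum fun l _ => ?_
  rw [← mul_assoc]
  exact mul_le_mul_of_nonneg_right ((slowlyVarying_decay hr l).2 n m) (hg l)

theorem SlowlyVarying.le_mul (hr : 1 < r) (hφ : SlowlyVarying r φ) (n m : ℤ) :
    φ m ≤ r ^ |n - m| * φ n := by
  have h := hφ.2 n m
  have h2 : 0 < r ^ |n - m| := zpow_pos (by linarith) _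
  calc φ m = r ^ |n - m| * (decay r (n - m) * φ m) := by
        rw [← mul_assoc, decay, zpow_neg, mul_inv_cancel₀ h2.ne', one_mul]
    _ ≤ _ := mul_le_mul_of_nonneg_left h h2.le

/-- A summable perturbation does not affect the exponential rate. -/
theorem gronwall_of_sum_le (hr : 1 < r) (S : Finset ℤ) (hφ : SlowlyVarying r φ) {w η : ℤ → ℝ}
    (hη : ∀ n, 0 ≤ η n) (hsum : ∑ m ∈ S, η m ≤ 1 / 2)
    (h : ∀ n ∈ S, w n ≤ φ n + ∑ m ∈ S, decay r (n - m) * (η m * w m)) :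
    ∀ n ∈ S, w n ≤ 2 * φ n := by
  intro n hn
  -- adding a constant keeps the function slowly varying and makes it positive
  have key : ∀ ε : ℝ, 0 < ε → w n ≤ 2 * (φ n + ε) := by
    intro ε hε
    have hφε := hφ.add (slowlyVarying_const hr hε.le)
    have hpos : ∀ k, 0 < φ k + ε := fun k => by have := hφ.1 k; linarith
    obtain ⟨n₀, hn₀, hmax⟩ := S.exists_max_image (fun k => w k / (φ k + ε)) ⟨n, hn⟩
    set q := w n₀ / (φ n₀ + ε) with hq
    have hw : ∀ k ∈ S, w k ≤ q * (φ k + ε) := fun k hk => (div_le_iff₀ (hpos k)).1 (hmax k hk)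
    by_cases hq0 : q ≤ 2
    · exact (hw n hn).trans (mul_le_mul_of_nonneg_right hq0 (hpos n).le)
    have hq1 : 0 ≤ q := by linarith
    exfalso
    have h1 : w n₀ = q * (φ n₀ + ε) := by rw [hq, div_mul_cancel₀ _ (hpos n₀).ne']
    have h2 : ∑ m ∈ S, decay r (n₀ - m) * (η m * w m) ≤ ∑ m ∈ S, η m * (q * (φ n₀ + ε)) := by
      refine Finset.sum_le_sum fun m hm => ?_
      calc decay r (n₀ - m) * (η m * w m)
          ≤ decay r (n₀ - m) * (η m * (q * (φ m + ε))) :=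
            mul_le_mul_of_nonneg_left (mul_le_mul_of_nonneg_left (hw m hm) (hη m))
              (decay_nonneg hr _)
        _ = η m * (q * (decay r (n₀ - m) * (φ m + ε))) := by ring
        _ ≤ _ := mul_le_mul_of_nonneg_left (mul_le_mul_of_nonneg_left (hφε.2 n₀ m) hq1) (hη m)
    rw [← Finset.sum_mul] at h2
    have h3 := h n₀ hn₀
    have h4 : (∑ m ∈ S, η m) * (q * (φ n₀ + ε)) ≤ 1 / 2 * (q * (φ n₀ + ε)) :=
      mul_le_mul_of_nonneg_right hsum (mul_nonneg hq1 (hpos _).le)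
    have h5 : q * (φ n₀ + ε) ≤ 2 * (φ n₀ + ε) := by linarith
    exact hq0 (le_of_mul_le_mul_right h5 (hpos n₀))
  refine le_of_forall_pos_le_add fun ε hε => ?_
  have := key (ε / 2) (by linarith)
  linarith

/-- A uniformly small perturbation keeps the solution summable. -/
theorem sum_le_of_gronwall (hr : 1 < r) (S : Finset ℤ) {w : ℤ → ℝ} {α β ε : ℝ} {a b : ℤ}
    (hα : 0 ≤ α) (hβ : 0 ≤ β) (hw : ∀ n ∈ S, 0 ≤ w n) (hε : 0 ≤ ε) (hsmall : ε * decaySum r ≤ 1 / 2)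
    (h : ∀ n ∈ S, w n ≤ α * decay r (n - a) + β * decay r (n - b)
      + ∑ m ∈ S, decay r (n - m) * (ε * w m)) :
    ∑ n ∈ S, w n ≤ 2 * decaySum r * (α + β) := by
  have h1 := Finset.sum_le_sum h
  rw [Finset.sum_add_distrib, Finset.sum_add_distrib, ← Finset.mul_sum, ← Finset.mul_sum,
    Finset.sum_comm] at h1
  have h2 : ∑ m ∈ S, ∑ n ∈ S, decay r (n - m) * (ε * w m) ≤ ∑ m ∈ S, 1 / 2 * w m := by
    refine Finset.sum_le_sum fun m hm => ?_
    rw [← Finset.sum_mul]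
    calc (∑ n ∈ S, decay r (n - m)) * (ε * w m) ≤ decaySum r * (ε * w m) :=
          mul_le_mul_of_nonneg_right (sum_decay_sub_right_le hr S m) (mul_nonneg hε (hw m hm))
      _ = ε * decaySum r * w m := by ring
      _ ≤ _ := mul_le_mul_of_nonneg_right hsmall (hw m hm)
  rw [← Finset.mul_sum] at h2
  have h3 := mul_le_mul_of_nonneg_left (sum_decay_sub_right_le hr S a) hα
  have h4 := mul_le_mul_of_nonneg_left (sum_decay_sub_right_le hr S b) hβ
  linarith

/-- The quadratic version: a small solution of a quadratic inequality decays from both ends of the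
interval at the full rate. Being small, it is summable, so that the quadratic term is a summable
perturbation. -/
theorem quadratic_gronwall (hr : 1 < r) (S : Finset ℤ) {w : ℤ → ℝ} {α β C c δ : ℝ} {a b : ℤ}
    (hC : 0 ≤ C) (hc : 0 ≤ c) (hα : 0 ≤ α) (hβ : 0 ≤ β)
    (hαδ : α ≤ δ) (hβδ : β ≤ δ) (hw : ∀ n, 0 ≤ w n) (hwδ : ∀ n ∈ S, w n ≤ δ)
    (h1 : c * δ * decaySum r ≤ 1 / 2) (h2 : c * (2 * decaySum r * (C * δ + C * δ)) ≤ 1 / 2)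
    (h : ∀ n ∈ S, w n ≤ C * (α * decay r (n - a) + β * decay r (n - b))
      + c * ∑ m ∈ S, decay r (n - m) * w m ^ 2) :
    ∀ n ∈ S, w n ≤ 2 * (C * (α * decay r (n - a) + β * decay r (n - b))) := by
  have hδ : 0 ≤ δ := hα.trans hαδ
  have hκ := (decaySum_pos hr).le
  have hl1 : ∑ n ∈ S, w n ≤ 2 * decaySum r * (C * α + C * β) := by
    refine sum_le_of_gronwall hr S (a := a) (b := b) (ε := c * δ) (mul_nonneg hC hα)
      (mul_nonneg hC hβ) (fun n _ => hw n) (mul_nonneg hc hδ) h1 fun n hn => ?_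
    refine (h n hn).trans ?_
    rw [Finset.mul_sum, mul_add, mul_assoc, mul_assoc]
    refine add_le_add le_rfl (Finset.sum_le_sum fun m hm => ?_)
    calc c * (decay r (n - m) * w m ^ 2) = decay r (n - m) * (c * (w m * w m)) := by ring
      _ ≤ decay r (n - m) * (c * (δ * w m)) := by
        have := hw m; have := hwδ m hm; have := decay_nonneg hr (n - m)
        gcongr
      _ = _ := by ring
  have hφ : SlowlyVarying r (fun n => C * (α * decay r (n - a) + β * decay r (n - b))) :=
    (((slowlyVarying_decay hr a).const_mul hα).add
      ((slowlyVarying_decay hr b).const_mul hβ)).const_mul hC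
  refine gronwall_of_sum_le hr S hφ (η := fun n => c * w n) (fun n => mul_nonneg hc (hw n)) ?_ ?_
  · rw [← Finset.mul_sum]
    refine (mul_le_mul_of_nonneg_left (hl1.trans ?_) hc).trans h2
    gcongr
  · intro n hn
    refine (h n hn).trans (le_of_eq ?_)
    rw [Finset.mul_sum]
    congr 1
    exact Finset.sum_congr rfl fun m _ => by ring

end SlowlyVarying

/-! ### Hyperbolic diffeomorphisms -/

/-- `DF` is a locally Lipschitz derivative of `F`, expressed by the resulting estimate of the
difference between `F` and its linearization at an arbitrary nearby point. -/
def IsC11 {X : Type*} [NormedAddCommGroup X] [NormedSpace ℝ X] (F : X → X) (DF : X → X →L[ℝ] X) :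
    Prop :=
  ∀ R : ℝ, ∃ K : ℝ, 0 ≤ K ∧
    (∀ x y z, ‖x‖ ≤ R → ‖y‖ ≤ R → ‖z‖ ≤ R →
      ‖F y - F x - DF z (y - x)‖ ≤ K * (‖x - z‖ + ‖y - z‖) * ‖y - x‖) ∧
    ∀ x y, ‖x‖ ≤ R → ‖y‖ ≤ R → ‖DF x - DF y‖ ≤ K * ‖x - y‖

/-- A diffeomorphism `F` with inverse `G`, both with locally Lipschitz derivatives, and with a
hyperbolic fixed point at the origin: in an adapted norm the linearization contracts the range of
the projection `P` and expands the range of the complementary projection `Pc`, both at least by the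
factor `r`. The data are symmetric under the exchange of `F` and `G`. -/
structure HypDiffeo (X : Type*) [NormedAddCommGroup X] [NormedSpace ℝ X] where
  r : ℝ
  one_lt : 1 < r
  F : X → X
  G : X → X
  DF : X → X →L[ℝ] X
  DG : X → X →L[ℝ] X
  P : X →L[ℝ] X
  Pc : X →L[ℝ] X
  F_zero : F 0 = 0
  left_inv : ∀ x, G (F x) = x
  right_inv : ∀ x, F (G x) = x
  c11F : IsC11 F DF
  c11G : IsC11 G DG
  DG_DF : ∀ x v, DG (F x) (DF x v) = v
  DF_DG : ∀ x v, DF (G x) (DG x v) = v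
  P_add : ∀ x, P x + Pc x = x
  P_idem : ∀ x, P (P x) = P x
  P_comm : ∀ x, P (DF 0 x) = DF 0 (P x)
  Pc_comm : ∀ x, Pc (DG 0 x) = DG 0 (Pc x)
  norm_P : ∀ x, ‖P x‖ ≤ ‖x‖
  norm_Pc : ∀ x, ‖Pc x‖ ≤ ‖x‖
  contract : ∀ x, ‖DF 0 (P x)‖ ≤ r⁻¹ * ‖P x‖
  expand : ∀ x, ‖DG 0 (Pc x)‖ ≤ r⁻¹ * ‖Pc x‖

/-- Repeated halving of the excess over `2 p` removes it. -/
theorem le_two_mul_of_halving {ι : Type*} (S : Set ι) (w : ι → ℝ) {p s₀ : ℝ}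
    (h0 : ∀ n ∈ S, w n ≤ s₀)
    (h : ∀ s, (∀ n ∈ S, w n ≤ s) → ∀ n ∈ S, w n ≤ p + s / 2) : ∀ n ∈ S, w n ≤ 2 * p := by
  have key : ∀ k : ℕ, ∀ n ∈ S, w n ≤ 2 * p + (s₀ - 2 * p) * (1 / 2) ^ k := by
    intro k
    induction k with
    | zero => simpa using h0
    | succ k ih =>
      intro n hn
      refine (h _ ih n hn).trans (le_of_eq ?_)
      ring
  intro n hn
  have h1 : Tendsto (fun k : ℕ => 2 * p + (s₀ - 2 * p) * (1 / 2 : ℝ) ^ k) atTop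
      (𝓝 (2 * p + (s₀ - 2 * p) * 0)) :=
    ((tendsto_pow_atTop_nhds_zero_of_lt_one (by norm_num) (by norm_num)).const_mul _).const_add _
  simpa using ge_of_tendsto' h1 fun k => key k n hn

namespace HypDiffeo

variable {X : Type*} [NormedAddCommGroup X] [NormedSpace ℝ X] (H : HypDiffeo X)

theorem r_pos : 0 < H.r := zero_lt_one.trans H.one_lt

theorem G_zero : H.G 0 = 0 := by
  have := H.left_inv 0
  rwa [H.F_zero] at this

theorem Pc_eq (x : X) : H.Pc x = x - H.P x := by rw [eq_sub_iff_add_eq', H.P_add]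

theorem P_Pc (x : X) : H.P (H.Pc x) = 0 := by rw [Pc_eq, map_sub, H.P_idem, sub_self]

theorem Pc_P (x : X) : H.Pc (H.P x) = 0 := by rw [Pc_eq, H.P_idem, sub_self]

theorem Pc_comm_DF (x : X) : H.Pc (H.DF 0 x) = H.DF 0 (H.Pc x) := by
  rw [Pc_eq, Pc_eq, H.P_comm, map_sub]

theorem DG_DF_zero (x : X) : H.DG 0 (H.DF 0 x) = x := by
  have := H.DG_DF 0 x
  rwa [H.F_zero] at this

theorem norm_le_add (x : X) : ‖x‖ ≤ ‖H.P x‖ + ‖H.Pc x‖ := by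
  conv_lhs => rw [← H.P_add x]
  exact norm_add_le _ _

/-- Time reversal. -/
def reverse : HypDiffeo X where
  r := H.r
  one_lt := H.one_lt
  F := H.G
  G := H.F
  DF := H.DG
  DG := H.DF
  P := H.Pc
  Pc := H.P
  F_zero := H.G_zero
  left_inv := H.right_inv
  right_inv := H.left_inv
  c11F := H.c11G
  c11G := H.c11F
  DG_DF := H.DF_DG
  DF_DG := H.DG_DF
  P_add x := by rw [add_comm, H.P_add]
  P_idem x := by rw [Pc_eq H (H.Pc x), P_Pc, sub_zero]
  P_comm := H.Pc_comm
  Pc_comm := H.P_comm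
  norm_P := H.norm_Pc
  norm_Pc := H.norm_P
  contract := H.expand
  expand := H.contract

/-! ### The constant coefficient equation and its perturbations -/

/-- The estimate by Green's function for the linearization at the origin on an interval; the stable
component is prescribed at the left end and the unstable component at the right end. -/
theorem green {a b : ℤ} {W : ℤ → X} {e : ℤ → ℝ}
    (he : ∀ n ∈ Finset.Ico a b, ‖W (n + 1) - H.DF 0 (W n)‖ ≤ e n) :
    ∀ n ∈ Finset.Icc a b, ‖W n‖ ≤ decay H.r (n - a) * ‖H.P (W a)‖
      + decay H.r (n - b) * ‖H.Pc (W b)‖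
      + H.r * ∑ m ∈ Finset.Ico a b, decay H.r (n - m) * e m := by
  have hr := H.one_lt
  have hr0 := H.r_pos
  have hstable : ∀ n, a ≤ n → n ≤ b → ‖H.P (W n)‖ ≤ decay H.r (n - a) * ‖H.P (W a)‖
      + H.r * ∑ m ∈ Finset.Ico a n, decay H.r (n - m) * e m := by
    intro n hn
    induction n, hn using Int.leInduction with
    | base => simp
    | succ n hn ih =>
      intro hnb
      have h1 := ih (by omega)
      have h2 := he n (Finset.mem_Ico.2 ⟨hn, by omega⟩)
      have hstep : ∀ l ≤ n, decay H.r (n + 1 - l) = H.r⁻¹ * decay H.r (n - l) := fun l hl => by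
        rw [decay_of_nonneg (by omega), decay_of_nonneg (by omega), ← zpow_neg_one,
          ← zpow_add₀ hr0.ne']
        congr 1; ring
      have h3 : H.P (W (n + 1)) = H.DF 0 (H.P (W n)) + H.P (W (n + 1) - H.DF 0 (W n)) := by
        rw [map_sub, H.P_comm]; abel
      have h4 : ‖H.P (W (n + 1))‖ ≤ H.r⁻¹ * ‖H.P (W n)‖ + e n := by
        rw [h3]
        exact (norm_add_le _ _).trans (add_le_add (H.contract _) ((H.norm_P _).trans h2))
      have h5 : Finset.Ico a (n + 1) = insert n (Finset.Ico a n) := by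
        ext l; simp only [Finset.mem_Ico, Finset.mem_insert]; omega
      rw [h5, Finset.sum_insert (by simp), hstep a hn, hstep n le_rfl]
      have h6 : ∑ m ∈ Finset.Ico a n, decay H.r (n + 1 - m) * e m
          = H.r⁻¹ * ∑ m ∈ Finset.Ico a n, decay H.r (n - m) * e m := by
        rw [Finset.mul_sum]
        refine Finset.sum_congr rfl fun m hm => ?_
        rw [hstep m (Finset.mem_Ico.1 hm).2.le]; ring
      rw [h6]
      have h7 := mul_le_mul_of_nonneg_left h1 (inv_nonneg.2 hr0.le)
      have h8 : H.r * (H.r⁻¹ * decay H.r (n - n) * e n) = e n := by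
        rw [sub_self, decay_zero]; field_simp
      rw [mul_add H.r, h8]
      calc ‖H.P (W (n + 1))‖ ≤ _ := h4
        _ ≤ _ := add_le_add_left h7 _
        _ = _ := by ring
  have hunstable : ∀ n, n ≤ b → a ≤ n → ‖H.Pc (W n)‖ ≤ decay H.r (n - b) * ‖H.Pc (W b)‖
      + H.r * ∑ m ∈ Finset.Ico n b, decay H.r (n - m) * e m := by
    intro n hn
    induction n, hn using Int.leInductionDown with
    | base => simp
    | pred n hn ih =>
      intro han
      have h1 := ih (by omega)
      have h2 := he (n - 1) (Finset.mem_Ico.2 ⟨han, by omega⟩)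
      rw [sub_add_cancel] at h2
      have hstep : ∀ l, n ≤ l → decay H.r (n - 1 - l) = H.r⁻¹ * decay H.r (n - l) := fun l hl => by
        rw [decay_of_nonpos (by omega), decay_of_nonpos (by omega), ← zpow_neg_one,
          ← zpow_add₀ hr0.ne']
        congr 1; ring
      have h3 : H.Pc (W (n - 1)) = H.DG 0 (H.Pc (W n - (W n - H.DF 0 (W (n - 1))))) := by
        rw [sub_sub_cancel, H.Pc_comm_DF, H.DG_DF_zero]
      have h4 : ‖H.Pc (W (n - 1))‖ ≤ H.r⁻¹ * (‖H.Pc (W n)‖ + e (n - 1)) := by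
        rw [h3]
        refine (H.expand _).trans (mul_le_mul_of_nonneg_left ?_ (inv_nonneg.2 hr0.le))
        rw [map_sub]
        exact (norm_sub_le _ _).trans (add_le_add le_rfl ((H.norm_Pc _).trans h2))
      have h5 : Finset.Ico (n - 1) b = insert (n - 1) (Finset.Ico n b) := by
        ext l; simp only [Finset.mem_Ico, Finset.mem_insert]; omega
      rw [h5, Finset.sum_insert (by simp), hstep b hn, sub_self, decay_zero, one_mul]
      have h6 : ∑ m ∈ Finset.Ico n b, decay H.r (n - 1 - m) * e m
          = H.r⁻¹ * ∑ m ∈ Finset.Ico n b, decay H.r (n - m) * e m := by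
        rw [Finset.mul_sum]
        refine Finset.sum_congr rfl fun m hm => ?_
        rw [hstep m (Finset.mem_Ico.1 hm).1]; ring
      rw [h6]
      have h7 := mul_le_mul_of_nonneg_left h1 (inv_nonneg.2 hr0.le)
      have h8 : H.r⁻¹ * e (n - 1) ≤ H.r * e (n - 1) :=
        mul_le_mul_of_nonneg_right ((inv_le_one_of_one_le₀ hr.le).trans hr.le)
          ((norm_nonneg _).trans h2)
      calc ‖H.Pc (W (n - 1))‖ ≤ _ := h4
        _ = H.r⁻¹ * ‖H.Pc (W n)‖ + H.r⁻¹ * e (n - 1) := by ring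
        _ ≤ _ := add_le_add h7 h8
        _ = _ := by ring
  intro n hn
  obtain ⟨h1, h2⟩ := Finset.mem_Icc.1 hn
  have h3 := hstable n h1 h2
  have h4 := hunstable n h2 h1
  have h5 : ∑ m ∈ Finset.Ico a b, decay H.r (n - m) * e m
      = ∑ m ∈ Finset.Ico a n, decay H.r (n - m) * e m
        + ∑ m ∈ Finset.Ico n b, decay H.r (n - m) * e m := by
    rw [← Finset.sum_union (Finset.Ico_disjoint_Ico_consecutive a n b),
      Finset.Ico_union_Ico_eq_Ico h1 h2]
  rw [h5, mul_add]
  linarith [H.norm_le_add (W n)]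

/-- A version of `green` with a uniform bound of the right-hand side. -/
theorem green_of_le {a b : ℤ} {W : ℤ → X} {e : ℝ} (he0 : 0 ≤ e)
    (he : ∀ n ∈ Finset.Ico a b, ‖W (n + 1) - H.DF 0 (W n)‖ ≤ e) :
    ∀ n ∈ Finset.Icc a b, ‖W n‖ ≤ decay H.r (n - a) * ‖H.P (W a)‖
      + decay H.r (n - b) * ‖H.Pc (W b)‖ + H.r * (decaySum H.r * e) := by
  intro n hn
  refine (H.green (e := fun _ => e) he n hn).trans (add_le_add le_rfl ?_)
  rw [← Finset.sum_mul]
  exact mul_le_mul_of_nonneg_left (mul_le_mul_of_nonneg_right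
    (sum_decay_sub_left_le H.one_lt _ _) he0) H.r_pos.le

/-- A summable perturbation of the linearization obeys the same estimate. -/
theorem green_perturbed {a b : ℤ} {W : ℤ → X} {η g : ℤ → ℝ} (hη : ∀ n, 0 ≤ η n)
    (hg : ∀ n, 0 ≤ g n) (hsum : H.r * ∑ m ∈ Finset.Icc a b, η m ≤ 1 / 2)
    (he : ∀ n ∈ Finset.Ico a b, ‖W (n + 1) - H.DF 0 (W n)‖ ≤ η n * ‖W n‖ + g n) :
    ∀ n ∈ Finset.Icc a b, ‖W n‖ ≤ 2 * (decay H.r (n - a) * ‖H.P (W a)‖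
      + decay H.r (n - b) * ‖H.Pc (W b)‖
      + H.r * ∑ m ∈ Finset.Ico a b, decay H.r (n - m) * g m) := by
  have hr := H.one_lt
  have hr0 := H.r_pos
  have hφ : SlowlyVarying H.r (fun n => decay H.r (n - a) * ‖H.P (W a)‖
      + decay H.r (n - b) * ‖H.Pc (W b)‖
      + H.r * ∑ m ∈ Finset.Ico a b, decay H.r (n - m) * g m) := by
    simp_rw [mul_comm _ ‖_‖]
    exact ((((slowlyVarying_decay hr a).const_mul (norm_nonneg _)).add
      ((slowlyVarying_decay hr b).const_mul (norm_nonneg _)))).add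
      ((slowlyVarying_sum hr _ hg).const_mul hr0.le)
  refine gronwall_of_sum_le hr (Finset.Icc a b) hφ (η := fun m => H.r * η m)
    (fun m => mul_nonneg hr0.le (hη m)) (by rwa [← Finset.mul_sum]) fun n hn => ?_
  refine (H.green he n hn).trans ?_
  have h1 : H.r * ∑ m ∈ Finset.Ico a b, decay H.r (n - m) * (η m * ‖W m‖)
      ≤ ∑ m ∈ Finset.Icc a b, decay H.r (n - m) * (H.r * η m * ‖W m‖) := by
    rw [Finset.mul_sum]
    refine le_trans (le_of_eq (Finset.sum_congr rfl fun m _ => by ring))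
      (Finset.sum_le_sum_of_subset_of_nonneg Finset.Ico_subset_Icc_self fun m _ _ => ?_)
    have := decay_nonneg hr (n - m)
    have := hη m
    positivity
  simp_rw [mul_add (decay H.r _)]
  rw [Finset.sum_add_distrib, mul_add]
  linarith

/-- Near the origin a bounded forward solution is controlled by its initial stable component. -/
theorem le_two_mul_of_bounded {a : ℤ} {W : ℤ → X} {ε s₀ : ℝ} (hε : 0 ≤ ε)
    (hsmall : H.r * (decaySum H.r * ε) ≤ 1 / 2) (hbdd : ∀ n, a ≤ n → ‖W n‖ ≤ s₀)
    (he : ∀ n, a ≤ n → ‖W (n + 1) - H.DF 0 (W n)‖ ≤ ε * ‖W n‖) :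
    ∀ n, a ≤ n → ‖W n‖ ≤ 2 * ‖H.P (W a)‖ := by
  refine le_two_mul_of_halving {n | a ≤ n} (fun n => ‖W n‖) hbdd fun s hs n hn => ?_
  have hs0 : 0 ≤ s := (norm_nonneg _).trans (hs a (le_refl a))
  refine le_of_forall_decay H.one_lt (c := s) n ?_
  filter_upwards [eventually_ge_atTop n.toNat] with k hk
  have hk' : n ≤ k := Int.toNat_le.1 hk
  have hk2 : a ≤ k := le_trans hn hk'
  have h1 := H.green_of_le (a := a) (b := k) (W := W) (mul_nonneg hε hs0) (fun l hl =>
    (he l (Finset.mem_Ico.1 hl).1).trans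
      (mul_le_mul_of_nonneg_left (hs l (Finset.mem_Ico.1 hl).1) hε)) n (Finset.mem_Icc.2 ⟨hn, hk'⟩)
  have h2 : decay H.r (n - a) * ‖H.P (W a)‖ ≤ ‖H.P (W a)‖ :=
    mul_le_of_le_one_left (norm_nonneg _) (decay_le_one H.one_lt _)
  have h3 : decay H.r (n - k) * ‖H.Pc (W k)‖ ≤ s * decay H.r (n - k) := by
    rw [mul_comm]
    exact mul_le_mul_of_nonneg_right ((H.norm_Pc _).trans (hs k hk2)) (decay_nonneg H.one_lt _)
  have h4 : H.r * (decaySum H.r * (ε * s)) ≤ s / 2 := by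
    have := mul_le_mul_of_nonneg_right hsmall hs0
    linarith
  linarith

/-! ### Orbits near the origin -/

theorem exists_norm_sub_DF_zero_le : ∃ K, 0 ≤ K ∧ ∀ x y : X, ‖x‖ ≤ 1 → ‖y‖ ≤ 1 →
    ‖H.F y - H.F x - H.DF 0 (y - x)‖ ≤ K * (‖x‖ + ‖y‖) * ‖y - x‖ := by
  obtain ⟨K, hK, h, -⟩ := H.c11F 1
  exact ⟨K, hK, fun x y hx hy => by simpa using h x y 0 hx hy (by simp)⟩

/-- Near the origin, orbits decay from the ends of their time interval at the full rate. -/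
theorem exists_small_orbit_bound : ∃ δ, 0 < δ ∧ δ ≤ 1 ∧ ∀ (a b : ℤ) (U : ℤ → X), a ≤ b →
    (∀ n ∈ Finset.Ico a b, U (n + 1) = H.F (U n)) → (∀ n ∈ Finset.Icc a b, ‖U n‖ ≤ δ) →
    ∀ n ∈ Finset.Icc a b, ‖U n‖ ≤ 2 * (‖U a‖ * decay H.r (n - a) + ‖U b‖ * decay H.r (n - b)) := by
  obtain ⟨K, hK, hF⟩ := H.exists_norm_sub_DF_zero_le
  have hr := H.one_lt
  have hr0 := H.r_pos
  have hκ := decaySum_pos hr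
  set q := H.r * K * decaySum H.r with hq
  have hq0 : 0 ≤ q := by positivity
  refine ⟨1 / (8 * (q + 1)), by positivity, ?_, ?_⟩
  · rw [div_le_one (by positivity)]; linarith
  intro a b U hab hU hsmall
  set δ := 1 / (8 * (q + 1)) with hδ
  have hδ1 : δ ≤ 1 := by rw [hδ, div_le_one (by positivity)]; linarith
  have hqδ : q * δ ≤ 1 / 8 := by
    rw [hδ, mul_one_div, div_le_div_iff₀ (by positivity) (by norm_num)]; linarith
  have hha := hsmall a (Finset.mem_Icc.2 ⟨le_rfl, hab⟩)
  have hhb := hsmall b (Finset.mem_Icc.2 ⟨hab, le_rfl⟩)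
  have key := quadratic_gronwall hr (Finset.Icc a b) (w := fun n => ‖U n‖) (α := ‖U a‖)
    (β := ‖U b‖) (C := 1) (c := H.r * K) (δ := δ) (a := a) (b := b) zero_le_one (by positivity)
    (norm_nonneg _) (norm_nonneg _) hha hhb (fun _ => norm_nonneg _) hsmall
    (by rw [show H.r * K * δ * decaySum H.r = q * δ by rw [hq]; ring]; linarith)
    (by rw [show H.r * K * (2 * decaySum H.r * (1 * δ + 1 * δ)) = 4 * (q * δ) by rw [hq]; ring]
        linarith) ?_
  · simpa using key
  intro n hn
  refine (H.green (e := fun m => K * ‖U m‖ ^ 2) (fun m hm => ?_) n hn).trans ?_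
  · have hm' := hsmall m (Finset.Ico_subset_Icc_self hm)
    have := hF 0 (U m) (by simp) (hm'.trans hδ1)
    rw [hU m hm]
    simpa [H.F_zero, pow_two, mul_assoc] using this
  · have h1 := mul_le_mul_of_nonneg_left (H.norm_P (U a)) (decay_nonneg hr (n - a))
    have h2 := mul_le_mul_of_nonneg_left (H.norm_Pc (U b)) (decay_nonneg hr (n - b))
    have h3 : ∑ m ∈ Finset.Ico a b, decay H.r (n - m) * (K * ‖U m‖ ^ 2)
        ≤ K * ∑ m ∈ Finset.Icc a b, decay H.r (n - m) * ‖U m‖ ^ 2 := by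
      rw [Finset.mul_sum]
      refine (Finset.sum_le_sum_of_subset_of_nonneg Finset.Ico_subset_Icc_self
        fun m _ _ => ?_).trans (le_of_eq (Finset.sum_congr rfl fun m _ => by ring))
      have := decay_nonneg hr (n - m)
      positivity
    have h4 := mul_le_mul_of_nonneg_left h3 hr0.le
    linarith

/-- An orbit that converges to the origin does so at the full rate. -/
theorem exists_decay_bound {Q : ℤ → X} (hQ : ∀ n, Q (n + 1) = H.F (Q n))
    (h0 : Tendsto (fun k : ℕ => Q k) atTop (𝓝 0)) :
    ∃ C, 0 ≤ C ∧ ∀ n, 0 ≤ n → ‖Q n‖ ≤ C * decay H.r n := by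
  obtain ⟨δ, hδ, hδ1, hb⟩ := H.exists_small_orbit_bound
  have hr := H.one_lt
  have h0' : Tendsto (fun k : ℕ => ‖Q k‖) atTop (𝓝 0) := by simpa using h0.norm
  obtain ⟨k₀, hk₀⟩ := eventually_atTop.1 (h0'.eventually (ge_mem_nhds hδ))
  have hsmall : ∀ n : ℤ, k₀ ≤ n → ‖Q n‖ ≤ δ := fun n hn => by
    lift n to ℕ using by omega
    exact hk₀ n (by exact_mod_cast hn)
  have hfar : ∀ n : ℤ, k₀ ≤ n → ‖Q n‖ ≤ 2 * δ * decay H.r (n - k₀) := by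
    intro n hn
    refine le_of_forall_decay hr (c := 2 * δ) n ?_
    filter_upwards [eventually_ge_atTop n.toNat] with k hk
    have hk' : n ≤ k := Int.toNat_le.1 hk
    refine (hb k₀ k Q (hn.trans hk') (fun m _ => hQ m)
      (fun m hm => hsmall m (Finset.mem_Icc.1 hm).1) n (Finset.mem_Icc.2 ⟨hn, hk'⟩)).trans ?_
    have h1 := mul_le_mul_of_nonneg_right (hsmall k₀ le_rfl) (decay_nonneg hr (n - k₀))
    have h2 := mul_le_mul_of_nonneg_right (hsmall k (hn.trans hk')) (decay_nonneg hr (n - k))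
    linarith
  refine ⟨∑ n ∈ Finset.Ico (0 : ℤ) k₀, H.r ^ n * ‖Q n‖ + 2 * δ * H.r ^ (k₀ : ℤ), ?_, ?_⟩
  · have := H.r_pos; positivity
  intro n hn
  have hsum : 0 ≤ ∑ n ∈ Finset.Ico (0 : ℤ) k₀, H.r ^ n * ‖Q n‖ := by
    have := H.r_pos; positivity
  have hp : 0 ≤ 2 * δ * H.r ^ (k₀ : ℤ) := by have := H.r_pos; positivity
  rcases lt_or_ge n k₀ with h | h
  · have h1 : H.r ^ n * ‖Q n‖ ≤ ∑ n ∈ Finset.Ico (0 : ℤ) k₀, H.r ^ n * ‖Q n‖ :=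
      Finset.single_le_sum (f := fun n : ℤ => H.r ^ n * ‖Q n‖)
        (fun m _ => by have := H.r_pos; positivity) (Finset.mem_Ico.2 ⟨hn, h⟩)
    calc ‖Q n‖ = H.r ^ n * ‖Q n‖ * decay H.r n := by
          rw [decay_of_nonneg hn, zpow_neg, mul_right_comm,
            mul_inv_cancel₀ (zpow_pos H.r_pos n).ne', one_mul]
      _ ≤ _ := mul_le_mul_of_nonneg_right (by linarith) (decay_nonneg hr _)
  · refine (hfar n h).trans ?_
    have h1 : decay H.r (n - k₀) ≤ H.r ^ (k₀ : ℤ) * decay H.r n := by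
      have := decay_le_mul hr n (-(k₀ : ℤ))
      simpa [sub_eq_add_neg] using this
    calc 2 * δ * decay H.r (n - k₀) ≤ 2 * δ * (H.r ^ (k₀ : ℤ) * decay H.r n) := by gcongr
      _ = 2 * δ * H.r ^ (k₀ : ℤ) * decay H.r n := by ring
      _ ≤ _ := mul_le_mul_of_nonneg_right (by linarith) (decay_nonneg hr _)

end HypDiffeo

/-! ### The linearization along a homoclinic orbit -/

theorem IsC11.hasFDerivAt {X : Type*} [NormedAddCommGroup X] [NormedSpace ℝ X] {F : X → X}
    {DF : X → X →L[ℝ] X} (h : IsC11 F DF) (x : X) : HasFDerivAt F (DF x) x := by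
  obtain ⟨K, hK, hF, -⟩ := h (‖x‖ + 1)
  rw [hasFDerivAt_iff_isLittleO, Asymptotics.isLittleO_iff]
  intro c hc
  have h1 : ∀ᶠ y in 𝓝 x, ‖y - x‖ < min 1 (c / (K + 1)) := by
    have := Metric.ball_mem_nhds x (ε := min 1 (c / (K + 1))) (by positivity)
    filter_upwards [this] with y hy
    rwa [← dist_eq_norm]
  filter_upwards [h1] with y hy
  obtain ⟨hy1, hy2⟩ := lt_min_iff.1 hy
  have h2 : ‖y‖ ≤ ‖x‖ + 1 := by
    have := norm_add_le x (y - x)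
    rw [add_sub_cancel] at this
    linarith
  have h3 := hF x y x (by linarith) h2 (by linarith)
  rw [sub_self, norm_zero, zero_add] at h3
  refine h3.trans (mul_le_mul_of_nonneg_right ?_ (norm_nonneg _))
  rw [lt_div_iff₀ (by positivity)] at hy2
  have := norm_nonneg (y - x)
  nlinarith

namespace HypDiffeo

variable {X : Type*} [NormedAddCommGroup X] [NormedSpace ℝ X] (H : HypDiffeo X)

/-- `Q` is an orbit that converges to the origin at the full rate in both time directions. -/
structure IsHomoclinic (Q : ℤ → X) : Prop where
  orbit : ∀ n, Q (n + 1) = H.F (Q n)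
  bound : ∃ C, 0 ≤ C ∧ ∀ n, ‖Q n‖ ≤ C * decay H.r n

/-- The products of the linearizations `DF` along the forward orbit `Q`. -/
def linFlow (Q : ℤ → X) : ℕ → X →L[ℝ] X
  | 0 => ContinuousLinearMap.id ℝ X
  | k + 1 => (H.DF (Q k)).comp (linFlow Q k)

/-- The initial values of bounded forward solutions of the equation linearized along `Q`. -/
def stableSpace (Q : ℤ → X) : Submodule ℝ X where
  carrier := {v | ∃ C, ∀ k, ‖H.linFlow Q k v‖ ≤ C}
  add_mem' := by
    rintro v w ⟨C, hC⟩ ⟨D, hD⟩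
    refine ⟨C + D, fun k => ?_⟩
    rw [map_add]
    exact (norm_add_le _ _).trans (add_le_add (hC k) (hD k))
  zero_mem' := ⟨0, fun k => by simp⟩
  smul_mem' := by
    rintro c v ⟨C, hC⟩
    refine ⟨‖c‖ * C, fun k => ?_⟩
    rw [map_smul, norm_smul]
    exact mul_le_mul_of_nonneg_left (hC k) (norm_nonneg _)

variable {H} {Q : ℤ → X}

theorem linFlow_injective (k : ℕ) :
    Function.Injective (H.linFlow Q k) := by
  induction k with
  | zero => exact fun _ _ h => h
  | succ k ih =>
    intro v w h
    have h1 := congrArg (H.DG (H.F (Q k))) h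
    simp only [linFlow, ContinuousLinearMap.comp_apply, H.DG_DF] at h1
    exact ih h1

/-- Bounds beyond some time imply membership in the stable space. -/
theorem mem_stableSpace_of_le {v : X} {K : ℕ} {C : ℝ}
    (h : ∀ k, K ≤ k → ‖H.linFlow Q k v‖ ≤ C) : v ∈ H.stableSpace Q := by
  refine ⟨|C| + ∑ j ∈ Finset.range K, ‖H.linFlow Q j v‖, fun k => ?_⟩
  have h0 : 0 ≤ ∑ j ∈ Finset.range K, ‖H.linFlow Q j v‖ :=
    Finset.sum_nonneg fun _ _ => norm_nonneg _
  rcases le_or_gt K k with hk | hk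
  · have := h k hk
    have := le_abs_self C
    linarith
  · have h1 := Finset.single_le_sum (f := fun j => ‖H.linFlow Q j v‖)
      (fun _ _ => norm_nonneg _) (Finset.mem_range.2 hk)
    have := abs_nonneg C
    linarith

namespace IsHomoclinic

theorem reverse (hQ : H.IsHomoclinic Q) : H.reverse.IsHomoclinic (fun n => Q (-n)) where
  orbit n := by
    have h := hQ.orbit (-(n + 1))
    rw [show -(n + 1) + 1 = -n by ring] at h
    change Q (-(n + 1)) = H.G (Q (-n))
    rw [h, H.left_inv]
  bound := by
    obtain ⟨C, hC, h⟩ := hQ.bound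
    exact ⟨C, hC, fun n => by
      have := h (-n)
      rwa [decay_neg] at this⟩

theorem bounded (hQ : H.IsHomoclinic Q) : ∃ R, 0 ≤ R ∧ ∀ n, ‖Q n‖ ≤ R := by
  obtain ⟨C, hC, h⟩ := hQ.bound
  exact ⟨C, hC, fun n => (h n).trans (mul_le_of_le_one_right hC (decay_le_one H.one_lt n))⟩

theorem exists_norm_le (hQ : H.IsHomoclinic Q) {ε : ℝ} (hε : 0 < ε) :
    ∃ k : ℕ, ∀ n : ℤ, (k : ℤ) ≤ |n| → ‖Q n‖ ≤ ε := by
  obtain ⟨C, hC, h⟩ := hQ.bound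
  obtain ⟨k, hk⟩ := exists_decay_le H.one_lt (ε := ε / (C + 1)) (by positivity)
  refine ⟨k, fun n hn => (h n).trans ?_⟩
  calc C * decay H.r n ≤ (C + 1) * (ε / (C + 1)) :=
        mul_le_mul (by linarith) (hk n hn) (decay_nonneg H.one_lt _) (by linarith)
    _ = ε := by field_simp

theorem exists_norm_DF_sub_le (hQ : H.IsHomoclinic Q) :
    ∃ C, 0 ≤ C ∧ ∀ n v, ‖H.DF (Q n) v - H.DF 0 v‖ ≤ C * decay H.r n * ‖v‖ := by
  obtain ⟨R, hR, hb⟩ := hQ.bounded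
  obtain ⟨C, hC, h⟩ := hQ.bound
  obtain ⟨K, hK, -, hF⟩ := H.c11F R
  refine ⟨K * C, by positivity, fun n v => ?_⟩
  rw [← sub_apply]
  refine (ContinuousLinearMap.le_opNorm _ _).trans
    (mul_le_mul_of_nonneg_right ?_ (norm_nonneg _))
  have := hF (Q n) 0 (hb n) (by simpa using hR)
  rw [sub_zero] at this
  rw [mul_assoc]
  exact this.trans (mul_le_mul_of_nonneg_left (h n) hK)

theorem exists_norm_DF_le (hQ : H.IsHomoclinic Q) :
    ∃ C, 0 ≤ C ∧ ∀ n v, ‖H.DF (Q n) v‖ ≤ C * ‖v‖ := by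
  obtain ⟨C, hC, h⟩ := hQ.exists_norm_DF_sub_le
  refine ⟨C + ‖H.DF 0‖, by positivity, fun n v => ?_⟩
  have h1 := norm_add_le (H.DF (Q n) v - H.DF 0 v) (H.DF 0 v)
  rw [sub_add_cancel] at h1
  have h2 := (H.DF 0).le_opNorm v
  have h3 := h n v
  have h4 : C * decay H.r n * ‖v‖ ≤ C * ‖v‖ := mul_le_mul_of_nonneg_right
    (mul_le_of_le_one_right hC (decay_le_one H.one_lt n)) (norm_nonneg _)
  linarith

/-- Far along the orbit, the linearization is a small perturbation of the one at the origin. -/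
theorem exists_small_tail (hQ : H.IsHomoclinic Q) {ε : ℝ} (hε : 0 < ε) :
    ∃ k : ℕ, ∀ n : ℤ, (k : ℤ) ≤ |n| → ∀ v, ‖H.DF (Q n) v - H.DF 0 v‖ ≤ ε * ‖v‖ := by
  obtain ⟨C, hC, h⟩ := hQ.exists_norm_DF_sub_le
  obtain ⟨k, hk⟩ := exists_decay_le H.one_lt (ε := ε / (C + 1)) (by positivity)
  refine ⟨k, fun n hn v => (h n v).trans (mul_le_mul_of_nonneg_right ?_ (norm_nonneg _))⟩
  calc C * decay H.r n ≤ (C + 1) * (ε / (C + 1)) :=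
        mul_le_mul (by linarith) (hk n hn) (decay_nonneg H.one_lt _) (by linarith)
    _ = ε := by field_simp

/-- Velocities of curves of forward orbits that converge uniformly to the origin are initial values
of bounded solutions of the linearized equation. -/
theorem mem_stableSpace (hQ : H.IsHomoclinic Q) {Γ : ℝ → ℕ → X} {v : X}
    (hΓ : ∀ s k, Γ s (k + 1) = H.F (Γ s k))
    (hunif : ∀ ε, 0 < ε → ∃ K, ∀ k, K ≤ k → ∀ s, ‖Γ s k‖ ≤ ε) (h0 : ∀ k : ℕ, Γ 0 k = Q k)
    (hv : Tendsto (fun s : ℝ => s⁻¹ • (Γ s 0 - Q 0)) (𝓝[≠] 0) (𝓝 v)) :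
    v ∈ H.stableSpace Q := by
  have hlim : ∀ k : ℕ, Tendsto (fun s : ℝ => s⁻¹ • (Γ s k - Q k)) (𝓝[≠] 0)
      (𝓝 (H.linFlow Q k v)) := by
    intro k
    induction k with
    | zero => simpa [linFlow] using hv
    | succ k ih =>
      have h1 := (H.c11F.hasFDerivAt (Q k)).hasFDerivWithinAt (s := Set.univ)
      have hd : Tendsto (fun s : ℝ => Γ s k - Q k) (𝓝[≠] 0) (𝓝 0) := by
        have h4 : Tendsto (fun s : ℝ => s) (𝓝[≠] 0) (𝓝 0) :=
          tendsto_id.mono_left nhdsWithin_le_nhds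
        have h5 := h4.smul ih
        rw [zero_smul] at h5
        refine h5.congr' ?_
        filter_upwards [self_mem_nhdsWithin] with s hs
        rw [smul_inv_smul₀ hs]
      have h2 := h1.lim (c := fun s : ℝ => s⁻¹) (v := H.linFlow Q k v) hd (by simp) ih
      simp only [add_sub_cancel] at h2
      simpa [hΓ, hQ.orbit, linFlow] using h2
  obtain ⟨K, hK, hF⟩ := H.exists_norm_sub_DF_zero_le
  have hr0 := H.r_pos
  have hκ := decaySum_pos H.one_lt
  set ε := min 1 (1 / (4 * (H.r * decaySum H.r * K + 1))) with hε
  have hε0 : 0 < ε := by positivity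
  have hsm : H.r * (decaySum H.r * (K * (2 * ε))) ≤ 1 / 2 := by
    have h1 : ε ≤ 1 / (4 * (H.r * decaySum H.r * K + 1)) := min_le_right _ _
    rw [le_div_iff₀ (by positivity)] at h1
    nlinarith
  obtain ⟨k₀, hk₀⟩ := hunif ε hε0
  have hQ0 : ∀ k : ℕ, k₀ ≤ k → ‖Q k‖ ≤ ε := fun k hk => by rw [← h0 k]; exact hk₀ k hk 0
  have hD : ∀ s, ∀ k : ℕ, k₀ ≤ k → ‖Γ s k - Q k‖ ≤ 2 * ‖Γ s k₀ - Q k₀‖ := by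
    intro s k hk
    have h1 := H.le_two_mul_of_bounded (a := k₀) (W := fun n : ℤ => Γ s n.toNat - Q n)
      (ε := K * (2 * ε)) (s₀ := 2 * ε) (by positivity) hsm ?_ ?_ k (by exact_mod_cast hk)
    · simpa using h1.trans (mul_le_mul_of_nonneg_left (H.norm_P _) zero_le_two)
    · intro n hn
      lift n to ℕ using by omega
      have hn' : k₀ ≤ n := by exact_mod_cast hn
      have := hk₀ n hn' s
      have := hQ0 n hn'
      have := norm_sub_le (Γ s n) (Q n)
      simp only [Int.toNat_natCast]
      linarith
    · intro n hn
      lift n to ℕ using by omega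
      have hn' : k₀ ≤ n := by exact_mod_cast hn
      have h2 := hk₀ n hn' s
      have h3 := hQ0 n hn'
      have h4 : ((n : ℤ) + 1).toNat = n + 1 := by omega
      have h5 := hF (Q n) (Γ s n) (h3.trans (min_le_left _ _)) (h2.trans (min_le_left _ _))
      simp only [h4, hΓ, hQ.orbit, Int.toNat_natCast]
      refine h5.trans (mul_le_mul_of_nonneg_right (mul_le_mul_of_nonneg_left ?_ hK)
        (norm_nonneg _))
      linarith
  refine mem_stableSpace_of_le (K := k₀) (C := 2 * ‖H.linFlow Q k₀ v‖) fun k hk => ?_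
  refine le_of_tendsto_of_tendsto' (hlim k).norm ((hlim k₀).norm.const_mul 2) fun s => ?_
  rw [norm_smul, norm_smul, mul_left_comm]
  exact mul_le_mul_of_nonneg_left (hD s k hk) (norm_nonneg _)

section FiniteDimensional
variable [FiniteDimensional ℝ X]

theorem finrank_stableSpace_le (hQ : H.IsHomoclinic Q) :
    Module.finrank ℝ (H.stableSpace Q) ≤ Module.finrank ℝ (LinearMap.range (H.P : X →ₗ[ℝ] X)) := by
  have hr0 := H.r_pos
  have hκ := decaySum_pos H.one_lt
  obtain ⟨k, hk⟩ := hQ.exists_small_tail (ε := 1 / (2 * (H.r * decaySum H.r))) (by positivity)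
  let L : H.stableSpace Q →ₗ[ℝ] LinearMap.range (H.P : X →ₗ[ℝ] X) :=
    (LinearMap.rangeRestrict (H.P : X →ₗ[ℝ] X)).comp
      ((H.linFlow Q k : X →ₗ[ℝ] X).comp (H.stableSpace Q).subtype)
  refine LinearMap.finrank_le_finrank_of_injective (f := L)
    ((injective_iff_map_eq_zero L).2 fun v hv => ?_)
  have hv0 : H.P (H.linFlow Q k v) = 0 := congrArg Subtype.val hv
  obtain ⟨C, hC⟩ := v.2
  have h1 := H.le_two_mul_of_bounded (a := k) (W := fun n : ℤ => H.linFlow Q n.toNat v)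
    (ε := 1 / (2 * (H.r * decaySum H.r))) (s₀ := C) (by positivity)
    (le_of_eq (by field_simp)) (fun n _ => hC _) ?_ k le_rfl
  · simp only [Int.toNat_natCast, hv0, norm_zero, mul_zero] at h1
    have h2 := norm_le_zero_iff.1 h1
    exact Subtype.ext (linFlow_injective k (by simpa using h2))
  · intro n hn
    lift n to ℕ using by omega
    have h4 : ((n : ℤ) + 1).toNat = n + 1 := by omega
    have h5 := hk n (hn.trans (le_abs_self _)) (H.linFlow Q n v)
    simpa [h4, linFlow] using h5

/-- Transversality and the count of dimensions leave no bounded solution of the linearized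
equation. -/
theorem inf_eq_bot (hQ : H.IsHomoclinic Q)
    (hT : H.stableSpace Q ⊔ H.reverse.stableSpace (fun n => Q (-n)) = ⊤) :
    H.stableSpace Q ⊓ H.reverse.stableSpace (fun n => Q (-n)) = ⊥ := by
  have h1 := hQ.finrank_stableSpace_le
  have h2 := hQ.reverse.finrank_stableSpace_le
  have h3 := Submodule.finrank_sup_add_finrank_inf_eq (H.stableSpace Q)
    (H.reverse.stableSpace (fun n => Q (-n)))
  rw [hT, finrank_top] at h3
  have h4 := LinearMap.finrank_range_add_finrank_ker (H.P : X →ₗ[ℝ] X)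
  have h5 : LinearMap.range (H.reverse.P : X →ₗ[ℝ] X) ≤ LinearMap.ker (H.P : X →ₗ[ℝ] X) := by
    rintro _ ⟨x, rfl⟩
    exact H.P_Pc x
  have h6 := Submodule.finrank_mono h5
  exact Submodule.finrank_eq_zero.1 (by omega)

end FiniteDimensional
end IsHomoclinic
end HypDiffeo

namespace HypDiffeo
namespace IsHomoclinic

variable {X : Type*} [NormedAddCommGroup X] [NormedSpace ℝ X] {H : HypDiffeo X} {Q : ℤ → X}

/-! ### The exponential dichotomy along a transverse homoclinic orbit -/

/-- Beyond some time, the linearization along `Q` is a summable perturbation of the linearization at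
the origin. -/
theorem exists_green_tail (hQ : H.IsHomoclinic Q) : ∃ k₀ : ℕ, ∀ (b : ℤ) (W : ℤ → X) (g : ℤ → ℝ),
    (∀ n, 0 ≤ g n) →
    (∀ n ∈ Finset.Ico (k₀ : ℤ) b, ‖W (n + 1) - H.DF (Q n) (W n)‖ ≤ g n) →
    ∀ n ∈ Finset.Icc (k₀ : ℤ) b, ‖W n‖ ≤ 2 * (decay H.r (n - k₀) * ‖W k₀‖
      + decay H.r (n - b) * ‖W b‖
      + H.r * ∑ m ∈ Finset.Ico (k₀ : ℤ) b, decay H.r (n - m) * g m) := by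
  have hr := H.one_lt
  have hr0 := H.r_pos
  have hκ := decaySum_pos hr
  obtain ⟨C, hC, hDF⟩ := hQ.exists_norm_DF_sub_le
  obtain ⟨k₀, hk₀⟩ := exists_decay_le hr (ε := 1 / (2 * (H.r * C * decaySum H.r + 1)))
    (by positivity)
  refine ⟨k₀, fun b W g hg hW n hn => ?_⟩
  have h1 : H.r * ∑ m ∈ Finset.Icc (k₀ : ℤ) b, C * decay H.r m ≤ 1 / 2 := by
    rw [← Finset.mul_sum]
    have h2 := sum_decay_le_of_far hr (Finset.Icc (k₀ : ℤ) b) k₀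
      (fun m hm => (Finset.mem_Icc.1 hm).1)
    have h3 := hk₀ k₀ (le_abs_self _)
    rw [le_div_iff₀ (by positivity)] at h3
    have h5 := decay_nonneg hr (k₀ : ℤ)
    calc H.r * (C * ∑ m ∈ Finset.Icc (k₀ : ℤ) b, decay H.r m)
        ≤ H.r * (C * (decaySum H.r * decay H.r k₀)) := by gcongr
      _ ≤ 1 / 2 := by nlinarith
  refine (H.green_perturbed (η := fun m => C * decay H.r m) (W := W) (fun m => ?_) hg h1
    (fun m hm => ?_) n hn).trans ?_
  · have := decay_nonneg hr m; positivity
  · have h2 := norm_add_le (W (m + 1) - H.DF (Q m) (W m)) (H.DF (Q m) (W m) - H.DF 0 (W m))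
    rw [sub_add_sub_cancel] at h2
    have := hW m hm
    have := hDF m (W m)
    linarith
  · have h2 := mul_le_mul_of_nonneg_left (H.norm_P (W k₀)) (decay_nonneg hr (n - k₀))
    have h3 := mul_le_mul_of_nonneg_left (H.norm_Pc (W b)) (decay_nonneg hr (n - b))
    linarith

/-- Limits of approximate solutions of the linearized equation on growing intervals, with small
weighted errors and boundary values, are initial values of bounded solutions. -/
theorem mem_stableSpace_of_tendsto (hQ : H.IsHomoclinic Q) {W : ℕ → ℤ → X} {g : ℕ → ℤ → ℝ}
    {b : ℕ → ℤ} {θ : ℕ → ℝ} {v : X} (hb : Tendsto b atTop atTop) (hg : ∀ j n, 0 ≤ g j n)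
    (hW : ∀ j, ∀ n ∈ Finset.Ico 0 (b j), ‖W j (n + 1) - H.DF (Q n) (W j n)‖ ≤ g j n)
    (hv : Tendsto (fun j => W j 0) atTop (𝓝 v)) (hθ : Tendsto θ atTop (𝓝 0))
    (hsmall : ∀ j, decay H.r (b j) * ‖W j (b j)‖
      + ∑ m ∈ Finset.Ico 0 (b j), decay H.r m * g j m ≤ θ j) : v ∈ H.stableSpace Q := by
  have hr := H.one_lt
  have hr0 := H.r_pos
  have hsum0 : ∀ j, 0 ≤ ∑ m ∈ Finset.Ico 0 (b j), decay H.r m * g j m := fun j =>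
    Finset.sum_nonneg fun m _ => mul_nonneg (decay_nonneg hr _) (hg j m)
  have hb0 : ∀ j, 0 ≤ decay H.r (b j) * ‖W j (b j)‖ := fun j =>
    mul_nonneg (decay_nonneg hr _) (norm_nonneg _)
  have hdec : ∀ (k : ℕ) (m : ℤ), decay H.r (k - m) ≤ H.r ^ k * decay H.r m := fun k m => by
    have := decay_le_mul hr (-m) k
    rwa [decay_neg, neg_add_eq_sub, Nat.abs_cast, zpow_natCast] at this
  have hsumk : ∀ (j k : ℕ), ∑ m ∈ Finset.Ico 0 (b j), decay H.r (k - m) * g j m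
      ≤ H.r ^ k * θ j := fun j k => by
    calc ∑ m ∈ Finset.Ico 0 (b j), decay H.r (k - m) * g j m
        ≤ ∑ m ∈ Finset.Ico 0 (b j), H.r ^ k * (decay H.r m * g j m) := by
          refine Finset.sum_le_sum fun m _ => ?_
          rw [← mul_assoc]
          exact mul_le_mul_of_nonneg_right (hdec k m) (hg j m)
      _ = H.r ^ k * ∑ m ∈ Finset.Ico 0 (b j), decay H.r m * g j m := by rw [Finset.mul_sum]
      _ ≤ _ := mul_le_mul_of_nonneg_left (by linarith [hsmall j, hb0 j]) (by positivity)
  have hlim : ∀ k : ℕ, Tendsto (fun j => W j k) atTop (𝓝 (H.linFlow Q k v)) := by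
    intro k
    induction k with
    | zero => simpa [linFlow] using hv
    | succ k ih =>
      have h1 := ((H.DF (Q k)).continuous.tendsto _).comp ih
      have h2 : Tendsto (fun j => W j (k + 1) - H.DF (Q k) (W j k)) atTop (𝓝 0) := by
        refine squeeze_zero_norm' ?_ (by simpa using hθ.const_mul (H.r ^ k))
        filter_upwards [hb.eventually_gt_atTop (k : ℤ)] with j hj
        have hk : (k : ℤ) ∈ Finset.Ico 0 (b j) := Finset.mem_Ico.2 ⟨by positivity, hj⟩
        refine (hW j k hk).trans (le_trans ?_ (hsumk j k))
        have := Finset.single_le_sum (f := fun m : ℤ => decay H.r (k - m) * g j m)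
          (fun m _ => mul_nonneg (decay_nonneg hr _) (hg j m)) hk
        simpa using this
      have h3 := h2.add h1
      simp only [Function.comp_apply, sub_add_cancel, zero_add] at h3
      simpa [linFlow] using h3
  obtain ⟨k₀, hk₀⟩ := hQ.exists_green_tail
  refine mem_stableSpace_of_le (K := k₀) (C := 2 * ‖H.linFlow Q k₀ v‖) fun k hk => ?_
  have hk' : (k₀ : ℤ) ≤ k := by exact_mod_cast hk
  have h1 : ∀ᶠ j in atTop, ‖W j k‖ ≤ 2 * (‖W j k₀‖ + H.r ^ k * θ j + H.r * (H.r ^ k * θ j)) := by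
    filter_upwards [hb.eventually_gt_atTop (k : ℤ)] with j hj
    have hsub : Finset.Ico (k₀ : ℤ) (b j) ⊆ Finset.Ico 0 (b j) :=
      Finset.Ico_subset_Ico_left (by positivity)
    have h2 := hk₀ (b j) (W j) (g j) (hg j) (fun n hn => hW j n (hsub hn)) k
      (Finset.mem_Icc.2 ⟨hk', hj.le⟩)
    have h3 : decay H.r (k - k₀) * ‖W j k₀‖ ≤ ‖W j k₀‖ :=
      mul_le_of_le_one_left (norm_nonneg _) (decay_le_one hr _)
    have h4 : decay H.r (k - b j) * ‖W j (b j)‖ ≤ H.r ^ k * θ j := by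
      calc decay H.r (k - b j) * ‖W j (b j)‖ ≤ H.r ^ k * decay H.r (b j) * ‖W j (b j)‖ :=
            mul_le_mul_of_nonneg_right (hdec k _) (norm_nonneg _)
        _ = H.r ^ k * (decay H.r (b j) * ‖W j (b j)‖) := by ring
        _ ≤ _ := mul_le_mul_of_nonneg_left (by linarith [hsmall j, hsum0 j]) (by positivity)
    have h5 : ∑ m ∈ Finset.Ico (k₀ : ℤ) (b j), decay H.r (k - m) * g j m ≤ H.r ^ k * θ j :=
      (Finset.sum_le_sum_of_subset_of_nonneg hsub fun m _ _ =>
        mul_nonneg (decay_nonneg hr _) (hg j m)).trans (hsumk j k)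
    have h6 := mul_le_mul_of_nonneg_left h5 hr0.le
    linarith
  have h2 := hθ.const_mul (H.r ^ k)
  have h3 := (((hlim k₀).norm.add h2).add (h2.const_mul H.r)).const_mul 2
  simp only [mul_zero, add_zero] at h3
  exact le_of_tendsto_of_tendsto (hlim k).norm h3 h1

/-- Reversing time turns approximate solutions of the linearized equation into such. -/
theorem exists_reverse_step_le (hQ : H.IsHomoclinic Q) : ∃ M, 1 ≤ M ∧ ∀ (W : ℤ → X) (n : ℤ),
    ‖W n - H.DG (Q (n + 1)) (W (n + 1))‖ ≤ M * ‖W (n + 1) - H.DF (Q n) (W n)‖ := by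
  obtain ⟨M, hM, h⟩ := hQ.reverse.exists_norm_DF_le
  refine ⟨M + 1, by linarith, fun W n => ?_⟩
  have h1 : W n - H.DG (Q (n + 1)) (W (n + 1))
      = -(H.DG (Q (n + 1)) (W (n + 1) - H.DF (Q n) (W n))) := by
    rw [map_sub, hQ.orbit, H.DG_DF]; abel
  rw [h1, norm_neg]
  have h2 := h (-(n + 1)) (W (n + 1) - H.DF (Q n) (W n))
  rw [neg_neg] at h2
  refine h2.trans (mul_le_mul_of_nonneg_right (by linarith) (norm_nonneg _))

theorem sum_reverse (r : ℝ) (a : ℤ) (g : ℤ → ℝ) (n : ℤ) :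
    ∑ m ∈ Finset.Ico 0 (-a), decay r (n - m) * g (-m - 1)
      = ∑ m ∈ Finset.Ico a 0, decay r (-n - 1 - m) * g m := by
  refine Finset.sum_nbij' (fun m => -m - 1) (fun m => -m - 1) ?_ ?_ ?_ ?_ ?_
  · intro m hm; simp only [Finset.mem_Ico] at hm ⊢; omega
  · intro m hm; simp only [Finset.mem_Ico] at hm ⊢; omega
  · intro m _; ring
  · intro m _; ring
  · intro m _
    rw [← decay_neg (n - m)]
    congr 2; ring

section FiniteDimensional
variable [FiniteDimensional ℝ X]

/-- Since the linearized equation has no bounded solution, the value at the center of a long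
interval is controlled by the weighted boundary values and errors; the constant comes from a
compactness argument. -/
theorem exists_center_bound (hQ : H.IsHomoclinic Q)
    (hT : H.stableSpace Q ⊔ H.reverse.stableSpace (fun n => Q (-n)) = ⊤) :
    ∃ L : ℕ, ∀ (a b : ℤ) (W : ℤ → X) (g : ℤ → ℝ), a ≤ -L → L ≤ b → (∀ n, 0 ≤ g n) →
      (∀ n ∈ Finset.Ico a b, ‖W (n + 1) - H.DF (Q n) (W n)‖ ≤ g n) →
      ‖W 0‖ ≤ L * (decay H.r a * ‖W a‖ + decay H.r b * ‖W b‖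
        + ∑ m ∈ Finset.Ico a b, decay H.r m * g m) := by
  have hr := H.one_lt
  have hr0 := H.r_pos
  by_contra! hcon
  choose a b W g ha hb hg hW hlt using hcon
  set φ : ℕ → ℝ := fun j => decay H.r (a j) * ‖W j (a j)‖ + decay H.r (b j) * ‖W j (b j)‖
        + ∑ m ∈ Finset.Ico (a j) (b j), decay H.r m * g j m with hφ
  have hsum0 : ∀ (j : ℕ) (S : Finset ℤ), 0 ≤ ∑ m ∈ S, decay H.r m * g j m := fun j S =>
    Finset.sum_nonneg fun m _ => mul_nonneg (decay_nonneg hr _) (hg j m)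
  have hend : ∀ (j : ℕ) (n : ℤ), 0 ≤ decay H.r n * ‖W j n‖ := fun j n =>
    mul_nonneg (decay_nonneg hr _) (norm_nonneg _)
  have hφ0 : ∀ j, 0 ≤ φ j := fun j => by
    have := hsum0 j (Finset.Ico (a j) (b j))
    have := hend j (a j)
    have := hend j (b j)
    simp only [hφ]; linarith
  have hpos : ∀ j, 0 < ‖W j 0‖ := fun j =>
    (mul_nonneg (Nat.cast_nonneg j) (hφ0 j)).trans_lt (hlt j)
  -- normalize the value at the center
  set c : ℕ → ℝ := fun j => ‖W j 0‖⁻¹ with hc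
  have hc0 : ∀ j, 0 < c j := fun j => inv_pos.2 (hpos j)
  have hone : ∀ j, ‖c j • W j 0‖ = 1 := fun j => by
    rw [norm_smul, Real.norm_of_nonneg (hc0 j).le, hc, inv_mul_cancel₀ (hpos j).ne']
  have hθ : Tendsto (fun j => c j * φ j) atTop (𝓝 0) := by
    refine squeeze_zero' (Eventually.of_forall fun j => mul_nonneg (hc0 j).le (hφ0 j)) ?_
      (tendsto_const_div_atTop_nhds_zero_nat (1 : ℝ))
    filter_upwards [eventually_gt_atTop 0] with j hj
    have hj' : (0 : ℝ) < j := by exact_mod_cast hj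
    rw [le_div_iff₀ hj', hc]
    calc ‖W j 0‖⁻¹ * φ j * j = ‖W j 0‖⁻¹ * (j * φ j) := by ring
      _ ≤ ‖W j 0‖⁻¹ * ‖W j 0‖ := mul_le_mul_of_nonneg_left (hlt j).le (hc0 j).le
      _ = 1 := inv_mul_cancel₀ (hpos j).ne'
  obtain ⟨v, hv, ψ, hψ, hψv⟩ := (isCompact_sphere (0 : X) 1).tendsto_subseq
    (x := fun j => c j • W j 0) (fun j => by simpa using hone j)
  have hψt := hψ.tendsto_atTop
  have hstep : ∀ j n, ‖c j • W j (n + 1) - H.DF (Q n) (c j • W j n)‖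
      = c j * ‖W j (n + 1) - H.DF (Q n) (W j n)‖ := fun j n => by
    rw [map_smul, ← smul_sub, norm_smul, Real.norm_of_nonneg (hc0 j).le]
  have hbt : Tendsto b atTop atTop :=
    tendsto_atTop_mono hb tendsto_natCast_atTop_atTop
  have hat : Tendsto (fun j => -a j) atTop atTop :=
    tendsto_atTop_mono (fun j => by have := ha j; omega) tendsto_natCast_atTop_atTop
  have hv1 : v ∈ H.stableSpace Q := by
    refine hQ.mem_stableSpace_of_tendsto (W := fun j n => c (ψ j) • W (ψ j) n)
      (g := fun j n => c (ψ j) * g (ψ j) n) (b := fun j => b (ψ j))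
      (θ := fun j => c (ψ j) * φ (ψ j)) (hbt.comp hψt)
      (fun j n => mul_nonneg (hc0 _).le (hg _ _)) (fun j n hn => ?_) hψv (hθ.comp hψt)
      (fun j => ?_)
    · rw [hstep]
      refine mul_le_mul_of_nonneg_left (hW _ n ?_) (hc0 _).le
      have := ha (ψ j)
      simp only [Finset.mem_Ico] at hn ⊢; omega
    · simp only [norm_smul, Real.norm_of_nonneg (hc0 _).le, mul_left_comm _ (c _)]
      rw [← Finset.mul_sum, ← mul_add]
      refine mul_le_mul_of_nonneg_left ?_ (hc0 _).le
      have h1 : ∑ m ∈ Finset.Ico 0 (b (ψ j)), decay H.r m * g (ψ j) m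
          ≤ ∑ m ∈ Finset.Ico (a (ψ j)) (b (ψ j)), decay H.r m * g (ψ j) m :=
        Finset.sum_le_sum_of_subset_of_nonneg
          (Finset.Ico_subset_Ico_left (by have := ha (ψ j); omega))
          fun m _ _ => mul_nonneg (decay_nonneg hr _) (hg _ m)
      have := hend (ψ j) (a (ψ j))
      simp only [hφ]; linarith
  obtain ⟨M, hM, hrev⟩ := hQ.exists_reverse_step_le
  have hv2 : v ∈ H.reverse.stableSpace (fun n => Q (-n)) := by
    refine hQ.reverse.mem_stableSpace_of_tendsto (W := fun j n => c (ψ j) • W (ψ j) (-n))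
      (g := fun j n => M * (c (ψ j) * g (ψ j) (-n - 1))) (b := fun j => -a (ψ j))
      (θ := fun j => M * H.r * (c (ψ j) * φ (ψ j))) (hat.comp hψt)
      (fun j n => mul_nonneg (by linarith) (mul_nonneg (hc0 _).le (hg _ _)))
      (fun j n hn => ?_) (by simpa [Function.comp_def] using hψv)
      (by simpa using (hθ.comp hψt).const_mul (M * H.r)) (fun j => ?_)
    · have h1 := hrev (fun n => c (ψ j) • W (ψ j) n) (-n - 1)
      rw [hstep, sub_add_cancel] at h1
      have h2 : -(n + 1) = -n - 1 := by ring
      have h3 := hW (ψ j) (-n - 1)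
      rw [sub_add_cancel] at h3
      rw [h2]
      refine h1.trans (mul_le_mul_of_nonneg_left
        (mul_le_mul_of_nonneg_left (h3 ?_) (hc0 _).le) (by linarith))
      have := hb (ψ j)
      simp only [Finset.mem_Ico] at hn ⊢; omega
    · have h1 := sum_reverse H.r (a (ψ j)) (g (ψ j)) 0
      simp only [zero_sub, decay_neg] at h1
      have h2 : ∑ m ∈ Finset.Ico (a (ψ j)) 0, decay H.r (-0 - 1 - m) * g (ψ j) m
          ≤ H.r * ∑ m ∈ Finset.Ico (a (ψ j)) (b (ψ j)), decay H.r m * g (ψ j) m := by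
        rw [Finset.mul_sum]
        refine (Finset.sum_le_sum fun m _ => ?_).trans
          (Finset.sum_le_sum_of_subset_of_nonneg (Finset.Ico_subset_Ico_right
            (by have := hb (ψ j); omega))
          fun m _ _ => mul_nonneg hr0.le (mul_nonneg (decay_nonneg hr _) (hg _ m)))
        rw [← mul_assoc]
        refine mul_le_mul_of_nonneg_right ?_ (hg _ m)
        have := decay_le_mul hr m 1
        rw [← decay_neg, show -(-0 - 1 - m) = m + 1 by ring]
        simpa using this
      have h3 : ∑ m ∈ Finset.Ico 0 (-a (ψ j)), decay H.r m * g (ψ j) (-m - 1)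
          ≤ H.r * ∑ m ∈ Finset.Ico (a (ψ j)) (b (ψ j)), decay H.r m * g (ψ j) m := by
        rw [h1]; simpa using h2
      have e1 : ‖c (ψ j) • W (ψ j) (- -a (ψ j))‖ = c (ψ j) * ‖W (ψ j) (a (ψ j))‖ := by
        rw [neg_neg, norm_smul, Real.norm_of_nonneg (hc0 _).le]
      have e2 : ∑ m ∈ Finset.Ico 0 (-a (ψ j)), decay H.r m * (M * (c (ψ j) * g (ψ j) (-m - 1)))
          = c (ψ j) * (M * ∑ m ∈ Finset.Ico 0 (-a (ψ j)), decay H.r m * g (ψ j) (-m - 1)) := by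
        rw [Finset.mul_sum, Finset.mul_sum]
        exact Finset.sum_congr rfl fun m _ => by ring
      change decay H.r (-a (ψ j)) * ‖c (ψ j) • W (ψ j) (- -a (ψ j))‖
        + ∑ m ∈ Finset.Ico 0 (-a (ψ j)), decay H.r m * (M * (c (ψ j) * g (ψ j) (-m - 1))) ≤ _
      rw [e1, e2, decay_neg]
      have h4 := hend (ψ j) (a (ψ j))
      have h5 := hend (ψ j) (b (ψ j))
      have h6 := hsum0 (ψ j) (Finset.Ico (a (ψ j)) (b (ψ j)))
      have h7 : (1 : ℝ) ≤ M * H.r := one_le_mul_of_one_le_of_one_le hM hr.le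
      have h8 : decay H.r (a (ψ j)) * ‖W (ψ j) (a (ψ j))‖
          ≤ M * H.r * (decay H.r (a (ψ j)) * ‖W (ψ j) (a (ψ j))‖) :=
        le_mul_of_one_le_left h4 h7
      have h9 := mul_le_mul_of_nonneg_left h3 (zero_le_one.trans hM)
      have h10 : 0 ≤ M * H.r * (decay H.r (b (ψ j)) * ‖W (ψ j) (b (ψ j))‖) := by positivity
      have h11 : decay H.r (a (ψ j)) * ‖W (ψ j) (a (ψ j))‖
          + M * ∑ m ∈ Finset.Ico 0 (-a (ψ j)), decay H.r m * g (ψ j) (-m - 1)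
          ≤ M * H.r * φ (ψ j) := by
        simp only [hφ]; linarith
      have h12 := mul_le_mul_of_nonneg_left h11 (hc0 (ψ j)).le
      calc _ = c (ψ j) * (decay H.r (a (ψ j)) * ‖W (ψ j) (a (ψ j))‖
            + M * ∑ m ∈ Finset.Ico 0 (-a (ψ j)), decay H.r m * g (ψ j) (-m - 1)) := by ring
        _ ≤ c (ψ j) * (M * H.r * φ (ψ j)) := h12
        _ = _ := by ring
  have h0 : v ∈ H.stableSpace Q ⊓ H.reverse.stableSpace (fun n => Q (-n)) := ⟨hv1, hv2⟩
  rw [hQ.inf_eq_bot hT, Submodule.mem_bot] at h0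
  simp [h0] at hv

end FiniteDimensional

/-- A bound at the center by a slowly varying function that dominates the boundary value and the
errors spreads to the whole forward interval. -/
theorem exists_forward_bound (hQ : H.IsHomoclinic Q) {C₀ : ℝ} (hC₀ : 0 ≤ C₀) :
    ∃ C, C₀ ≤ C ∧ ∀ (b : ℤ) (W : ℤ → X) (g φ : ℤ → ℝ), SlowlyVarying H.r φ → (∀ n, 0 ≤ g n) →
      (∀ n ∈ Finset.Ico 0 b, ‖W (n + 1) - H.DF (Q n) (W n)‖ ≤ g n) → ‖W 0‖ ≤ C₀ * φ 0 →
      (∀ n ∈ Finset.Icc 0 b, decay H.r (n - b) * ‖W b‖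
        + ∑ m ∈ Finset.Ico 0 b, decay H.r (n - m) * g m ≤ φ n) →
      ∀ n ∈ Finset.Icc 0 b, ‖W n‖ ≤ C * φ n := by
  have hr := H.one_lt
  have hr0 := H.r_pos
  obtain ⟨M, hM, hDF⟩ := hQ.exists_norm_DF_le
  obtain ⟨k₀, hk₀⟩ := hQ.exists_green_tail
  -- finitely many steps cost a constant factor
  have hfin : ∀ k : ℕ, ∃ C, C₀ ≤ C ∧ ∀ (b : ℤ) (W : ℤ → X) (g φ : ℤ → ℝ), SlowlyVarying H.r φ →
      (∀ n, 0 ≤ g n) →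
      (∀ n ∈ Finset.Ico 0 b, ‖W (n + 1) - H.DF (Q n) (W n)‖ ≤ g n) → ‖W 0‖ ≤ C₀ * φ 0 →
      (∀ n ∈ Finset.Icc 0 b, decay H.r (n - b) * ‖W b‖
        + ∑ m ∈ Finset.Ico 0 b, decay H.r (n - m) * g m ≤ φ n) →
      ∀ n ∈ Finset.Icc 0 b, n ≤ k → ‖W n‖ ≤ C * φ n := by
    intro k
    induction k with
    | zero =>
      refine ⟨C₀, le_rfl, fun b W g φ _ _ _ h0 _ n hn hnk => ?_⟩
      obtain rfl : n = 0 := by have := (Finset.mem_Icc.1 hn).1; simp at hnk; omega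
      exact h0
    | succ k ih =>
      obtain ⟨C, hC, h⟩ := ih
      refine ⟨max C ((M * C + 1) * H.r), hC.trans (le_max_left _ _),
        fun b W g φ hφ hg hW h0 hb n hn hnk => ?_⟩
      have hC0 : 0 ≤ C := hC₀.trans hC
      rcases le_or_gt n k with h1 | h1
      · exact (h b W g φ hφ hg hW h0 hb n hn h1).trans
          (mul_le_mul_of_nonneg_right (le_max_left _ _) (hφ.1 n))
      obtain rfl : n = k + 1 := by push_cast at hnk; omega
      have hk1 : (k : ℤ) ∈ Finset.Icc 0 b := by
        simp only [Finset.mem_Icc] at hn ⊢; omega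
      have hk2 : (k : ℤ) ∈ Finset.Ico 0 b := by
        simp only [Finset.mem_Icc, Finset.mem_Ico] at hn ⊢; omega
      have h2 := h b W g φ hφ hg hW h0 hb k hk1 le_rfl
      have h3 : g k ≤ φ k := by
        have h4 := Finset.single_le_sum (f := fun m : ℤ => decay H.r (k - m) * g m)
          (fun m _ => mul_nonneg (decay_nonneg hr _) (hg m)) hk2
        simp only [sub_self, decay_zero, one_mul] at h4
        have h5 : 0 ≤ decay H.r (k - b) * ‖W b‖ := mul_nonneg (decay_nonneg hr _) (norm_nonneg _)
        linarith [hb k hk1]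
      have h4 := norm_add_le (W (k + 1) - H.DF (Q k) (W k)) (H.DF (Q k) (W k))
      rw [sub_add_cancel] at h4
      have h5 : ‖W (k + 1)‖ ≤ (M * C + 1) * φ k := by
        have := hW k hk2
        have := hDF k (W k)
        have := mul_le_mul_of_nonneg_left h2 hM
        linarith
      have h6 : φ k ≤ H.r * φ (k + 1) := by
        have := hφ.le_mul hr (k + 1) k
        simpa using this
      calc ‖W (k + 1)‖ ≤ (M * C + 1) * φ k := h5
        _ ≤ (M * C + 1) * (H.r * φ (k + 1)) := mul_le_mul_of_nonneg_left h6 (by positivity)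
        _ = (M * C + 1) * H.r * φ (k + 1) := by ring
        _ ≤ _ := mul_le_mul_of_nonneg_right (le_max_right _ _) (hφ.1 _)
  obtain ⟨C, hC, h⟩ := hfin k₀
  have hC0 : 0 ≤ C := hC₀.trans hC
  refine ⟨max C (2 * (C + 1 + H.r)), hC.trans (le_max_left _ _),
    fun b W g φ hφ hg hW h0 hb n hn => ?_⟩
  rcases le_or_gt n k₀ with h1 | h1
  · exact (h b W g φ hφ hg hW h0 hb n hn h1).trans
      (mul_le_mul_of_nonneg_right (le_max_left _ _) (hφ.1 n))
  have hnb := Finset.mem_Icc.1 hn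
  have hsub : Finset.Ico (k₀ : ℤ) b ⊆ Finset.Ico 0 b := Finset.Ico_subset_Ico_left (by positivity)
  have h2 := hk₀ b W g hg (fun m hm => hW m (hsub hm)) n (Finset.mem_Icc.2 ⟨h1.le, hnb.2⟩)
  have h3 := h b W g φ hφ hg hW h0 hb k₀ (Finset.mem_Icc.2 ⟨by positivity, by omega⟩) le_rfl
  have h4 : decay H.r (n - k₀) * ‖W k₀‖ ≤ C * φ n := by
    calc _ ≤ decay H.r (n - k₀) * (C * φ k₀) := mul_le_mul_of_nonneg_left h3 (decay_nonneg hr _)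
      _ = C * (decay H.r (n - k₀) * φ k₀) := by ring
      _ ≤ _ := mul_le_mul_of_nonneg_left (hφ.2 n k₀) hC0
  have h5 : ∑ m ∈ Finset.Ico (k₀ : ℤ) b, decay H.r (n - m) * g m
      ≤ ∑ m ∈ Finset.Ico 0 b, decay H.r (n - m) * g m :=
    Finset.sum_le_sum_of_subset_of_nonneg hsub fun m _ _ =>
      mul_nonneg (decay_nonneg hr _) (hg m)
  have h6 : 0 ≤ ∑ m ∈ Finset.Ico 0 b, decay H.r (n - m) * g m :=
    Finset.sum_nonneg fun m _ => mul_nonneg (decay_nonneg hr _) (hg m)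
  have h7 : 0 ≤ decay H.r (n - b) * ‖W b‖ := mul_nonneg (decay_nonneg hr _) (norm_nonneg _)
  have h8 := hb n hn
  have h9 : H.r * ∑ m ∈ Finset.Ico (k₀ : ℤ) b, decay H.r (n - m) * g m ≤ H.r * φ n :=
    mul_le_mul_of_nonneg_left (by linarith) hr0.le
  calc ‖W n‖ ≤ 2 * (C + 1 + H.r) * φ n := by linarith
    _ ≤ _ := mul_le_mul_of_nonneg_right (le_max_right _ _) (hφ.1 n)

/-- The exponential dichotomy along a transverse homoclinic orbit, in the form of an a priori
estimate with the full rate for approximate solutions of the linearized equation on an interval. -/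
theorem exists_dichotomy [FiniteDimensional ℝ X] (hQ : H.IsHomoclinic Q)
    (hT : H.stableSpace Q ⊔ H.reverse.stableSpace (fun n => Q (-n)) = ⊤) :
    ∃ L : ℕ, ∃ C : ℝ, 0 < C ∧ ∀ (a b : ℤ) (W : ℤ → X) (g : ℤ → ℝ), a ≤ -L → L ≤ b →
      (∀ n, 0 ≤ g n) → (∀ n ∈ Finset.Ico a b, ‖W (n + 1) - H.DF (Q n) (W n)‖ ≤ g n) →
      ∀ n ∈ Finset.Icc a b, ‖W n‖ ≤ C * (decay H.r (n - a) * ‖W a‖ + decay H.r (n - b) * ‖W b‖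
        + ∑ m ∈ Finset.Ico a b, decay H.r (n - m) * g m) := by
  have hr := H.one_lt
  have hr0 := H.r_pos
  obtain ⟨L, hL⟩ := hQ.exists_center_bound hT
  obtain ⟨M, hM, hrev⟩ := hQ.exists_reverse_step_le
  obtain ⟨C₁, hC₁, h₁⟩ := hQ.exists_forward_bound (C₀ := L) (Nat.cast_nonneg L)
  obtain ⟨C₂, hC₂, h₂⟩ := hQ.reverse.exists_forward_bound (C₀ := L) (Nat.cast_nonneg L)
  have hMr : (1 : ℝ) ≤ M * H.r := one_le_mul_of_one_le_of_one_le hM hr.le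
  have hC₁0 : 0 ≤ C₁ := (Nat.cast_nonneg L).trans hC₁
  have hC₂0 : 0 ≤ C₂ := (Nat.cast_nonneg L).trans hC₂
  refine ⟨L, C₁ + C₂ * (M * H.r) + 1, by positivity, fun a b W g ha hb hg hW n hn => ?_⟩
  set φ : ℤ → ℝ := fun n => decay H.r (n - a) * ‖W a‖ + decay H.r (n - b) * ‖W b‖
        + ∑ m ∈ Finset.Ico a b, decay H.r (n - m) * g m with hφ
  have hφs : SlowlyVarying H.r φ := by
    simp_rw [hφ, mul_comm _ ‖_‖]
    exact ((((slowlyVarying_decay hr a).const_mul (norm_nonneg _)).add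
      ((slowlyVarying_decay hr b).const_mul (norm_nonneg _)))).add (slowlyVarying_sum hr _ hg)
  have h0 : ‖W 0‖ ≤ L * φ 0 := by
    have := hL a b W g ha hb hg hW
    simpa [hφ, decay_neg] using this
  have hsum : ∀ (n : ℤ) (S : Finset ℤ), S ⊆ Finset.Ico a b →
      ∑ m ∈ S, decay H.r (n - m) * g m ≤ ∑ m ∈ Finset.Ico a b, decay H.r (n - m) * g m :=
    fun n S hS => Finset.sum_le_sum_of_subset_of_nonneg hS fun m _ _ =>
      mul_nonneg (decay_nonneg hr _) (hg m)
  have hend : ∀ (n m : ℤ), 0 ≤ decay H.r n * ‖W m‖ := fun n m =>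
    mul_nonneg (decay_nonneg hr _) (norm_nonneg _)
  have hab := Finset.mem_Icc.1 hn
  change ‖W n‖ ≤ _ * φ n
  rcases le_total 0 n with h | h
  · have hs : Finset.Ico 0 b ⊆ Finset.Ico a b := Finset.Ico_subset_Ico_left (by omega)
    have := h₁ b W g φ hφs hg (fun m hm => hW m (hs hm)) h0
      (fun m _ => by
        have := hsum m _ hs
        have := hend (m - a) a
        simp only [hφ]; linarith) n (Finset.mem_Icc.2 ⟨h, hab.2⟩)
    refine this.trans (mul_le_mul_of_nonneg_right ?_ (hφs.1 n))
    have : 0 ≤ C₂ * (M * H.r) := by positivity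
    linarith
  · have hs : Finset.Ico a 0 ⊆ Finset.Ico a b := Finset.Ico_subset_Ico_right (by omega)
    have hφ' : SlowlyVarying H.reverse.r (fun n => M * H.r * φ (-n)) := by
      refine SlowlyVarying.const_mul ⟨fun n => hφs.1 _, fun n m => ?_⟩ (by linarith)
      have := hφs.2 (-n) (-m)
      rwa [show -n - -m = -(n - m) by ring, decay_neg] at this
    have key := h₂ (-a) (fun n => W (-n)) (fun n => M * g (-n - 1)) (fun n => M * H.r * φ (-n))
      hφ' (fun n => mul_nonneg (by linarith) (hg _)) (fun m hm => ?_) ?_ (fun m hm => ?_) (-n)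
      (Finset.mem_Icc.2 ⟨by omega, by omega⟩)
    · simp only [neg_neg] at key
      refine key.trans ?_
      rw [← mul_assoc]
      exact mul_le_mul_of_nonneg_right (by linarith) (hφs.1 n)
    · have h1 := hrev W (-m - 1)
      rw [sub_add_cancel] at h1
      rw [show -(m + 1) = -m - 1 by ring]
      have h2 := hW (-m - 1)
      rw [sub_add_cancel] at h2
      refine h1.trans (mul_le_mul_of_nonneg_left (h2 ?_) (by linarith))
      simp only [Finset.mem_Ico] at hm ⊢; omega
    · simp only [neg_zero]
      refine h0.trans (mul_le_mul_of_nonneg_left ?_ (Nat.cast_nonneg L))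
      exact le_mul_of_one_le_left (hφs.1 0) hMr
    · have h1 := sum_reverse H.r a g m
      have h2 : ∑ l ∈ Finset.Ico a 0, decay H.r (-m - 1 - l) * g l
          ≤ H.r * ∑ l ∈ Finset.Ico a 0, decay H.r (-m - l) * g l := by
        rw [Finset.mul_sum]
        refine Finset.sum_le_sum fun l _ => ?_
        rw [← mul_assoc]
        refine mul_le_mul_of_nonneg_right ?_ (hg l)
        have := decay_le_mul hr (-m - l) (-1)
        rw [show -m - l + -1 = -m - 1 - l by ring] at this
        simpa using this
      have h3 := hsum (-m) _ hs
      have h4 := hend (-m - b) b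
      have h5 := hend (-m - a) a
      change decay H.r (m - -a) * ‖W (- -a)‖ + ∑ l ∈ _, decay H.r (m - l) * _ ≤ _
      simp only [neg_neg, mul_left_comm _ M]
      rw [← Finset.mul_sum, h1]
      rw [show m - -a = -(-m - a) by ring, decay_neg]
      have h6 : decay H.r (-m - a) * ‖W a‖ ≤ M * H.r * (decay H.r (-m - a) * ‖W a‖) :=
        le_mul_of_one_le_left h5 hMr
      have h7 : M * ∑ l ∈ Finset.Ico a 0, decay H.r (-m - 1 - l) * g l
          ≤ M * H.r * ∑ l ∈ Finset.Ico a b, decay H.r (-m - l) * g l := by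
        rw [mul_assoc]
        exact mul_le_mul_of_nonneg_left (h2.trans (mul_le_mul_of_nonneg_left h3 hr0.le))
          (by linarith)
      have h8 : 0 ≤ M * H.r * (decay H.r (-m - b) * ‖W b‖) := mul_nonneg (by linarith) h4
      simp only [hφ]
      linarith

end IsHomoclinic
end HypDiffeo

/-! ### The geometry of chains -/

/-- The position at which the `i`-th and the `(i+1)`-st piece of a chain meet. -/
def interface (N : ℕ → ℕ) (i : ℕ) : ℤ := center N i + halfPlus N i

open Classical in
/-- The index of the piece of the chain that contains `n`; interfaces belong to the piece on their
right. -/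
noncomputable def pieceIndex (m : ℕ) (N : ℕ → ℕ) (n : ℤ) : ℕ :=
  Nat.findGreatest (fun i => 1 ≤ i ∧ interface N i ≤ n) (m - 1) + 1

section chain
variable {m : ℕ} {N : ℕ → ℕ}

theorem center_one : center N 1 = 0 := by simp [center]

theorem center_succ {i : ℕ} (hi : 1 ≤ i) : center N (i + 1) = center N i + N i := by
  rw [center, center, Finset.sum_Ico_succ_top hi]

theorem center_mono {i j : ℕ} (hij : i ≤ j) : center N i ≤ center N j :=
  Finset.sum_le_sum_of_subset_of_nonneg (Finset.Ico_subset_Ico_right hij)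
    fun _ _ _ => Int.natCast_nonneg _

theorem center_nonneg (i : ℕ) : 0 ≤ center N i :=
  Finset.sum_nonneg fun _ _ => Int.natCast_nonneg _

theorem halfPlus_nonneg (i : ℕ) : 0 ≤ halfPlus N i := Int.natCast_nonneg _

theorem halfPlus_add_halfMinus (i : ℕ) : halfPlus N i + halfMinus N i = N i := by
  simp [halfMinus]

theorem halfPlus_le_halfMinus (i : ℕ) : halfPlus N i ≤ halfMinus N i := by
  simp only [halfMinus, halfPlus]; omega

theorem halfMinus_le (i : ℕ) : halfMinus N i ≤ halfPlus N i + 1 := by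
  simp only [halfMinus, halfPlus]; omega

theorem interface_eq {i : ℕ} (hi : 1 ≤ i) :
    interface N i = center N (i + 1) - halfMinus N i := by
  have := halfPlus_add_halfMinus (N := N) i
  rw [interface, center_succ hi]; omega

theorem center_le_interface (i : ℕ) : center N i ≤ interface N i := by
  have := halfPlus_nonneg (N := N) i
  rw [interface]; omega

theorem interface_le_center {i : ℕ} (hi : 1 ≤ i) : interface N i ≤ center N (i + 1) := by
  have := halfPlus_nonneg (N := N) i
  have := halfPlus_le_halfMinus (N := N) i
  rw [interface_eq hi]; omega

theorem interface_mono {i j : ℕ} (hi : 1 ≤ i) (hij : i ≤ j) : interface N i ≤ interface N j := by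
  induction j, hij using Nat.le_induction with
  | base => exact le_rfl
  | succ j hj ih =>
    exact ih.trans ((interface_le_center (hi.trans hj)).trans (center_le_interface _))

theorem pieceIndex_pos (n : ℤ) : 1 ≤ pieceIndex m N n := Nat.le_add_left _ _

theorem pieceIndex_le (hm : 1 < m) (n : ℤ) : pieceIndex m N n ≤ m := by
  classical
  have := Nat.findGreatest_le (P := fun i => 1 ≤ i ∧ interface N i ≤ n) (m - 1)
  simp only [pieceIndex]
  convert (by omega : Nat.findGreatest (fun i => 1 ≤ i ∧ interface N i ≤ n) (m - 1) + 1 ≤ m)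

theorem interface_pred_le (n : ℤ) (h : 1 < pieceIndex m N n) :
    interface N (pieceIndex m N n - 1) ≤ n := by
  classical
  have h1 : Nat.findGreatest (fun i => 1 ≤ i ∧ interface N i ≤ n) (m - 1) ≠ 0 := by
    intro h0
    have : pieceIndex m N n = 1 := by
      rw [pieceIndex]; convert congrArg (· + 1) h0
    omega
  have h2 := (Nat.findGreatest_of_ne_zero (n := m - 1) rfl h1).2
  rw [pieceIndex, Nat.add_sub_cancel]
  convert h2

theorem lt_interface (n : ℤ) (h : pieceIndex m N n < m) : n < interface N (pieceIndex m N n) := by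
  classical
  by_contra! hcon
  have h1 := Nat.findGreatest_is_greatest (P := fun i => 1 ≤ i ∧ interface N i ≤ n)
    (n := m - 1) (k := pieceIndex m N n) (by rw [pieceIndex]; convert Nat.lt_succ_self _) (by omega)
  exact h1 ⟨pieceIndex_pos n, hcon⟩

theorem pieceIndex_eq {n : ℤ} {i : ℕ} (hi : 1 ≤ i) (him : i ≤ m)
    (h1 : 1 < i → interface N (i - 1) ≤ n) (h2 : i < m → n < interface N i) :
    pieceIndex m N n = i := by
  have h3 := pieceIndex_pos (m := m) (N := N) n
  rcases lt_trichotomy (pieceIndex m N n) i with h | h | h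
  · have h4 := lt_interface (m := m) (N := N) n (by omega)
    have h5 := interface_mono (N := N) h3 (show pieceIndex m N n ≤ i - 1 by omega)
    have := h1 (by omega)
    omega
  · exact h
  · have h4 := interface_pred_le (m := m) (N := N) n (by omega)
    have h5 := interface_mono (N := N) hi (show i ≤ pieceIndex m N n - 1 by omega)
    have h6 : i < m := by
      by_contra h7
      have h8 := interface_pred_le (m := m) (N := N) n (by omega)
      have h9 : pieceIndex m N n ≤ m := by
        rcases Nat.lt_or_ge 1 m with h10 | h10
        · exact pieceIndex_le h10 n
        · have : m - 1 = 0 := by omega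
          simp [pieceIndex, this]; omega
      omega
    have := h2 h6
    omega

end chain

namespace HypDiffeo
namespace IsHomoclinic

variable {X : Type*} [NormedAddCommGroup X] [NormedSpace ℝ X] {H : HypDiffeo X} {Q : ℤ → X}

/-! ### The linearization along a chain -/

/-- The a priori estimate for the linearization along a chain, uniform in the chain: the interfaces
are reached through long stretches where the linearization is close to the one at the origin, so
that the values there are small, and each piece is controlled by its ends. The values at the two
ends of the interval are in turn controlled by their incoming components. -/
theorem exists_chain_bound [FiniteDimensional ℝ X] (hQ : H.IsHomoclinic Q)
    (hT : H.stableSpace Q ⊔ H.reverse.stableSpace (fun n => Q (-n)) = ⊤) :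
    ∃ (L : ℕ) (ε C : ℝ), 0 < ε ∧ 0 < C ∧ ∀ (m : ℕ) (N : ℕ → ℕ), 1 < m →
      (∀ i, 1 ≤ i → i < m → L ≤ N i) → ∀ (a b : ℤ) (W : ℤ → X) (s γ : ℝ), a ≤ -L →
      center N m + L ≤ b → 0 ≤ γ → (∀ n ∈ Finset.Icc a b, ‖W n‖ ≤ s) →
      (∀ n ∈ Finset.Ico a b, ‖W (n + 1) - H.DF (Q (n - center N (pieceIndex m N n))) (W n)‖
        ≤ ε * ‖W n‖ + γ) →
      (∀ n ∈ Finset.Icc a b, ‖W n‖ ≤ s / 4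
        + C * (γ + decay H.r (n - a) * ‖W a‖ + decay H.r (n - b) * ‖W b‖)) ∧
      (∀ n ∈ Finset.Icc a b, ‖W n‖ ≤ s / 2 + C * (γ + ‖H.P (W a)‖ + ‖H.Pc (W b)‖)) := by
  have hr := H.one_lt
  have hr0 := H.r_pos
  have hκ := decaySum_pos hr
  obtain ⟨L₀, C₀, hC₀, hdich⟩ := hQ.exists_dichotomy hT
  set κ := decaySum H.r with hκd
  set μ := 1 / (16 * C₀) with hμ
  have hμ0 : 0 < μ := by positivity
  set ε₁ := μ / (4 * (H.r * κ)) with hε₁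
  have hε₁0 : 0 < ε₁ := by positivity
  set ε := min ε₁ (1 / (8 * C₀ * κ)) with hε
  have hε0 : 0 < ε := by positivity
  obtain ⟨k₁, hk₁⟩ := hQ.exists_small_tail hε₁0
  obtain ⟨k₂, hk₂⟩ := exists_decay_le hr (ε := μ / 4) (by positivity)
  have e1 : H.r * (κ * (2 * ε₁)) = μ / 2 := by rw [hε₁]; field_simp; norm_num
  have e2 : C₀ * μ = 1 / 16 := by rw [hμ]; field_simp
  have e3 : C₀ * (κ * ε) ≤ 1 / 8 := by
    have : ε ≤ 1 / (8 * C₀ * κ) := min_le_right _ _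
    rw [le_div_iff₀ (by positivity)] at this
    linarith
  refine ⟨2 * (k₁ + k₂ + L₀) + 2, ε, C₀ * (1 + 4 * (H.r * κ) + κ), hε0, by positivity,
    fun m N hm hN a b W s γ ha hb hγ hs hW => ?_⟩
  push_cast at ha hb
  have hcm := center_nonneg (N := N) m
  have hs0 : 0 ≤ s := (norm_nonneg _).trans (hs a (Finset.mem_Icc.2 ⟨le_rfl, by omega⟩))
  have hp : ∀ i, 1 ≤ i → i < m → k₁ + k₂ + L₀ + 1 ≤ halfPlus N i := fun i h1 h2 => by
    have := hN i h1 h2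
    simp only [halfPlus]; omega
  -- where the linearization is close to the one at the origin
  have hnear : ∀ α β : ℤ, a ≤ α → β ≤ b → (∀ n ∈ Finset.Ico α β,
      (k₁ : ℤ) ≤ |n - center N (pieceIndex m N n)|) → ∀ n ∈ Finset.Icc α β,
      ‖W n‖ ≤ decay H.r (n - α) * ‖H.P (W α)‖ + decay H.r (n - β) * ‖H.Pc (W β)‖
        + (μ / 2 * s + H.r * κ * γ) := by
    intro α β hα hβ hfar n hn
    have h1 := H.green_of_le (W := W) (a := α) (b := β) (e := 2 * ε₁ * s + γ) (by positivity)
      (fun l hl => ?_) n hn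
    · refine h1.trans (le_of_eq ?_)
      rw [← e1]; ring
    · have hl' : l ∈ Finset.Ico a b := Finset.Ico_subset_Ico hα hβ hl
      have h2 := hW l hl'
      have h3 := hk₁ _ (hfar l hl) (W l)
      have h4 := norm_add_le (W (l + 1) - H.DF (Q (l - center N (pieceIndex m N l))) (W l))
        (H.DF (Q (l - center N (pieceIndex m N l))) (W l) - H.DF 0 (W l))
      rw [sub_add_sub_cancel] at h4
      have h5 := hs l (Finset.Ico_subset_Icc_self hl')
      have h6 : ε * ‖W l‖ ≤ ε₁ * s :=
        mul_le_mul (min_le_left _ _) h5 (norm_nonneg _) hε₁0.le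
      have h7 : ε₁ * ‖W l‖ ≤ ε₁ * s := mul_le_mul_of_nonneg_left h5 hε₁0.le
      linarith
  have hsmall : ∀ k l : ℤ, (k₂ : ℤ) ≤ |k| → l ∈ Finset.Icc a b → ∀ R : X →L[ℝ] X,
      (∀ x, ‖R x‖ ≤ ‖x‖) → decay H.r k * ‖R (W l)‖ ≤ μ / 4 * s := fun k l hk hl R hR =>
    mul_le_mul (hk₂ k hk) ((hR _).trans (hs l hl)) (norm_nonneg _) (by positivity)
  have hint : ∀ i, 1 ≤ i → i < m → ‖W (interface N i)‖ ≤ μ * s + H.r * κ * γ := by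
    intro i h1 h2
    have h3 := hp i h1 h2
    have h4 := halfPlus_le_halfMinus (N := N) i
    have h5 := interface_eq (N := N) h1
    have h6 : interface N i = center N i + halfPlus N i := rfl
    have h7 := center_nonneg (N := N) i
    have h8 := center_mono (N := N) (show i + 1 ≤ m by omega)
    have h9 := hnear (center N i + k₁) (center N (i + 1) - k₁) (by omega) (by omega)
      (fun n hn => ?_) (interface N i) (Finset.mem_Icc.2 ⟨by omega, by omega⟩)
    · have h10 := hsmall (interface N i - (center N i + k₁)) (center N i + k₁)
        (by rw [abs_of_nonneg] <;> omega) (Finset.mem_Icc.2 ⟨by omega, by omega⟩) H.P H.norm_P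
      have h11 := hsmall (interface N i - (center N (i + 1) - k₁)) (center N (i + 1) - k₁)
        (by rw [abs_of_nonpos] <;> omega) (Finset.mem_Icc.2 ⟨by omega, by omega⟩) H.Pc H.norm_Pc
      linarith
    · rw [Finset.mem_Ico] at hn
      rcases lt_or_ge n (interface N i) with h | h
      · rw [pieceIndex_eq h1 h2.le (fun h10 => ?_) fun _ => h]
        · rw [abs_of_nonneg] <;> omega
        · have h11 := interface_le_center (N := N) (show 1 ≤ i - 1 by omega)
          rw [Nat.sub_add_cancel h1] at h11
          omega
      · rw [pieceIndex_eq (i := i + 1) (by omega) (by omega) (fun _ => by simpa using h)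
          (fun _ => by have := center_le_interface (N := N) (i + 1); omega)]
        rw [abs_of_nonpos] <;> omega
  have hleft : ‖W a‖ ≤ ‖H.P (W a)‖ + (μ * s + H.r * κ * γ) := by
    have h9 := hnear a (-k₁) le_rfl (by omega) (fun n hn => ?_) a
      (Finset.mem_Icc.2 ⟨by omega, by omega⟩)
    · have h10 := hsmall (a - -k₁) (-k₁) (by rw [abs_of_nonpos] <;> omega)
        (Finset.mem_Icc.2 ⟨by omega, by omega⟩) H.Pc H.norm_Pc
      rw [sub_self, decay_zero, one_mul] at h9
      have : 0 ≤ μ * s := by positivity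
      linarith
    · rw [Finset.mem_Ico] at hn
      rw [pieceIndex_eq le_rfl hm.le (fun h => absurd h (lt_irrefl _)) (fun h => ?_), center_one]
      · rw [abs_of_nonpos] <;> omega
      · have := center_le_interface (N := N) 1
        rw [center_one] at this
        omega
  have hright : ‖W b‖ ≤ ‖H.Pc (W b)‖ + (μ * s + H.r * κ * γ) := by
    have h9 := hnear (center N m + k₁) b (by omega) le_rfl (fun n hn => ?_) b
      (Finset.mem_Icc.2 ⟨by omega, by omega⟩)
    · have h10 := hsmall (b - (center N m + k₁)) (center N m + k₁)
        (by rw [abs_of_nonneg] <;> omega)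
        (Finset.mem_Icc.2 ⟨by omega, by omega⟩) H.P H.norm_P
      rw [sub_self, decay_zero, one_mul] at h9
      have : 0 ≤ μ * s := by positivity
      linarith
    · rw [Finset.mem_Ico] at hn
      rw [pieceIndex_eq hm.le le_rfl (fun h => ?_) (fun h => absurd h (lt_irrefl _))]
      · rw [abs_of_nonneg] <;> omega
      · have := interface_le_center (N := N) (show 1 ≤ m - 1 by omega)
        rw [Nat.sub_add_cancel hm.le] at this
        omega
  have hmain : ∀ n ∈ Finset.Icc a b, ‖W n‖ ≤ s / 4 + C₀ * (2 * (H.r * κ) + κ) * γ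
      + C₀ * (decay H.r (n - a) * ‖W a‖ + decay H.r (n - b) * ‖W b‖) := by
    intro n hn
    rw [Finset.mem_Icc] at hn
    set i := pieceIndex m N n with hi
    have hi1 : 1 ≤ i := pieceIndex_pos n
    have him : i ≤ m := pieceIndex_le hm n
    set c := center N i with hc
    -- the ends of the piece, as far as they lie in the interval
    set α : ℤ := if 1 < i then interface N (i - 1) else a with hα
    set β : ℤ := if i < m then interface N i else b with hβ
    have hci := center_nonneg (N := N) i
    have hcim := center_mono (N := N) him
    have hα1 : a ≤ α ∧ α ≤ n ∧ α - c ≤ -L₀ := by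
      rw [hα]
      split_ifs with h
      · have h1 := interface_pred_le (m := m) (N := N) n h
        have h2 := center_le_interface (N := N) (i - 1)
        have h3 := center_nonneg (N := N) (i - 1)
        have h4 := interface_eq (N := N) (show 1 ≤ i - 1 by omega)
        rw [Nat.sub_add_cancel hi1] at h4
        have h5 := hp (i - 1) (by omega) (by omega)
        have h6 := halfPlus_le_halfMinus (N := N) (i - 1)
        refine ⟨by omega, h1, by omega⟩
      · exact ⟨le_rfl, hn.1, by omega⟩
    have hβ1 : β ≤ b ∧ n ≤ β ∧ L₀ ≤ β - c := by
      rw [hβ]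
      split_ifs with h
      · have h1 := lt_interface (m := m) (N := N) n h
        have h2 := interface_le_center (N := N) hi1
        have h3 := center_mono (N := N) (show i + 1 ≤ m by omega)
        have h4 : interface N i = c + halfPlus N i := rfl
        have h5 := hp i hi1 h
        refine ⟨by omega, h1.le, by omega⟩
      · have : i = m := by omega
        refine ⟨le_rfl, hn.2, ?_⟩
        rw [hc, this]; omega
    have hidx : ∀ l ∈ Finset.Ico (α - c) (β - c), pieceIndex m N (l + c) = i := fun l hl => by
      rw [Finset.mem_Ico, hα, hβ] at hl
      refine pieceIndex_eq hi1 him (fun h => ?_) (fun h => ?_)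
      · rw [if_pos h] at hl; omega
      · rw [if_pos h] at hl; omega
    have key := hdich (α - c) (β - c) (fun l => W (l + c)) (fun _ => ε * s + γ) hα1.2.2 hβ1.2.2
      (fun _ => by positivity) (fun l hl => ?_) (n - c) (Finset.mem_Icc.2 ⟨by omega, by omega⟩)
    · simp only [sub_add_cancel, sub_sub_sub_cancel_right] at key
      rw [← Finset.sum_mul] at key
      have h1 : (∑ l ∈ Finset.Ico (α - c) (β - c), decay H.r (n - c - l)) * (ε * s + γ)
          ≤ κ * (ε * s + γ) := mul_le_mul_of_nonneg_right (sum_decay_sub_left_le hr _ _)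
            (by positivity)
      have hX : 0 ≤ μ * s + H.r * κ * γ := by positivity
      have h2 : decay H.r (n - α) * ‖W α‖
          ≤ μ * s + H.r * κ * γ + decay H.r (n - a) * ‖W a‖ := by
        by_cases h : 1 < i
        · rw [hα, if_pos h]
          have h3 := hint (i - 1) (by omega) (by omega)
          have h4 : decay H.r (n - interface N (i - 1)) * ‖W (interface N (i - 1))‖
            ≤ ‖W (interface N (i - 1))‖ := mul_le_of_le_one_left (norm_nonneg _) (decay_le_one hr _)
          have : 0 ≤ decay H.r (n - a) * ‖W a‖ := mul_nonneg (decay_nonneg hr _) (norm_nonneg _)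
          linarith
        · rw [hα, if_neg h]; linarith
      have h3 : decay H.r (n - β) * ‖W β‖
          ≤ μ * s + H.r * κ * γ + decay H.r (n - b) * ‖W b‖ := by
        by_cases h : i < m
        · rw [hβ, if_pos h]
          have h3 := hint i hi1 h
          have h4 : decay H.r (n - interface N i) * ‖W (interface N i)‖
            ≤ ‖W (interface N i)‖ := mul_le_of_le_one_left (norm_nonneg _) (decay_le_one hr _)
          have : 0 ≤ decay H.r (n - b) * ‖W b‖ := mul_nonneg (decay_nonneg hr _) (norm_nonneg _)
          linarith
        · rw [hβ, if_neg h]; linarith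
      have h5 := mul_le_mul_of_nonneg_right e3 hs0
      calc ‖W n‖ ≤ _ := key
        _ ≤ C₀ * ((μ * s + H.r * κ * γ + decay H.r (n - a) * ‖W a‖)
            + (μ * s + H.r * κ * γ + decay H.r (n - b) * ‖W b‖) + κ * (ε * s + γ)) :=
          mul_le_mul_of_nonneg_left (add_le_add (add_le_add h2 h3) h1) hC₀.le
        _ = 2 * (C₀ * μ) * s + C₀ * (κ * ε) * s + C₀ * (2 * (H.r * κ) + κ) * γ
            + C₀ * (decay H.r (n - a) * ‖W a‖ + decay H.r (n - b) * ‖W b‖) := by ring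
        _ ≤ _ := by rw [e2]; linarith
    · have h1 : l + c ∈ Finset.Ico a b := by
        simp only [Finset.mem_Ico] at hl ⊢; omega
      have h2 := hW (l + c) h1
      rw [hidx l hl, ← hc, add_sub_cancel_right] at h2
      rw [show l + 1 + c = l + c + 1 by ring]
      refine h2.trans ?_
      have := mul_le_mul_of_nonneg_left (hs _ (Finset.Ico_subset_Icc_self h1)) hε0.le
      linarith
  have hρ : 0 ≤ H.r * κ := by positivity
  refine ⟨fun n hn => (hmain n hn).trans ?_, fun n hn => (hmain n hn).trans ?_⟩
  · have h1 : 0 ≤ decay H.r (n - a) * ‖W a‖ := mul_nonneg (decay_nonneg hr _) (norm_nonneg _)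
    have h2 : 0 ≤ decay H.r (n - b) * ‖W b‖ := mul_nonneg (decay_nonneg hr _) (norm_nonneg _)
    have h3 : C₀ * (decay H.r (n - a) * ‖W a‖ + decay H.r (n - b) * ‖W b‖)
        ≤ C₀ * (1 + 4 * (H.r * κ) + κ) *
          (decay H.r (n - a) * ‖W a‖ + decay H.r (n - b) * ‖W b‖) :=
      mul_le_mul_of_nonneg_right (le_mul_of_one_le_right hC₀.le (by linarith)) (by linarith)
    have h4 : C₀ * (2 * (H.r * κ) + κ) * γ ≤ C₀ * (1 + 4 * (H.r * κ) + κ) * γ :=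
      mul_le_mul_of_nonneg_right (mul_le_mul_of_nonneg_left (by linarith) hC₀.le) hγ
    linarith
  · have h1 : decay H.r (n - a) * ‖W a‖ ≤ ‖W a‖ :=
      mul_le_of_le_one_left (norm_nonneg _) (decay_le_one hr _)
    have h2 : decay H.r (n - b) * ‖W b‖ ≤ ‖W b‖ :=
      mul_le_of_le_one_left (norm_nonneg _) (decay_le_one hr _)
    have h3 : C₀ * (decay H.r (n - a) * ‖W a‖ + decay H.r (n - b) * ‖W b‖)
        ≤ C₀ * (‖H.P (W a)‖ + ‖H.Pc (W b)‖ + 2 * (μ * s + H.r * κ * γ)) :=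
      mul_le_mul_of_nonneg_left (by linarith) hC₀.le
    have h4 : C₀ * (‖H.P (W a)‖ + ‖H.Pc (W b)‖)
        ≤ C₀ * (1 + 4 * (H.r * κ) + κ) * (‖H.P (W a)‖ + ‖H.Pc (W b)‖) :=
      mul_le_mul_of_nonneg_right (le_mul_of_one_le_right hC₀.le (by linarith)) (by positivity)
    have h5 : 0 ≤ C₀ * γ := by positivity
    have h6 : C₀ * (‖H.P (W a)‖ + ‖H.Pc (W b)‖ + 2 * (μ * s + H.r * κ * γ))
        = C₀ * (‖H.P (W a)‖ + ‖H.Pc (W b)‖) + 2 * (C₀ * μ) * s + 2 * C₀ * (H.r * κ) * γ := by ring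
    rw [e2] at h6
    linarith

end IsHomoclinic
end HypDiffeo

namespace HypDiffeo

variable {X : Type*} [NormedAddCommGroup X] [NormedSpace ℝ X] {H : HypDiffeo X} {Q : ℤ → X}

/-! ### Orbits near a chain: existence and uniqueness -/

/-- The symmetry `F (-x) = -F x`, together with its consequence for the derivative. -/
structure IsOdd (H : HypDiffeo X) : Prop where
  F_neg : ∀ x, H.F (-x) = -H.F x
  DF_neg : ∀ x, H.DF (-x) = H.DF x

/-- All distances of the chain are at least `K`, and the orientations are signs. -/
structure IsChain (K m : ℕ) (N : ℕ → ℕ) (σ : ℕ → ℝ) : Prop where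
  one_lt : 1 < m
  le : ∀ i, 1 ≤ i → i < m → K ≤ N i
  sign : ∀ i, 1 ≤ i → i ≤ m → σ i = 1 ∨ σ i = -1

/-- The chain of copies of `Q`: on each piece it is the copy belonging to that piece. -/
noncomputable def pseudoOrbit (Q : ℤ → X) (m : ℕ) (N : ℕ → ℕ) (σ : ℕ → ℝ) (n : ℤ) : X :=
  σ (pieceIndex m N n) • Q (n - center N (pieceIndex m N n))

theorem IsOdd.F_smul (hodd : H.IsOdd) {s : ℝ} (hs : s = 1 ∨ s = -1) (x : X) :
    H.F (s • x) = s • H.F x := by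
  rcases hs with rfl | rfl <;> simp [hodd.F_neg]

theorem IsOdd.DF_smul (hodd : H.IsOdd) {s : ℝ} (hs : s = 1 ∨ s = -1) (x : X) :
    H.DF (s • x) = H.DF x := by
  rcases hs with rfl | rfl <;> simp [hodd.DF_neg]

theorem norm_sign_smul {s : ℝ} (hs : s = 1 ∨ s = -1) (x : X) : ‖s • x‖ = ‖x‖ := by
  rcases hs with rfl | rfl <;> simp

namespace IsChain

variable {K m : ℕ} {N : ℕ → ℕ} {σ : ℕ → ℝ}

theorem mono {K' : ℕ} (h : IsChain K m N σ) (hK : K' ≤ K) : IsChain K' m N σ :=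
  ⟨h.one_lt, fun i h1 h2 => hK.trans (h.le i h1 h2), h.sign⟩

theorem sign_pieceIndex (h : IsChain K m N σ) (n : ℤ) :
    σ (pieceIndex m N n) = 1 ∨ σ (pieceIndex m N n) = -1 :=
  h.sign _ (pieceIndex_pos n) (pieceIndex_le h.one_lt n)

theorem le_halfPlus (h : IsChain K m N σ) {k : ℕ} (hk : 2 * k ≤ K) {i : ℕ} (h1 : 1 ≤ i)
    (h2 : i < m) : (k : ℤ) ≤ halfPlus N i := by
  have := h.le i h1 h2
  simp only [halfPlus]; omega

/-- A chain is an orbit up to small jumps at the interfaces. -/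
theorem norm_pseudoOrbit_step_le (h : IsChain K m N σ) (hodd : H.IsOdd)
    (hQ : ∀ n, Q (n + 1) = H.F (Q n)) {k : ℕ} {ε : ℝ} (hε : 0 ≤ ε)
    (hk : ∀ n : ℤ, (k : ℤ) ≤ |n| → ‖Q n‖ ≤ ε) (hK : 2 * k ≤ K)
    (hK2 : 2 ≤ K) (n : ℤ) :
    ‖pseudoOrbit Q m N σ (n + 1) - H.F (pseudoOrbit Q m N σ n)‖ ≤ 2 * ε := by
  set i := pieceIndex m N n with hi
  have hi1 : 1 ≤ i := pieceIndex_pos n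
  have him : i ≤ m := pieceIndex_le h.one_lt n
  have hF : H.F (pseudoOrbit Q m N σ n) = σ i • Q (n + 1 - center N i) := by
    rw [pseudoOrbit, hodd.F_smul (h.sign_pieceIndex n), ← hQ, ← hi,
      show n - center N i + 1 = n + 1 - center N i by ring]
  rw [hF]
  by_cases hlast : i < m ∧ n + 1 = interface N i
  · obtain ⟨h1, h2⟩ := hlast
    have h3 := h.le_halfPlus hK hi1 h1
    have h4 := halfPlus_le_halfMinus (N := N) i
    have h5 : interface N i = center N i + halfPlus N i := rfl
    have h6 := interface_eq (N := N) hi1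
    have h7 : pieceIndex m N (n + 1) = i + 1 :=
      pieceIndex_eq (by omega) (by omega) (fun _ => by simpa using h2.ge)
        (fun _ => by
          have h8 := h.le_halfPlus (k := 1) (by omega) (i := i + 1) (by omega) (by omega)
          have h9 : interface N (i + 1) = center N (i + 1) + halfPlus N (i + 1) := rfl
          omega)
    rw [pseudoOrbit, h7]
    refine (norm_sub_le _ _).trans ?_
    rw [norm_sign_smul (h.sign _ (by omega) (by omega)), norm_sign_smul (h.sign _ hi1 him)]
    have h8 := hk (n + 1 - center N (i + 1)) (by rw [abs_of_nonpos] <;> omega)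
    have h9 := hk (n + 1 - center N i) (by rw [abs_of_nonneg] <;> omega)
    linarith
  · have h7 : pieceIndex m N (n + 1) = i := pieceIndex_eq hi1 him
      (fun h1 => by have := interface_pred_le (m := m) (N := N) n h1; rw [← hi] at this; omega)
      (fun h1 => by
        have := lt_interface (m := m) (N := N) n h1
        rw [← hi] at this
        by_contra h2
        exact hlast ⟨h1, by omega⟩)
    rw [pseudoOrbit, h7, sub_self, norm_zero]
    positivity

end IsChain

/-- A sequence on a bounded interval, extended by zero. -/
def extendZero (S : Finset ℤ) : (S → X) →ₗ[ℝ] ℤ → X where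
  toFun y n := if h : n ∈ S then y ⟨n, h⟩ else 0
  map_add' x y := by ext n; by_cases h : n ∈ S <;> simp [h]
  map_smul' c x := by ext n; by_cases h : n ∈ S <;> simp [h]

theorem extendZero_apply {S : Finset ℤ} (y : S → X) (n : S) : extendZero S y n = y n := by
  simp [extendZero]

theorem norm_extendZero_le {S : Finset ℤ} (y : S → X) (n : ℤ) : ‖extendZero S y n‖ ≤ ‖y‖ := by
  by_cases h : n ∈ S
  · simpa [extendZero, h] using norm_le_pi_norm y ⟨n, h⟩
  · simp [extendZero, h]

/-- The linearized boundary value problem along the sequence `U₀` on `[a, b]`. The slot of the last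
time holds the boundary conditions: the stable component at `a` and the unstable one at `b`. -/
noncomputable def linBVP (H : HypDiffeo X) (U₀ : ℤ → X) (a b : ℤ) :
    (Finset.Icc a b → X) →ₗ[ℝ] (Finset.Icc a b → X) where
  toFun y n := if (n : ℤ) < b then
      extendZero _ y (n + 1) - H.DF (U₀ n) (extendZero _ y n)
    else H.P (extendZero _ y a) + H.Pc (extendZero _ y b)
  map_add' x y := by
    ext n
    by_cases h : (n : ℤ) < b <;> simp [h] <;> abel
  map_smul' c x := by
    ext n
    by_cases h : (n : ℤ) < b <;> simp [h, smul_sub]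

/-- The nonlinear boundary value problem on `[a, b]` for the difference to `U₀`. -/
noncomputable def nonlinBVP (H : HypDiffeo X) (U₀ : ℤ → X) (a b : ℤ) (y : Finset.Icc a b → X) :
    Finset.Icc a b → X := fun n => if (n : ℤ) < b then
      U₀ (n + 1) + extendZero _ y (n + 1) - H.F (U₀ n + extendZero _ y n)
    else H.P (extendZero _ y a) + H.Pc (extendZero _ y b)

namespace IsHomoclinic
variable [FiniteDimensional ℝ X]

/-- Existence of an orbit near the chain on long bounded intervals. The linearized boundary value
problem is a square system, which is uniformly invertible by the a priori estimate. -/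
theorem exists_orbit_on_interval (hQ : H.IsHomoclinic Q) (hodd : H.IsOdd)
    (hT : H.stableSpace Q ⊔ H.reverse.stableSpace (fun n => Q (-n)) = ⊤) :
    ∃ δ₁ : ℝ, 0 < δ₁ ∧ ∀ δ, 0 < δ → δ ≤ δ₁ → ∃ K : ℕ, ∀ (m : ℕ) (N : ℕ → ℕ) (σ : ℕ → ℝ),
      IsChain K m N σ → ∀ a b : ℤ, a ≤ -K → center N m + K ≤ b → ∃ U : ℤ → X,
        (∀ n ∈ Finset.Ico a b, U (n + 1) = H.F (U n)) ∧
        ∀ n ∈ Finset.Icc a b, ‖U n - pseudoOrbit Q m N σ n‖ ≤ δ := by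
  obtain ⟨L, ε, C, hε, hC, hchain⟩ := hQ.exists_chain_bound hT
  obtain ⟨R, hR, hQR⟩ := hQ.bounded
  obtain ⟨M, hM, hF, -⟩ := H.c11F (R + 1)
  have hδ₁ : 0 < min 1 (1 / (24 * C * (M + 1))) := by positivity
  refine ⟨min 1 (1 / (24 * C * (M + 1))), hδ₁, fun δ hδ hδle => ?_⟩
  have hMδ0 : 0 ≤ 2 * M * δ := by positivity
  have hδ1 : δ ≤ 1 := hδle.trans (min_le_left _ _)
  have hMδ : 2 * M * δ ≤ 1 / (12 * C) := by
    have h1 : δ ≤ 1 / (24 * C * (M + 1)) := hδle.trans (min_le_right _ _)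
    rw [le_div_iff₀ (by positivity)] at h1 ⊢
    nlinarith
  obtain ⟨k, hk⟩ := hQ.exists_norm_le (ε := δ / (24 * C)) (by positivity)
  refine ⟨L + 2 * k + 2, fun m N σ hch a b ha hb => ?_⟩
  push_cast at ha hb
  set U₀ := pseudoOrbit Q m N σ with hU₀
  have hjump := hch.norm_pseudoOrbit_step_le hodd hQ.orbit (by positivity) hk (by omega) (by omega)
  have hU₀R : ∀ n, ‖U₀ n‖ ≤ R := fun n => by
    rw [hU₀, pseudoOrbit, norm_sign_smul (hch.sign_pieceIndex n)]; exact hQR _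
  have hDF : ∀ n, H.DF (U₀ n) = H.DF (Q (n - center N (pieceIndex m N n))) := fun n =>
    hodd.DF_smul (hch.sign_pieceIndex n) _
  have hab : a ≤ b := by have := center_nonneg (N := N) m; omega
  have ha' : a ∈ Finset.Icc a b := Finset.mem_Icc.2 ⟨le_rfl, hab⟩
  have hb' : b ∈ Finset.Icc a b := Finset.mem_Icc.2 ⟨hab, le_rfl⟩
  -- the a priori estimate of the linearized problem
  have hlin : ∀ y, ‖y‖ ≤ 6 * C * ‖linBVP H U₀ a b y‖ := by
    intro y
    set W := extendZero (Finset.Icc a b) y with hW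
    set γ := ‖linBVP H U₀ a b y‖ with hγ
    have hcomp : ∀ n : Finset.Icc a b, ‖linBVP H U₀ a b y n‖ ≤ γ := norm_le_pi_norm _
    have hend : ‖H.P (W a) + H.Pc (W b)‖ ≤ γ := by
      have := hcomp ⟨b, hb'⟩
      simpa [linBVP] using this
    have hPa : ‖H.P (W a)‖ ≤ γ := by
      have h1 := (H.norm_P _).trans hend
      rwa [map_add, H.P_idem, H.P_Pc, add_zero] at h1
    have hPb : ‖H.Pc (W b)‖ ≤ γ := by
      have h1 := (H.norm_Pc _).trans hend
      have h2 : H.Pc (H.Pc (W b)) = H.Pc (W b) := H.reverse.P_idem _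
      rwa [map_add, H.Pc_P, h2, zero_add] at h1
    have h1 := (hchain m N hch.one_lt (fun i h1 h2 => by have := hch.le i h1 h2; omega) a b W ‖y‖ γ
      (by omega) (by omega) (norm_nonneg _) (fun n _ => norm_extendZero_le y n)
      (fun n hn => ?_)).2
    · have h2 : ‖y‖ ≤ ‖y‖ / 2 + C * (γ + γ + γ) := by
        refine (pi_norm_le_iff_of_nonneg (by positivity)).2 fun n => ?_
        rw [← extendZero_apply y n]
        refine (h1 n n.2).trans (add_le_add le_rfl (mul_le_mul_of_nonneg_left ?_ hC.le))
        linarith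
      linarith
    · have h2 := hcomp ⟨n, Finset.Ico_subset_Icc_self hn⟩
      simp only [linBVP, LinearMap.coe_mk, AddHom.coe_mk, (Finset.mem_Ico.1 hn).2, if_true] at h2
      rw [hDF] at h2
      have : 0 ≤ ε * ‖W n‖ := by positivity
      linarith
  have hinj : Function.Injective (linBVP H U₀ a b) := by
    rw [injective_iff_map_eq_zero]
    intro y hy
    have := hlin y
    rw [hy, norm_zero, mul_zero] at this
    exact norm_le_zero_iff.1 this
  let e := LinearEquiv.ofInjectiveEndo (linBVP H U₀ a b) hinj
  let f' : (Finset.Icc a b → X) →L[ℝ] (Finset.Icc a b → X) :=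
    LinearMap.toContinuousLinearMap (linBVP H U₀ a b)
  let inv : f'.NonlinearRightInverse :=
    { toFun := e.symm
      nnnorm := ⟨6 * C, by positivity⟩
      bound' := fun z => by
        have h1 := hlin (e.symm z)
        have h2 : linBVP H U₀ a b (e.symm z) = z := e.apply_symm_apply z
        rwa [h2] at h1
      right_inv' := fun z => e.apply_symm_apply z }
  have happrox : ApproximatesLinearOn (nonlinBVP H U₀ a b) f' (Metric.closedBall 0 δ)
      ⟨2 * M * δ, by positivity⟩ := by
    intro x hx y hy
    rw [mem_closedBall_zero_iff] at hx hy
    refine (pi_norm_le_iff_of_nonneg (mul_nonneg hMδ0 (norm_nonneg _))).2 fun n => ?_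
    change ‖nonlinBVP H U₀ a b x n - nonlinBVP H U₀ a b y n - linBVP H U₀ a b (x - y) n‖
      ≤ 2 * M * δ * ‖x - y‖
    set w := extendZero (Finset.Icc a b) x with hw
    set z := extendZero (Finset.Icc a b) y with hz
    by_cases hn : (n : ℤ) < b
    · simp only [nonlinBVP, linBVP, LinearMap.coe_mk, AddHom.coe_mk, hn, if_true, map_sub,
        Pi.sub_apply, ← hw, ← hz]
      have h1 : ‖w n‖ ≤ δ := (norm_extendZero_le x n).trans hx
      have h2 : ‖z n‖ ≤ δ := (norm_extendZero_le y n).trans hy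
      have h3 := hF (U₀ n + z n) (U₀ n + w n) (U₀ n)
        ((norm_add_le _ _).trans (by linarith [hU₀R n]))
        ((norm_add_le _ _).trans (by linarith [hU₀R n])) (by linarith [hU₀R n])
      rw [add_sub_cancel_left, add_sub_cancel_left, add_sub_add_left_eq_sub] at h3
      have h4 : ‖w n - z n‖ ≤ ‖x - y‖ := by
        have := norm_extendZero_le (x - y) (n : ℤ)
        rwa [map_sub] at this
      rw [map_sub] at h3
      calc _ = ‖H.F (U₀ n + w n) - H.F (U₀ n + z n)
              - (H.DF (U₀ n) (w n) - H.DF (U₀ n) (z n))‖ := by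
            rw [← norm_neg]; congr 1; abel
        _ ≤ M * (‖z n‖ + ‖w n‖) * ‖w n - z n‖ := h3
        _ ≤ M * (δ + δ) * ‖x - y‖ := by gcongr
        _ = _ := by ring
    · have h0 : nonlinBVP H U₀ a b x n - nonlinBVP H U₀ a b y n
          - linBVP H U₀ a b (x - y) n = 0 := by
        simp only [nonlinBVP, linBVP, LinearMap.coe_mk, AddHom.coe_mk, hn, if_false, map_sub,
          Pi.sub_apply]
        abel
      rw [h0, norm_zero]
      positivity
  have hsurj := happrox.surjOn_closedBall_of_nonlinearRightInverse inv (b := 0) hδ.le subset_rfl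
  have hres : (0 : Finset.Icc a b → X) ∈ Metric.closedBall (nonlinBVP H U₀ a b 0)
      (((6 * C)⁻¹ - 2 * M * δ) * δ) := by
    rw [mem_closedBall_iff_norm', sub_zero]
    have h1 : δ / (12 * C) ≤ ((6 * C)⁻¹ - 2 * M * δ) * δ := by
      have h2 : (6 * C)⁻¹ = 1 / (12 * C) + 1 / (12 * C) := by field_simp; norm_num
      have h3 : 1 / (12 * C) * δ ≤ ((6 * C)⁻¹ - 2 * M * δ) * δ :=
        mul_le_mul_of_nonneg_right (by rw [h2]; linarith) hδ.le
      calc δ / (12 * C) = 1 / (12 * C) * δ := by ring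
        _ ≤ _ := h3
    refine le_trans ?_ h1
    refine (pi_norm_le_iff_of_nonneg (by positivity)).2 fun n => ?_
    by_cases hn : (n : ℤ) < b
    · simp only [nonlinBVP, hn, if_true, map_zero, Pi.zero_apply, add_zero]
      refine (hjump n).trans (le_of_eq ?_)
      field_simp; norm_num
    · simp only [nonlinBVP, hn, if_false, map_zero, Pi.zero_apply, add_zero, norm_zero]
      positivity
  obtain ⟨y, hy, hy0⟩ := hsurj hres
  rw [mem_closedBall_zero_iff] at hy
  refine ⟨fun n => U₀ n + extendZero _ y n, fun n hn => ?_, fun n _ => ?_⟩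
  · have h1 := congrFun hy0 ⟨n, Finset.Ico_subset_Icc_self hn⟩
    simp only [nonlinBVP, (Finset.mem_Ico.1 hn).2, if_true, Pi.zero_apply] at h1
    exact sub_eq_zero.1 h1
  · rw [add_sub_cancel_left]
    exact (norm_extendZero_le y n).trans hy

/-- Existence of an orbit near the chain, by compactness from bounded intervals. -/
theorem exists_orbit (hQ : H.IsHomoclinic Q) (hodd : H.IsOdd)
    (hT : H.stableSpace Q ⊔ H.reverse.stableSpace (fun n => Q (-n)) = ⊤) {δ : ℝ} (hδ : 0 < δ) :
    ∃ K : ℕ, ∀ (m : ℕ) (N : ℕ → ℕ) (σ : ℕ → ℝ), IsChain K m N σ → ∃ U : ℤ → X,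
        (∀ n, U (n + 1) = H.F (U n)) ∧ ∀ n, ‖U n - pseudoOrbit Q m N σ n‖ ≤ δ := by
  obtain ⟨δ₁, hδ₁, h⟩ := hQ.exists_orbit_on_interval hodd hT
  obtain ⟨K, hK⟩ := h (min δ δ₁) (lt_min hδ hδ₁) (min_le_right _ _)
  refine ⟨K, fun m N σ hch => ?_⟩
  set U₀ := pseudoOrbit Q m N σ with hU₀
  have hcont : Continuous H.F := continuous_iff_continuousAt.2 fun x =>
    (H.c11F.hasFDerivAt x).continuousAt
  have hcm := center_nonneg (N := N) m
  let S : ℕ → Set (ℤ → X) := fun j => (Set.univ.pi fun n => Metric.closedBall (U₀ n) δ) ∩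
    ⋂ n ∈ Finset.Ico (-(j : ℤ)) j, {U | U (n + 1) = H.F (U n)}
  have hcl : ∀ j, IsClosed (⋂ n ∈ Finset.Ico (-(j : ℤ)) j, {U : ℤ → X | U (n + 1) = H.F (U n)}) :=
    fun j => isClosed_biInter fun n _ =>
      isClosed_eq (continuous_apply _) (hcont.comp (continuous_apply _))
  have hcomp : IsCompact (Set.univ.pi fun n => Metric.closedBall (U₀ n) δ) := by
    have : ProperSpace X := FiniteDimensional.proper ℝ X
    exact isCompact_univ_pi fun n => isCompact_closedBall _ _
  obtain ⟨U, hU⟩ := IsCompact.nonempty_iInter_of_sequence_nonempty_isCompact_isClosed S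
    (fun j => Set.inter_subset_inter_right _ (Set.biInter_subset_biInter_left fun n hn => by
      simp only [Finset.coe_Ico, Set.mem_Ico] at hn ⊢
      push_cast; omega))
    (fun j => by
      obtain ⟨U, hU1, hU2⟩ := hK m N σ hch (-(j + K : ℤ)) (j + K + center N m) (by omega) (by omega)
      refine ⟨fun n => if n ∈ Finset.Icc (-(j + K : ℤ)) (j + K + center N m) then U n else U₀ n,
        fun n _ => ?_, Set.mem_iInter₂.2 fun n hn => ?_⟩
      · rw [mem_closedBall_iff_norm]
        dsimp only
        split_ifs with h1
        · exact (hU2 n h1).trans (min_le_left _ _)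
        · simpa using hδ.le
      · rw [Finset.mem_Ico] at hn
        simp only [Set.mem_ofPred_eq]
        rw [if_pos (Finset.mem_Icc.2 ⟨by omega, by omega⟩),
          if_pos (Finset.mem_Icc.2 ⟨by omega, by omega⟩)]
        exact hU1 n (Finset.mem_Ico.2 ⟨by omega, by omega⟩))
    (hcomp.inter_right (hcl 0)) (fun j => hcomp.isClosed.inter (hcl j))
  rw [Set.mem_iInter] at hU
  refine ⟨U, fun n => ?_, fun n => ?_⟩
  · have h1 := Set.mem_iInter₂.1 (hU (n.natAbs + 1)).2 n
      (Finset.mem_Ico.2 ⟨by omega, by omega⟩)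
    exact h1
  · have h1 := (hU 0).1 n (Set.mem_univ n)
    rwa [mem_closedBall_iff_norm] at h1

/-- Two orbits near the same chain coincide: their difference is a bounded solution of a small
perturbation of the linearized equation. -/
theorem exists_unique_orbit (hQ : H.IsHomoclinic Q) (hodd : H.IsOdd)
    (hT : H.stableSpace Q ⊔ H.reverse.stableSpace (fun n => Q (-n)) = ⊤) :
    ∃ δ : ℝ, 0 < δ ∧ ∃ K : ℕ, ∀ (m : ℕ) (N : ℕ → ℕ) (σ : ℕ → ℝ), IsChain K m N σ →
      ∀ U U' : ℤ → X, (∀ n, U (n + 1) = H.F (U n)) → (∀ n, U' (n + 1) = H.F (U' n)) →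
        (∀ n, ‖U n - pseudoOrbit Q m N σ n‖ ≤ δ) → (∀ n, ‖U' n - pseudoOrbit Q m N σ n‖ ≤ δ) →
        U' = U := by
  obtain ⟨L, ε, C, hε, hC, hchain⟩ := hQ.exists_chain_bound hT
  obtain ⟨R, hR, hQR⟩ := hQ.bounded
  obtain ⟨M, hM, hF, -⟩ := H.c11F (R + 1)
  have hr := H.one_lt
  refine ⟨min 1 (ε / (2 * (M + 1))), by positivity, L, fun m N σ hch U U' hU hU' hd hd' => ?_⟩
  set δ := min 1 (ε / (2 * (M + 1))) with hδ
  have hδ1 : δ ≤ 1 := min_le_left _ _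
  have hMδ : M * (δ + δ) ≤ ε := by
    have h1 : δ ≤ ε / (2 * (M + 1)) := min_le_right _ _
    have h0 : 0 ≤ δ := by positivity
    rw [le_div_iff₀ (by positivity)] at h1
    nlinarith
  set U₀ := pseudoOrbit Q m N σ with hU₀
  have hU₀R : ∀ n, ‖U₀ n‖ ≤ R := fun n => by
    rw [hU₀, pseudoOrbit, norm_sign_smul (hch.sign_pieceIndex n)]; exact hQR _
  have hDF : ∀ n, H.DF (U₀ n) = H.DF (Q (n - center N (pieceIndex m N n))) := fun n =>
    hodd.DF_smul (hch.sign_pieceIndex n) _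
  have hnear : ∀ (V : ℤ → X), (∀ n, ‖V n - U₀ n‖ ≤ δ) → ∀ n, ‖V n‖ ≤ R + 1 := fun V hV n => by
    have := norm_add_le (V n - U₀ n) (U₀ n)
    rw [sub_add_cancel] at this
    linarith [hV n, hU₀R n]
  have hstep : ∀ n, ‖(U' (n + 1) - U (n + 1))
      - H.DF (Q (n - center N (pieceIndex m N n))) (U' n - U n)‖ ≤ ε * ‖U' n - U n‖ + 0 := by
    intro n
    rw [hU, hU', ← hDF, add_zero]
    refine (hF (U n) (U' n) (U₀ n) (hnear U hd n) (hnear U' hd' n)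
      (by linarith [hU₀R n])).trans (mul_le_mul_of_nonneg_right ?_ (norm_nonneg _))
    exact (mul_le_mul_of_nonneg_left (add_le_add (hd n) (hd' n)) hM).trans hMδ
  have hzero : ∀ n ∈ (Set.univ : Set ℤ), ‖U' n - U n‖ ≤ 2 * 0 := by
    refine le_two_mul_of_halving Set.univ (fun n => ‖U' n - U n‖) (s₀ := δ + δ) (fun n _ => ?_)
      fun s hs n _ => ?_
    · have := norm_sub_le (U' n - U₀ n) (U n - U₀ n)
      rw [sub_sub_sub_cancel_right] at this
      linarith [hd n, hd' n]
    · have hs0 : 0 ≤ s := (norm_nonneg _).trans (hs 0 trivial)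
      have h1 : ‖U' n - U n‖ ≤ s / 4 := by
        refine le_of_forall_decay hr (c := C * (2 * s)) 0 ?_
        filter_upwards [eventually_ge_atTop (n.natAbs + L + (center N m).natAbs)] with k hk
        have h2 := (hchain m N hch.one_lt hch.le (n - k) (n + k)
          (fun n => U' n - U n) s 0 (by omega) (by omega) le_rfl (fun l _ => hs l trivial)
          (fun l _ => hstep l)).1 n (Finset.mem_Icc.2 ⟨by omega, by omega⟩)
        refine h2.trans (add_le_add le_rfl ?_)
        rw [mul_assoc]
        refine mul_le_mul_of_nonneg_left ?_ hC.le
        rw [sub_sub_cancel, sub_add_cancel_left, decay_neg, zero_sub, decay_neg]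
        have h3 := mul_le_mul_of_nonneg_left (hs (n - k) trivial) (decay_nonneg hr (k : ℤ))
        have h4 := mul_le_mul_of_nonneg_left (hs (n + k) trivial) (decay_nonneg hr (k : ℤ))
        linarith
      linarith
  funext n
  have := hzero n trivial
  rw [mul_zero] at this
  exact sub_eq_zero.1 (norm_le_zero_iff.1 this)

end IsHomoclinic
end HypDiffeo

/-! ### Estimates of the remainders -/

section bounds
variable {r : ℝ} {m : ℕ} {N : ℕ → ℕ}

theorem minDist_le {i : ℕ} (h1 : 1 ≤ i) (h2 : i < m) : minDist m N ≤ N i := by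
  have : sInf (N '' Set.Icc 1 (m - 1)) ≤ N i :=
    Nat.sInf_le ⟨i, ⟨h1, by omega⟩, rfl⟩
  simp only [minDist]; exact_mod_cast this

theorem minDist_le_two_mul_halfMinus {i : ℕ} (h1 : 1 ≤ i) (h2 : i < m) :
    minDist m N ≤ 2 * halfMinus N i := by
  have := minDist_le (N := N) h1 h2
  have := halfPlus_add_halfMinus (N := N) i
  have := halfPlus_le_halfMinus (N := N) i
  omega

theorem minDist_le_two_mul_halfPlus {i : ℕ} (h1 : 1 ≤ i) (h2 : i < m) :
    minDist m N ≤ 2 * halfPlus N i + 1 := by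
  have := minDist_le (N := N) h1 h2
  have := halfPlus_add_halfMinus (N := N) i
  have := halfMinus_le (N := N) i
  omega

/-- The bound of the remainder on the `i`-th piece: the sum of the contributions of the existing
neighbours. -/
noncomputable def neighbourBound (r : ℝ) (m : ℕ) (N : ℕ → ℕ) (i : ℕ) (n : ℤ) : ℝ :=
  (if 1 < i then leftBound r N i n else 0) + (if i < m then rightBound r N i n else 0)

theorem decay_mul_leftBound_le (hr : 1 < r) {i : ℕ} (h1 : 1 < i) (h2 : i ≤ m) (n : ℤ) :
    decay r n * leftBound r N i n ≤ r * r ^ (-minDist m N) := by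
  have hr0 : r ≠ 0 := by linarith
  have h3 := minDist_le_two_mul_halfMinus (N := N) (m := m) (i := i - 1) (by omega) (by omega)
  have h4 : decay r n ≤ r ^ n := zpow_le_zpow_right₀ hr.le (neg_abs_le n)
  calc decay r n * leftBound r N i n
      ≤ r ^ n * leftBound r N i n := mul_le_mul_of_nonneg_right h4 (by
        have : 0 < r := by linarith
        unfold leftBound; positivity)
    _ = r ^ (-(2 * halfMinus N (i - 1))) := by
        rw [leftBound, ← zpow_add₀ hr0, ← zpow_add₀ hr0]; congr 1; ring
    _ ≤ r ^ (1 + -minDist m N) := zpow_le_zpow_right₀ hr.le (by omega)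
    _ = _ := by rw [zpow_add₀ hr0, zpow_one]

theorem decay_mul_rightBound_le (hr : 1 < r) {i : ℕ} (h1 : 1 ≤ i) (h2 : i < m) (n : ℤ) :
    decay r n * rightBound r N i n ≤ r * r ^ (-minDist m N) := by
  have hr0 : r ≠ 0 := by linarith
  have h3 := minDist_le_two_mul_halfPlus (N := N) (m := m) h1 h2
  have h4 : decay r n ≤ r ^ (-n) := zpow_le_zpow_right₀ hr.le (by have := le_abs_self n; omega)
  calc decay r n * rightBound r N i n
      ≤ r ^ (-n) * rightBound r N i n := mul_le_mul_of_nonneg_right h4 (by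
        have : 0 < r := by linarith
        unfold rightBound; positivity)
    _ = r ^ (-(2 * halfPlus N i)) := by
        rw [rightBound, ← zpow_add₀ hr0, ← zpow_add₀ hr0]; congr 1; ring
    _ ≤ r ^ (1 + -minDist m N) := zpow_le_zpow_right₀ hr.le (by omega)
    _ = _ := by rw [zpow_add₀ hr0, zpow_one]

theorem decay_mul_neighbourBound_le (hr : 1 < r) {i : ℕ} (h1 : 1 ≤ i) (h2 : i ≤ m) (n : ℤ) :
    decay r n * neighbourBound r m N i n ≤ 2 * (r * r ^ (-minDist m N)) := by
  have h0 : 0 ≤ r * r ^ (-minDist m N) := by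
    have : 0 < r := by linarith
    positivity
  have hl : decay r n * (if 1 < i then leftBound r N i n else 0) ≤ r * r ^ (-minDist m N) := by
    split_ifs with h
    · exact decay_mul_leftBound_le hr h h2 n
    · simpa using h0
  have hR : decay r n * (if i < m then rightBound r N i n else 0) ≤ r * r ^ (-minDist m N) := by
    split_ifs with h
    · exact decay_mul_rightBound_le hr h1 h n
    · simpa using h0
  rw [neighbourBound, mul_add]
  linarith

theorem mem_piece_of_nonneg {i : ℕ} (n : ℤ) (h1 : 0 ≤ n) (h2 : i < m → n ≤ halfPlus N i) :
    n ∈ piece m N i := by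
  refine ⟨fun _ => ?_, h2⟩
  have := halfPlus_nonneg (N := N) (i - 1)
  have := halfPlus_le_halfMinus (N := N) (i - 1)
  omega

theorem mem_piece_of_nonpos {i : ℕ} (n : ℤ) (h1 : n ≤ 0) (h2 : 1 < i → -halfMinus N (i - 1) ≤ n) :
    n ∈ piece m N i := by
  refine ⟨h2, fun _ => ?_⟩
  have := halfPlus_nonneg (N := N) i
  omega

end bounds

namespace HypDiffeo
variable {X : Type*} [NormedAddCommGroup X] [NormedSpace ℝ X] {H : HypDiffeo X} {Q : ℤ → X}

namespace IsHomoclinic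

/-- On a long interval, the difference of an orbit to a nearby copy of the homoclinic orbit decays
from the ends at the full rate. -/
theorem exists_difference_bound [FiniteDimensional ℝ X] (hQ : H.IsHomoclinic Q) (hodd : H.IsOdd)
    (hT : H.stableSpace Q ⊔ H.reverse.stableSpace (fun n => Q (-n)) = ⊤) :
    ∃ (L : ℕ) (δ C : ℝ), 0 < δ ∧ 0 < C ∧ ∀ (a b : ℤ) (V : ℤ → X) (s : ℝ), a ≤ -L → L ≤ b →
      (s = 1 ∨ s = -1) → (∀ n ∈ Finset.Ico a b, V (n + 1) = H.F (V n)) →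
      (∀ n ∈ Finset.Icc a b, ‖V n - s • Q n‖ ≤ δ) → ∀ n ∈ Finset.Icc a b,
      ‖V n - s • Q n‖ ≤ C * (decay H.r (n - a) * ‖V a - s • Q a‖
        + decay H.r (n - b) * ‖V b - s • Q b‖) := by
  have hr := H.one_lt
  have hκ := decaySum_pos hr
  obtain ⟨L, C, hC, hdich⟩ := hQ.exists_dichotomy hT
  obtain ⟨R, hR, hQR⟩ := hQ.bounded
  obtain ⟨M, hM, hF, -⟩ := H.c11F (R + 1)
  set q := C * M * decaySum H.r with hq
  have hq0 : 0 ≤ q := by positivity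
  set δ := min 1 (1 / (8 * (q * (1 + C) + 1))) with hδ
  have hδ0 : 0 < δ := by positivity
  have hδ1 : δ ≤ 1 := min_le_left _ _
  have hqδ : q * (1 + C) * δ ≤ 1 / 8 := by
    have h1 : δ ≤ 1 / (8 * (q * (1 + C) + 1)) := min_le_right _ _
    rw [le_div_iff₀ (by positivity)] at h1
    linarith
  have hqδ1 : 0 ≤ q * δ := by positivity
  have hqδ2 : 0 ≤ q * C * δ := by positivity
  refine ⟨L, δ, 2 * C, hδ0, by positivity, fun a b V s ha hb hs hV hd n hn => ?_⟩
  have hsQ : ∀ n, ‖s • Q n‖ ≤ R := fun n => by rw [norm_sign_smul hs]; exact hQR n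
  have key := quadratic_gronwall hr (Finset.Icc a b) (w := fun n => ‖V n - s • Q n‖)
    (α := ‖V a - s • Q a‖) (β := ‖V b - s • Q b‖) (C := C) (c := C * M) (δ := δ) (a := a) (b := b)
    hC.le (by positivity) (norm_nonneg _) (norm_nonneg _)
    (hd a (Finset.mem_Icc.2 ⟨le_rfl, by omega⟩)) (hd b (Finset.mem_Icc.2 ⟨by omega, le_rfl⟩))
    (fun _ => norm_nonneg _) hd
    (by rw [show C * M * δ * decaySum H.r = q * δ by rw [hq]; ring]; linarith)
    (by rw [show C * M * (2 * decaySum H.r * (C * δ + C * δ)) = 4 * (q * C * δ) by rw [hq]; ring]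
        linarith) (fun n hn => ?_) n hn
  · refine key.trans (le_of_eq ?_)
    ring
  · refine (hdich a b (fun n => V n - s • Q n) (fun n => M * ‖V n - s • Q n‖ ^ 2) ha hb
      (fun n => by positivity) (fun l hl => ?_) n hn).trans ?_
    · have hl' := Finset.Ico_subset_Icc_self hl
      have h1 : ‖V l‖ ≤ R + 1 := by
        have := norm_add_le (V l - s • Q l) (s • Q l)
        rw [sub_add_cancel] at this
        linarith [hd l hl', hsQ l]
      have h2 := hF (s • Q l) (V l) (s • Q l) (by linarith [hsQ l]) h1 (by linarith [hsQ l])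
      rw [sub_self, norm_zero, zero_add, hodd.F_smul hs, ← hQ.orbit, hodd.DF_smul hs,
        ← hV l hl] at h2
      refine h2.trans (le_of_eq (by ring))
    · rw [mul_add C, mul_assoc C M]
      refine add_le_add (le_of_eq (by ring)) (mul_le_mul_of_nonneg_left ?_ hC.le)
      rw [Finset.mul_sum]
      refine (Finset.sum_le_sum_of_subset_of_nonneg Finset.Ico_subset_Icc_self
        fun l _ _ => ?_).trans (le_of_eq (Finset.sum_congr rfl fun l _ => by ring))
      have := decay_nonneg hr (n - l)
      positivity

/-- Between two neighbouring copies an orbit near the chain decays from both at the full rate. -/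
theorem exists_gap_bound (hQ : H.IsHomoclinic Q) :
    ∃ (K : ℕ) (δ C : ℝ), 0 < δ ∧ 0 < C ∧ ∀ (m : ℕ) (N : ℕ → ℕ) (σ : ℕ → ℝ), IsChain K m N σ →
      ∀ U : ℤ → X, (∀ n, U (n + 1) = H.F (U n)) →
      (∀ i, 1 ≤ i → i ≤ m → ∀ n ∈ piece m N i, ‖U (n + center N i) - σ i • Q n‖ ≤ δ) →
      ∀ i, 1 ≤ i → i < m → ∀ n : ℤ, 0 ≤ n → n ≤ N i →
      ‖U (n + center N i)‖ ≤ C * (decay H.r n + decay H.r (n - N i)) := by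
  have hr := H.one_lt
  have hr0 := H.r_pos
  obtain ⟨δ₁, hδ₁, hδ₁1, hsmall⟩ := H.exists_small_orbit_bound
  obtain ⟨R, hR, hQR⟩ := hQ.bounded
  obtain ⟨k, hk⟩ := hQ.exists_norm_le (ε := δ₁ / 2) (by positivity)
  have hrk : 0 < H.r ^ (k : ℤ) := zpow_pos hr0 _
  refine ⟨2 * k, δ₁ / 2, 2 * (R + 1) * H.r ^ (k : ℤ), by positivity, by positivity,
    fun m N σ hch U hU hd i h1 h2 n hn0 hnN => ?_⟩
  set c := center N i with hc
  have hc' : center N (i + 1) = c + N i := center_succ h1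
  have hkp := hch.le_halfPlus (k := k) le_rfl h1 h2
  have hpq := halfPlus_add_halfMinus (N := N) i
  have hpq' := halfPlus_le_halfMinus (N := N) i
  -- the orbit is close to the nearer copy
  have hleft : ∀ l : ℤ, 0 ≤ l → l ≤ halfPlus N i → ‖U (l + c)‖ ≤ δ₁ / 2 + ‖Q l‖ := by
    intro l hl0 hl
    have h3 := hd i h1 h2.le l (mem_piece_of_nonneg l hl0 fun _ => hl)
    have h4 := norm_add_le (U (l + center N i) - σ i • Q l) (σ i • Q l)
    rw [sub_add_cancel, norm_sign_smul (hch.sign i h1 h2.le)] at h4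
    linarith
  have hright : ∀ l : ℤ, l ≤ N i → halfPlus N i ≤ l → ‖U (l + c)‖ ≤ δ₁ / 2 + ‖Q (l - N i)‖ := by
    intro l hl0 hl
    have h3 := hd (i + 1) (by omega) (by omega) (l - N i)
      (mem_piece_of_nonpos _ (by omega) fun _ => by rw [Nat.add_sub_cancel]; omega)
    rw [hc', show l - N i + (c + N i) = l + c by ring] at h3
    have h4 := norm_add_le (U (l + c) - σ (i + 1) • Q (l - N i)) (σ (i + 1) • Q (l - N i))
    rw [sub_add_cancel, norm_sign_smul (hch.sign (i + 1) (by omega) (by omega))] at h4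
    linarith
  have hdn := decay_nonneg hr n
  have hdN := decay_nonneg hr (n - N i)
  rcases lt_or_ge n k with h | h
  · have h3 := hleft n hn0 (by omega)
    have h4 := hQR n
    have h5 : 1 ≤ H.r ^ (k : ℤ) * decay H.r n := by
      rw [decay_of_nonneg hn0, ← zpow_add₀ hr0.ne']
      exact one_le_zpow₀ hr.le (by omega)
    have h6 : R + 1 ≤ (R + 1) * (H.r ^ (k : ℤ) * decay H.r n) :=
      le_mul_of_one_le_right (by linarith) h5
    have h7 : 0 ≤ (R + 1) * (H.r ^ (k : ℤ) * decay H.r n) := by positivity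
    have h8 : 0 ≤ (R + 1) * (H.r ^ (k : ℤ) * decay H.r (n - N i)) := by positivity
    linarith
  rcases lt_or_ge (N i - k : ℤ) n with h' | h'
  · have h3 := hright n hnN (by omega)
    have h4 := hQR (n - N i)
    have h5 : 1 ≤ H.r ^ (k : ℤ) * decay H.r (n - N i) := by
      rw [decay_of_nonpos (by omega), ← zpow_add₀ hr0.ne']
      exact one_le_zpow₀ hr.le (by omega)
    have h6 : R + 1 ≤ (R + 1) * (H.r ^ (k : ℤ) * decay H.r (n - N i)) :=
      le_mul_of_one_le_right (by linarith) h5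
    have h7 : 0 ≤ (R + 1) * (H.r ^ (k : ℤ) * decay H.r n) := by positivity
    have h8 : 0 ≤ (R + 1) * (H.r ^ (k : ℤ) * decay H.r (n - N i)) := by positivity
    linarith
  have hgap : ∀ l : ℤ, k ≤ l → l ≤ N i - k → ‖U (l + c)‖ ≤ δ₁ := by
    intro l hl1 hl2
    rcases le_total l (halfPlus N i) with h3 | h3
    · have h4 := hleft l (by omega) h3
      have h5 := hk l (by rw [abs_of_nonneg] <;> omega)
      linarith
    · have h4 := hright l (by omega) h3
      have h5 := hk (l - N i) (by rw [abs_of_nonpos] <;> omega)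
      linarith
  have key := hsmall k (N i - k) (fun l => U (l + c)) (by omega)
    (fun l _ => by rw [show l + 1 + c = l + c + 1 by ring]; exact hU _)
    (fun l hl => hgap l (Finset.mem_Icc.1 hl).1 (Finset.mem_Icc.1 hl).2) n
    (Finset.mem_Icc.2 ⟨h, h'⟩)
  have h3 : decay H.r (n - k) ≤ H.r ^ (k : ℤ) * decay H.r n := by
    have := decay_le_mul hr n (-(k : ℤ))
    rwa [abs_neg, Nat.abs_cast, ← sub_eq_add_neg] at this
  have h4 : decay H.r (n - (N i - k)) ≤ H.r ^ (k : ℤ) * decay H.r (n - N i) := by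
    have := decay_le_mul hr (n - N i) (k : ℤ)
    rwa [Nat.abs_cast, show n - N i + (k : ℤ) = n - (N i - k) by ring] at this
  refine key.trans ?_
  have h5 : ‖U (k + c)‖ * decay H.r (n - k) ≤ 1 * (H.r ^ (k : ℤ) * decay H.r n) :=
    mul_le_mul ((hgap k le_rfl (by omega)).trans hδ₁1) h3 (decay_nonneg hr _) zero_le_one
  have h6 : ‖U (N i - k + c)‖ * decay H.r (n - (N i - k))
      ≤ 1 * (H.r ^ (k : ℤ) * decay H.r (n - N i)) :=
    mul_le_mul ((hgap _ (by omega) le_rfl).trans hδ₁1) h4 (decay_nonneg hr _) zero_le_one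
  have h7 : 0 ≤ R * (H.r ^ (k : ℤ) * decay H.r n) := by positivity
  have h8 : 0 ≤ R * (H.r ^ (k : ℤ) * decay H.r (n - N i)) := by positivity
  linarith

/-- The estimates for an orbit near a chain. On each piece the remainder is bounded by the
contributions of the neighbours, and at an interface the orbit agrees with the sum of the two
adjacent copies up to the square of their size. -/
theorem exists_remainder_bounds [FiniteDimensional ℝ X] (hQ : H.IsHomoclinic Q) (hodd : H.IsOdd)
    (hT : H.stableSpace Q ⊔ H.reverse.stableSpace (fun n => Q (-n)) = ⊤) :
    ∃ (K : ℕ) (δ C : ℝ), 0 < δ ∧ 0 ≤ C ∧ ∀ (m : ℕ) (N : ℕ → ℕ) (σ : ℕ → ℝ), IsChain K m N σ →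
      ∀ U : ℤ → X, (∀ n, U (n + 1) = H.F (U n)) →
      (∀ i, 1 ≤ i → i ≤ m → ∀ n ∈ piece m N i, ‖U (n + center N i) - σ i • Q n‖ ≤ δ) →
      (∀ i, 1 ≤ i → i ≤ m → ∀ n ∈ piece m N i,
        ‖U (n + center N i) - σ i • Q n‖ ≤ C * neighbourBound H.r m N i n) ∧
      (∀ i, 1 ≤ i → i < m → ‖U (interface N i) - σ i • Q (halfPlus N i)
        - σ (i + 1) • Q (-halfMinus N i)‖ ≤ C * H.r ^ (-minDist m N)) := by
  have hr := H.one_lt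
  have hr0 := H.r_pos
  have hκ := decaySum_pos hr
  obtain ⟨L, δ₁, C₁, hδ₁, hC₁, hdiff⟩ := hQ.exists_difference_bound hodd hT
  obtain ⟨K, δ₂, C₂, hδ₂, hC₂, hgap⟩ := hQ.exists_gap_bound
  obtain ⟨R, hR, hQR⟩ := hQ.bounded
  obtain ⟨D, hD, hQD⟩ := hQ.bound
  obtain ⟨M, hM, hF, -⟩ := H.c11F (R + 1)
  set δ := min 1 (min δ₁ δ₂) with hδ
  have hδ0 : 0 < δ := by positivity
  set E := 2 * C₂ * H.r + D with hE
  have hE0 : 0 ≤ E := by positivity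
  set C₃ := C₁ * E with hC₃
  have hC₃0 : 0 ≤ C₃ := by positivity
  set e₀ := M * (D + 2 * C₂) * (C₃ * (2 * H.r)) + M * D ^ 2 * H.r with he₀
  have he₀0 : 0 ≤ e₀ := by positivity
  set C₄ := 2 * (C₃ * (2 * H.r) + D) + H.r * (decaySum H.r * e₀) with hC₄
  have hC₄0 : 0 ≤ C₄ := by positivity
  refine ⟨max K (2 * L), δ, C₃ + C₄, hδ0, by positivity, fun m N σ hch U hU hd => ?_⟩
  have hd1 : ∀ i, 1 ≤ i → i ≤ m → ∀ n ∈ piece m N i, ‖U (n + center N i) - σ i • Q n‖ ≤ δ₁ :=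
    fun i h1 h2 n hn => (hd i h1 h2 n hn).trans ((min_le_right _ _).trans (min_le_left _ _))
  have hg := hgap m N σ (hch.mono (le_max_left _ _)) U hU
    (fun i h1 h2 n hn => (hd i h1 h2 n hn).trans ((min_le_right _ _).trans (min_le_right _ _)))
  have hpL : ∀ i, 1 ≤ i → i < m → (L : ℤ) ≤ halfPlus N i := fun i h1 h2 =>
    hch.le_halfPlus (le_max_right _ _) h1 h2
  -- the size of the orbit at an interface
  have hint : ∀ i, 1 ≤ i → i < m → ‖U (halfPlus N i + center N i)‖
      ≤ 2 * C₂ * decay H.r (halfPlus N i) := by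
    intro i h1 h2
    have h3 := halfPlus_nonneg (N := N) i
    have h4 := halfPlus_add_halfMinus (N := N) i
    have h5 := halfPlus_le_halfMinus (N := N) i
    have h6 := hg i h1 h2 (halfPlus N i) h3 (by omega)
    have h7 : decay H.r (halfPlus N i - N i) ≤ decay H.r (halfPlus N i) :=
      decay_anti hr (by rw [abs_of_nonneg h3, abs_of_nonpos] <;> omega)
    have h8 := mul_le_mul_of_nonneg_left h7 hC₂.le
    linarith
  have hendR : ∀ i, 1 ≤ i → i < m → ‖U (halfPlus N i + center N i) - σ i • Q (halfPlus N i)‖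
      ≤ E * H.r ^ (-halfPlus N i) := by
    intro i h1 h2
    rw [← decay_of_nonneg (halfPlus_nonneg i)]
    have h3 := norm_sub_le (U (halfPlus N i + center N i)) (σ i • Q (halfPlus N i))
    rw [norm_sign_smul (hch.sign i h1 h2.le)] at h3
    have h4 := hint i h1 h2
    have h5 := hQD (halfPlus N i)
    have h6 : 2 * C₂ * decay H.r (halfPlus N i) ≤ 2 * C₂ * H.r * decay H.r (halfPlus N i) :=
      mul_le_mul_of_nonneg_right (le_mul_of_one_le_right (by positivity) hr.le)
        (decay_nonneg hr _)
    rw [hE]; linarith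
  have hpos : ∀ i, 1 ≤ i → -halfMinus N i + center N (i + 1) = halfPlus N i + center N i := by
    intro i h1
    have h3 := halfPlus_add_halfMinus (N := N) i
    rw [center_succ h1]; omega
  have hendL : ∀ i, 1 ≤ i → i < m → ‖U (-halfMinus N i + center N (i + 1))
      - σ (i + 1) • Q (-halfMinus N i)‖ ≤ E * H.r ^ (-halfMinus N i) := by
    intro i h1 h2
    have h0 := halfPlus_nonneg (N := N) i
    have h0' := halfPlus_le_halfMinus (N := N) i
    rw [← decay_of_nonneg (by omega), hpos i h1]
    have h3 := norm_sub_le (U (halfPlus N i + center N i)) (σ (i + 1) • Q (-halfMinus N i))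
    rw [norm_sign_smul (hch.sign _ (by omega) (by omega))] at h3
    have h4 := hint i h1 h2
    have h5 := hQD (-halfMinus N i)
    rw [decay_neg] at h5
    have h6 : decay H.r (halfPlus N i) ≤ H.r * decay H.r (halfMinus N i) := by
      have h7 := halfMinus_le (N := N) i
      rw [decay_of_nonneg h0, decay_of_nonneg (by omega), ← zpow_one_add₀ hr0.ne']
      exact zpow_le_zpow_right₀ hr.le (by omega)
    have h7 := mul_le_mul_of_nonneg_left h6 (by positivity : 0 ≤ 2 * C₂)
    rw [hE]; linarith
  have h3 : ∀ i, 1 ≤ i → i ≤ m → ∀ n ∈ piece m N i,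
      ‖U (n + center N i) - σ i • Q n‖ ≤ C₃ * neighbourBound H.r m N i n := by
    intro i h1 h2 n hn
    refine le_of_forall_decay hr (c := C₁ * (2 * δ)) 0 ?_
    filter_upwards [eventually_ge_atTop (n.natAbs + L)] with k hk
    rw [zero_sub, decay_neg]
    -- infinite ends are replaced by remote ones
    set a : ℤ := if 1 < i then -halfMinus N (i - 1) else n - k with ha
    set b : ℤ := if i < m then halfPlus N i else n + k with hb
    have haL : a ≤ -L ∧ a ≤ n := by
      rw [ha]
      split_ifs with h
      · have := hpL (i - 1) (by omega) (by omega)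
        have := halfPlus_le_halfMinus (N := N) (i - 1)
        exact ⟨by omega, hn.1 h⟩
      · omega
    have hbL : (L : ℤ) ≤ b ∧ n ≤ b := by
      rw [hb]
      split_ifs with h
      · exact ⟨hpL i h1 h, hn.2 h⟩
      · omega
    have hpiece : ∀ l ∈ Finset.Icc a b, l ∈ piece m N i := by
      intro l hl
      rw [Finset.mem_Icc, ha, hb] at hl
      refine ⟨fun h => ?_, fun h => ?_⟩
      · rw [if_pos h] at hl; exact hl.1
      · rw [if_pos h] at hl; exact hl.2
    have key := hdiff a b (fun l => U (l + center N i)) (σ i) haL.1 hbL.1 (hch.sign i h1 h2)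
      (fun l _ => by rw [show l + 1 + center N i = l + center N i + 1 by ring]; exact hU _)
      (fun l hl => hd1 i h1 h2 l (hpiece l hl)) n (Finset.mem_Icc.2 ⟨haL.2, hbL.2⟩)
    have hA : decay H.r (n - a) * ‖U (a + center N i) - σ i • Q a‖
        ≤ E * (if 1 < i then leftBound H.r N i n else 0) + δ * decay H.r k := by
      have hmem := hpiece a (Finset.mem_Icc.2 ⟨le_rfl, by omega⟩)
      have hdk : 0 ≤ δ * decay H.r k := mul_nonneg hδ0.le (decay_nonneg hr _)
      by_cases h : 1 < i
      · rw [ha, if_pos h, if_pos h]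
        have h4 := hendL (i - 1) (by omega) (by omega)
        rw [Nat.sub_add_cancel h1] at h4
        have h5 := hn.1 h
        have h6 := mul_le_mul_of_nonneg_left h4 (decay_nonneg hr (n - -halfMinus N (i - 1)))
        rw [decay_of_nonneg (by omega)] at h6 ⊢
        refine h6.trans ?_
        rw [leftBound, show -(halfMinus N (i - 1) + n) = -(n - -halfMinus N (i - 1)) by ring]
        linarith
      · have h4 := hd i h1 h2 a hmem
        rw [if_neg h, mul_zero, zero_add]
        have h5 : a = n - k := by rw [ha, if_neg h]
        rw [h5] at h4 ⊢
        rw [sub_sub_cancel, mul_comm]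
        exact mul_le_mul_of_nonneg_right h4 (decay_nonneg hr _)
    have hB : decay H.r (n - b) * ‖U (b + center N i) - σ i • Q b‖
        ≤ E * (if i < m then rightBound H.r N i n else 0) + δ * decay H.r k := by
      have hmem := hpiece b (Finset.mem_Icc.2 ⟨by omega, le_rfl⟩)
      have hdk : 0 ≤ δ * decay H.r k := mul_nonneg hδ0.le (decay_nonneg hr _)
      by_cases h : i < m
      · rw [hb, if_pos h, if_pos h]
        have h4 := hendR i h1 h
        have h5 := hn.2 h
        have h6 := mul_le_mul_of_nonneg_left h4 (decay_nonneg hr (n - halfPlus N i))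
        rw [decay_of_nonpos (by omega)] at h6 ⊢
        refine h6.trans ?_
        rw [rightBound, show -(halfPlus N i - n) = n - halfPlus N i by ring]
        linarith
      · have h4 := hd i h1 h2 b hmem
        rw [if_neg h, mul_zero, zero_add]
        have h5 : b = n + k := by rw [hb, if_neg h]
        rw [h5] at h4 ⊢
        rw [sub_add_cancel_left, decay_neg, mul_comm]
        exact mul_le_mul_of_nonneg_right h4 (decay_nonneg hr _)
    refine (key.trans (mul_le_mul_of_nonneg_left (add_le_add hA hB) hC₁.le)).trans (le_of_eq ?_)
    rw [hC₃, neighbourBound]; ring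
  have hρ : 0 < H.r ^ (-minDist m N) := zpow_pos hr0 _
  have hnb : ∀ i n, 0 ≤ neighbourBound H.r m N i n := fun i n => by
    unfold neighbourBound leftBound rightBound
    split_ifs <;> positivity
  refine ⟨fun i h1 h2 n hn => (h3 i h1 h2 n hn).trans
    (mul_le_mul_of_nonneg_right (by linarith) (hnb i n)), fun i h1 h2 => ?_⟩
  set ρ := H.r ^ (-minDist m N) with hρd
  have hrem : ∀ j, 1 ≤ j → j ≤ m → ∀ n ∈ piece m N j,
      decay H.r n * ‖U (n + center N j) - σ j • Q n‖ ≤ C₃ * (2 * H.r) * ρ := by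
    intro j hj1 hj2 n hn
    have h4 := mul_le_mul_of_nonneg_left (h3 j hj1 hj2 n hn) (decay_nonneg hr n)
    have h5 := mul_le_mul_of_nonneg_left
      (decay_mul_neighbourBound_le (N := N) hr hj1 hj2 n) hC₃0
    linarith
  have hp0 := halfPlus_nonneg (N := N) i
  have hpq := halfPlus_add_halfMinus (N := N) i
  have hpq1 := halfPlus_le_halfMinus (N := N) i
  have hpq2 := halfMinus_le (N := N) i
  have hc' : center N (i + 1) = center N i + N i := center_succ h1
  have hσ := hch.sign i h1 h2.le
  have hσ' := hch.sign (i + 1) (by omega) (by omega)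
  have hUR : ∀ j, 1 ≤ j → j ≤ m → ∀ n ∈ piece m N j, ‖U (n + center N j)‖ ≤ R + 1 := by
    intro j hj1 hj2 n hn
    have h4 := norm_add_le (U (n + center N j) - σ j • Q n) (σ j • Q n)
    rw [sub_add_cancel, norm_sign_smul (hch.sign j hj1 hj2)] at h4
    have h5 := (hd j hj1 hj2 n hn).trans (min_le_left _ _)
    linarith [hQR n]
  -- the far copy contributes the square of its size
  have hsq : ∀ (s : ℝ) (l : ℤ), (s = 1 ∨ s = -1) → halfPlus N i ≤ |l| →
      ‖H.F (s • Q l) - H.DF 0 (s • Q l)‖ ≤ M * D ^ 2 * H.r * ρ := by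
    intro s l hs hl
    have h4 := hF 0 (s • Q l) 0 (by rw [norm_zero]; linarith)
      (by rw [norm_sign_smul hs]; linarith [hQR l]) (by rw [norm_zero]; linarith)
    simp only [H.F_zero, sub_zero, sub_self, norm_zero, zero_add, norm_sign_smul hs] at h4
    have h5 : decay H.r l * decay H.r l ≤ H.r * ρ := by
      have h6 := minDist_le_two_mul_halfPlus (N := N) h1 h2
      rw [decay, ← zpow_add₀ hr0.ne', hρd, ← zpow_one_add₀ hr0.ne']
      exact zpow_le_zpow_right₀ hr.le (by omega)
    calc _ ≤ M * ‖Q l‖ * ‖Q l‖ := h4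
      _ ≤ M * (D * decay H.r l) * (D * decay H.r l) := by
          have := hQD l; have := decay_nonneg hr l; gcongr
      _ = M * D ^ 2 * (decay H.r l * decay H.r l) := by ring
      _ ≤ M * D ^ 2 * (H.r * ρ) := mul_le_mul_of_nonneg_left h5 (by positivity)
      _ = _ := by ring
  -- the near copy contributes its size times the remainder
  have hnear : ∀ (j : ℕ) (l : ℤ), 1 ≤ j → j ≤ m → l ∈ piece m N j →
      ‖U (l + center N j)‖ ≤ 2 * C₂ * decay H.r l →
      ‖H.F (U (l + center N j)) - H.F (σ j • Q l) - H.DF 0 (U (l + center N j) - σ j • Q l)‖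
        ≤ M * (D + 2 * C₂) * (C₃ * (2 * H.r)) * ρ := by
    intro j l hj1 hj2 hl hUl
    have hs := hch.sign j hj1 hj2
    have h4 := hF (σ j • Q l) (U (l + center N j)) 0
      (by rw [norm_sign_smul hs]; linarith [hQR l]) (hUR j hj1 hj2 l hl)
      (by rw [norm_zero]; linarith)
    simp only [sub_zero, norm_sign_smul hs] at h4
    calc _ ≤ M * (‖Q l‖ + ‖U (l + center N j)‖) * ‖U (l + center N j) - σ j • Q l‖ := h4
      _ ≤ M * (D * decay H.r l + 2 * C₂ * decay H.r l) * ‖U (l + center N j) - σ j • Q l‖ := by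
          have := hQD l; gcongr
      _ = M * (D + 2 * C₂) * (decay H.r l * ‖U (l + center N j) - σ j • Q l‖) := by ring
      _ ≤ M * (D + 2 * C₂) * (C₃ * (2 * H.r) * ρ) :=
          mul_le_mul_of_nonneg_left (hrem j hj1 hj2 l hl) (by positivity)
      _ = _ := by ring
  set W : ℤ → X := fun n => U (n + center N i) - σ i • Q n - σ (i + 1) • Q (n - N i) with hW
  have hgreen := H.green_of_le (a := 0) (b := N i) (W := W) (e := e₀ * ρ) (by positivity)
    (fun n hn => ?_) (halfPlus N i) (Finset.mem_Icc.2 ⟨hp0, by omega⟩)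
  · have hW0 : ‖W 0‖ ≤ (C₃ * (2 * H.r) + D) * ρ := by
      have h4 := hrem i h1 h2.le 0 (mem_piece_of_nonneg 0 le_rfl fun _ => hp0)
      rw [decay_zero, one_mul] at h4
      have h5 : ‖σ (i + 1) • Q (0 - N i)‖ ≤ D * ρ := by
        rw [norm_sign_smul hσ']
        refine (hQD _).trans (mul_le_mul_of_nonneg_left ?_ hD)
        have := minDist_le (N := N) h1 h2
        exact zpow_le_zpow_right₀ hr.le (by rw [zero_sub, abs_neg, Nat.abs_cast]; omega)
      have h6 := norm_sub_le (U (0 + center N i) - σ i • Q 0) (σ (i + 1) • Q (0 - N i))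
      simp only [hW]; linarith
    have hWN : ‖W (N i)‖ ≤ (C₃ * (2 * H.r) + D) * ρ := by
      have h4 := hrem (i + 1) (by omega) (by omega) 0
        (mem_piece_of_nonneg 0 le_rfl fun _ => halfPlus_nonneg _)
      rw [decay_zero, one_mul] at h4
      have h5 : ‖σ i • Q (N i)‖ ≤ D * ρ := by
        rw [norm_sign_smul hσ]
        refine (hQD _).trans (mul_le_mul_of_nonneg_left ?_ hD)
        have := minDist_le (N := N) h1 h2
        exact zpow_le_zpow_right₀ hr.le (by rw [Nat.abs_cast]; omega)
      have h6 := norm_sub_le (U (0 + center N (i + 1)) - σ (i + 1) • Q 0) (σ i • Q (N i))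
      have h7 : W (N i) = U (0 + center N (i + 1)) - σ (i + 1) • Q 0 - σ i • Q (N i) := by
        simp only [hW]
        rw [sub_self, zero_add, hc', add_comm (N i : ℤ)]; abel
      rw [h7]; linarith
    have hWp : W (halfPlus N i) = U (interface N i) - σ i • Q (halfPlus N i)
        - σ (i + 1) • Q (-halfMinus N i) := by
      simp only [hW, interface]
      rw [show halfPlus N i - N i = -halfMinus N i by omega, add_comm (center N i)]
    rw [← hWp]
    have h8 : decay H.r (halfPlus N i - 0) * ‖H.P (W 0)‖ ≤ ‖W 0‖ :=
      (mul_le_of_le_one_left (norm_nonneg _) (decay_le_one hr _)).trans (H.norm_P _)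
    have h9 : decay H.r (halfPlus N i - N i) * ‖H.Pc (W (N i))‖ ≤ ‖W (N i)‖ :=
      (mul_le_of_le_one_left (norm_nonneg _) (decay_le_one hr _)).trans (H.norm_Pc _)
    have h10 : 0 ≤ C₃ * ρ := by positivity
    have h11 : C₄ * ρ = 2 * ((C₃ * (2 * H.r) + D) * ρ)
        + H.r * (decaySum H.r * (e₀ * ρ)) := by rw [hC₄]; ring
    linarith
  · rw [Finset.mem_Ico] at hn
    have h0 : H.F (U (n + center N i)) = U (n + 1 + center N i) := by
      rw [← hU]; congr 1; ring
    have hQn : H.F (σ i • Q n) = σ i • Q (n + 1) := by rw [hodd.F_smul hσ, hQ.orbit]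
    have hQn' : H.F (σ (i + 1) • Q (n - N i)) = σ (i + 1) • Q (n + 1 - N i) := by
      rw [hodd.F_smul hσ', ← hQ.orbit, sub_add_eq_add_sub]
    have hgn := hg i h1 h2 n hn.1 hn.2.le
    rcases le_or_gt n (halfPlus N i) with h | h
    · have h4 := hnear i n h1 h2.le (mem_piece_of_nonneg n hn.1 fun _ => h) (by
        have h5 : decay H.r (n - N i) ≤ decay H.r n :=
          decay_anti hr (by rw [abs_of_nonneg hn.1, abs_of_nonpos] <;> omega)
        have := mul_le_mul_of_nonneg_left h5 hC₂.le
        linarith)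
      have h5 := hsq (σ (i + 1)) (n - N i) hσ' (by rw [abs_of_nonpos] <;> omega)
      have h6 := norm_sub_le (H.F (U (n + center N i)) - H.F (σ i • Q n)
        - H.DF 0 (U (n + center N i) - σ i • Q n))
        (H.F (σ (i + 1) • Q (n - N i)) - H.DF 0 (σ (i + 1) • Q (n - N i)))
      have h7 : W (n + 1) - H.DF 0 (W n) = H.F (U (n + center N i)) - H.F (σ i • Q n)
        - H.DF 0 (U (n + center N i) - σ i • Q n)
        - (H.F (σ (i + 1) • Q (n - N i)) - H.DF 0 (σ (i + 1) • Q (n - N i))) := by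
        simp only [hW]
        rw [h0, hQn, hQn', map_sub (H.DF 0) _ (σ (i + 1) • Q (n - N i))]
        abel
      rw [h7, he₀]
      linarith
    · have h8 : n - N i + center N (i + 1) = n + center N i := by rw [hc']; ring
      have h4 := hnear (i + 1) (n - N i) (by omega) (by omega)
        (mem_piece_of_nonpos _ (by omega) fun _ => by rw [Nat.add_sub_cancel]; omega) (by
        have h5 : decay H.r n ≤ decay H.r (n - N i) :=
          decay_anti hr (by rw [abs_of_nonneg hn.1, abs_of_nonpos] <;> omega)
        have := mul_le_mul_of_nonneg_left h5 hC₂.le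
        rw [h8]
        linarith)
      rw [h8] at h4
      have h5 := hsq (σ i) n hσ (by rw [abs_of_nonneg] <;> omega)
      have h6 := norm_sub_le (H.F (U (n + center N i)) - H.F (σ (i + 1) • Q (n - N i))
        - H.DF 0 (U (n + center N i) - σ (i + 1) • Q (n - N i)))
        (H.F (σ i • Q n) - H.DF 0 (σ i • Q n))
      have h7 : W (n + 1) - H.DF 0 (W n) = H.F (U (n + center N i))
        - H.F (σ (i + 1) • Q (n - N i)) - H.DF 0 (U (n + center N i) - σ (i + 1) • Q (n - N i))
        - (H.F (σ i • Q n) - H.DF 0 (σ i • Q n)) := by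
        simp only [hW]
        rw [h0, hQn, hQn']
        simp only [map_sub]
        abel
      rw [h7, he₀]
      linarith

end IsHomoclinic
end HypDiffeo

section bounds
variable {r : ℝ} {m : ℕ} {N : ℕ → ℕ}

theorem leftBound_eq (hr : 1 < r) (i : ℕ) (n : ℤ) :
    leftBound r N i n = r ^ (-(2 * halfMinus N (i - 1)) - n) := by
  rw [leftBound, ← zpow_add₀ (by linarith)]; congr 1; ring

theorem rightBound_eq (hr : 1 < r) (i : ℕ) (n : ℤ) :
    rightBound r N i n = r ^ (-(2 * halfPlus N i) + n) := by
  rw [rightBound, ← zpow_add₀ (by linarith)]; congr 1; ring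

theorem halfMinus_nonneg (i : ℕ) : 0 ≤ halfMinus N i := by
  rw [halfMinus, halfPlus]; omega

theorem neighbourBound_nonneg (hr : 0 < r) (i : ℕ) (n : ℤ) : 0 ≤ neighbourBound r m N i n := by
  unfold neighbourBound leftBound rightBound
  split_ifs <;> positivity

theorem neighbourBound_one_le (hr : 1 < r) (hm : 1 < m) (n : ℤ) :
    neighbourBound r m N 1 n ≤ r * (r ^ (-minDist m N) * r ^ n) := by
  have hr0 : r ≠ 0 := by linarith
  have h := minDist_le_two_mul_halfPlus (N := N) le_rfl hm
  rw [neighbourBound, if_neg (lt_irrefl 1), if_pos hm, zero_add, rightBound_eq hr,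
    ← zpow_add₀ hr0, ← zpow_one_add₀ hr0]
  exact zpow_le_zpow_right₀ hr.le (by omega)

theorem neighbourBound_last_le (hr : 1 < r) (hm : 1 < m) (n : ℤ) :
    neighbourBound r m N m n ≤ r * (r ^ (-minDist m N) * r ^ (-n)) := by
  have hr0 : r ≠ 0 := by linarith
  have h := minDist_le_two_mul_halfMinus (N := N) (m := m) (i := m - 1) (by omega) (by omega)
  rw [neighbourBound, if_neg (lt_irrefl m), if_pos hm, add_zero, leftBound_eq hr,
    ← zpow_add₀ hr0, ← zpow_one_add₀ hr0]
  exact zpow_le_zpow_right₀ hr.le (by omega)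

/-- If the distances have bounded spread, the left neighbour dominates on the left half of a
piece. -/
theorem neighbourBound_le_leftBound (hr : 1 < r) {D : ℕ}
    (hD : ∀ i ∈ Set.Icc 1 (m - 1), (N i : ℤ) ≤ minDist m N + D) {i : ℕ} (h1 : 2 ≤ i)
    {n : ℤ} (hn : n ≤ 0) :
    neighbourBound r m N i n ≤ (1 + r ^ (D + 2)) * leftBound r N i n := by
  have hr0 : 0 < r := by linarith
  rw [neighbourBound, if_pos (by omega), add_mul, one_mul]
  refine add_le_add le_rfl ?_
  split_ifs with h
  · rw [leftBound_eq hr, rightBound_eq hr, ← zpow_natCast, ← zpow_add₀ hr0.ne']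
    refine zpow_le_zpow_right₀ hr.le ?_
    have h3 := minDist_le_two_mul_halfPlus (N := N) (by omega) h
    have h4 := hD (i - 1) ⟨by omega, by omega⟩
    have h5 := halfPlus_add_halfMinus (N := N) (i - 1)
    have h6 := halfMinus_le (N := N) (i - 1)
    push_cast
    omega
  · rw [leftBound_eq hr]; positivity

/-- If the distances have bounded spread, the right neighbour dominates on the right half of a
piece. -/
theorem neighbourBound_le_rightBound (hr : 1 < r) {D : ℕ}
    (hD : ∀ i ∈ Set.Icc 1 (m - 1), (N i : ℤ) ≤ minDist m N + D) {i : ℕ} (h1 : 1 ≤ i) (h2 : i < m)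
    {n : ℤ} (hn : 0 ≤ n) :
    neighbourBound r m N i n ≤ (1 + r ^ (D + 2)) * rightBound r N i n := by
  have hr0 : 0 < r := by linarith
  rw [neighbourBound, if_pos h2, add_mul, one_mul, add_comm]
  refine add_le_add le_rfl ?_
  split_ifs with h
  · rw [leftBound_eq hr, rightBound_eq hr, ← zpow_natCast, ← zpow_add₀ hr0.ne']
    refine zpow_le_zpow_right₀ hr.le ?_
    have h3 := minDist_le_two_mul_halfMinus (N := N) (m := m) (i := i - 1) (by omega) (by omega)
    have h4 := hD i ⟨by omega, by omega⟩
    have h5 := halfPlus_add_halfMinus (N := N) i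
    have h6 := halfPlus_le_halfMinus (N := N) i
    push_cast
    omega
  · rw [rightBound_eq hr]; positivity

end bounds

namespace HypDiffeo
variable {X : Type*} [NormedAddCommGroup X] [NormedSpace ℝ X] {H : HypDiffeo X} {Q : ℤ → X}

/-- On every piece of the chain, `U` is within `δ` of the copy belonging to the piece. -/
def IsNearChain (Q : ℤ → X) (m : ℕ) (N : ℕ → ℕ) (σ : ℕ → ℝ) (δ : ℝ) (U : ℤ → X) : Prop :=
  ∀ i, 1 ≤ i → i ≤ m → ∀ n ∈ piece m N i, ‖U (n + center N i) - σ i • Q n‖ ≤ δ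

theorem IsNearChain.norm_sub_pseudoOrbit_le {K m : ℕ} {N : ℕ → ℕ} {σ : ℕ → ℝ} {δ : ℝ} {U : ℤ → X}
    (h : IsNearChain Q m N σ δ U) (hch : IsChain K m N σ) (n : ℤ) :
    ‖U n - pseudoOrbit Q m N σ n‖ ≤ δ := by
  set i := pieceIndex m N n with hi
  have hi1 : 1 ≤ i := pieceIndex_pos n
  have h1 := h i hi1 (pieceIndex_le hch.one_lt n) (n - center N i) ⟨fun h1 => ?_, fun h1 => ?_⟩
  · rwa [sub_add_cancel] at h1
  · have h2 := interface_pred_le (m := m) (N := N) n h1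
    have h3 := interface_eq (N := N) (show 1 ≤ i - 1 by omega)
    rw [Nat.sub_add_cancel hi1] at h3
    rw [← hi] at h2
    omega
  · have h2 := lt_interface (m := m) (N := N) n h1
    have h3 : interface N i = center N i + halfPlus N i := rfl
    rw [← hi] at h2
    omega

/-- An orbit near the chain `pseudoOrbit` is near the chain also at the right ends of the pieces,
which the pseudo-orbit attributes to the next copy. -/
theorem isNearChain_of_norm_sub_le {K k m : ℕ} {N : ℕ → ℕ} {σ : ℕ → ℝ} {δ : ℝ} {U : ℤ → X}
    (hch : IsChain K m N σ) (hδ : 0 ≤ δ) (hk : ∀ n : ℤ, (k : ℤ) ≤ |n| → ‖Q n‖ ≤ δ / 4)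
    (hK : 2 * k ≤ K) (hK2 : 2 ≤ K) (h : ∀ n, ‖U n - pseudoOrbit Q m N σ n‖ ≤ δ / 2) :
    IsNearChain Q m N σ δ U := by
  intro i h1 h2 n hn
  have hl : 1 < i → interface N (i - 1) ≤ n + center N i := fun h3 => by
    have h4 := interface_eq (N := N) (show 1 ≤ i - 1 by omega)
    rw [Nat.sub_add_cancel h1] at h4
    have := hn.1 h3
    omega
  by_cases h3 : i < m ∧ n = halfPlus N i
  · obtain ⟨h4, h5⟩ := h3
    have h6 := hch.le_halfPlus hK h1 h4
    have h7 := halfPlus_le_halfMinus (N := N) i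
    have h8 := interface_eq (N := N) h1
    have h9 : interface N i = center N i + halfPlus N i := rfl
    have h10 : pieceIndex m N (n + center N i) = i + 1 := by
      refine pieceIndex_eq (by omega) (by omega)
        (fun _ => by rw [Nat.add_sub_cancel]; omega) (fun h11 => ?_)
      have h12 := hch.le_halfPlus (k := 1) (by omega) (i := i + 1) (by omega) h11
      have h13 := halfPlus_add_halfMinus (N := N) i
      have h14 := hch.le_halfPlus (k := 1) (by omega) (i := i) h1 h4
      have h15 : interface N (i + 1) = center N (i + 1) + halfPlus N (i + 1) := rfl
      omega
    have h11 := h (n + center N i)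
    rw [pseudoOrbit, h10] at h11
    have e : U (n + center N i) - σ i • Q n
        = (U (n + center N i) - σ (i + 1) • Q (n + center N i - center N (i + 1)))
          + (σ (i + 1) • Q (n + center N i - center N (i + 1)) - σ i • Q n) := by abel
    rw [e]
    refine (norm_add_le _ _).trans ?_
    have h12 := norm_sub_le (σ (i + 1) • Q (n + center N i - center N (i + 1))) (σ i • Q n)
    rw [norm_sign_smul (hch.sign _ (by omega) (by omega)), norm_sign_smul (hch.sign i h1 h2)] at h12
    have h13 := hk (n + center N i - center N (i + 1)) (by rw [abs_of_nonpos] <;> omega)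
    have h14 := hk n (by rw [abs_of_nonneg] <;> omega)
    linarith
  · have h4 : pieceIndex m N (n + center N i) = i := pieceIndex_eq h1 h2 hl fun h5 => by
      have h6 := hn.2 h5
      have h7 : interface N i = center N i + halfPlus N i := rfl
      have h8 : n ≠ halfPlus N i := fun h8 => h3 ⟨h5, h8⟩
      omega
    have h5 := h (n + center N i)
    rw [pseudoOrbit, h4, add_sub_cancel_right] at h5
    linarith

/-- Multi-pulse orbits of an odd hyperbolic diffeomorphism with a transverse homoclinic orbit. -/
theorem IsHomoclinic.exists_multipulse [FiniteDimensional ℝ X] (hQ : H.IsHomoclinic Q)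
    (hodd : H.IsOdd) (hT : H.stableSpace Q ⊔ H.reverse.stableSpace (fun n => Q (-n)) = ⊤) :
    ∃ (K₀ : ℕ) (δ₀ C : ℝ), 0 < δ₀ ∧ 0 ≤ C ∧
      (∀ (m : ℕ) (N : ℕ → ℕ) (σ : ℕ → ℝ), IsChain K₀ m N σ → ∀ U : ℤ → X,
        (∀ n, U (n + 1) = H.F (U n)) → IsNearChain Q m N σ δ₀ U →
        (∀ U' : ℤ → X, (∀ n, U' (n + 1) = H.F (U' n)) → IsNearChain Q m N σ δ₀ U' → U' = U) ∧
        (∀ i, 1 ≤ i → i ≤ m → ∀ n ∈ piece m N i,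
          ‖U (n + center N i) - σ i • Q n‖ ≤ C * neighbourBound H.r m N i n) ∧
        (∀ i, 1 ≤ i → i < m → ‖U (interface N i) - σ i • Q (halfPlus N i)
          - σ (i + 1) • Q (-halfMinus N i)‖ ≤ C * H.r ^ (-minDist m N))) ∧
      ∀ δ, 0 < δ → ∃ K : ℕ, ∀ (m : ℕ) (N : ℕ → ℕ) (σ : ℕ → ℝ), IsChain K m N σ →
        ∃ U : ℤ → X, (∀ n, U (n + 1) = H.F (U n)) ∧ IsNearChain Q m N σ δ U := by
  obtain ⟨δ₁, hδ₁, K₁, huniq⟩ := hQ.exists_unique_orbit hodd hT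
  obtain ⟨K₂, δ₂, C, hδ₂, hC, hbd⟩ := hQ.exists_remainder_bounds hodd hT
  refine ⟨max K₁ K₂, min δ₁ δ₂, C, lt_min hδ₁ hδ₂, hC, fun m N σ hch U hU hnear => ⟨?_, ?_⟩,
    fun δ hδ => ?_⟩
  · intro U' hU' hnear'
    exact huniq m N σ (hch.mono (le_max_left _ _)) U U' hU hU'
      (fun n => (hnear.norm_sub_pseudoOrbit_le hch n).trans (min_le_left _ _))
      (fun n => (hnear'.norm_sub_pseudoOrbit_le hch n).trans (min_le_left _ _))
  · exact hbd m N σ (hch.mono (le_max_right _ _)) U hU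
      fun i h1 h2 n hn => (hnear i h1 h2 n hn).trans (min_le_right _ _)
  · obtain ⟨k, hk⟩ := hQ.exists_norm_le (ε := δ / 4) (by positivity)
    obtain ⟨K, hK⟩ := hQ.exists_orbit hodd hT (δ := δ / 2) (by positivity)
    refine ⟨K + 2 * k + 2, fun m N σ hch => ?_⟩
    obtain ⟨U, hU1, hU2⟩ := hK m N σ (hch.mono (by omega))
    exact ⟨U, hU1, isNearChain_of_norm_sub_le hch hδ.le hk (by omega) (by omega) hU2⟩

end HypDiffeo

/-! ### Cosine polynomials -/

/-- `cos (2 π k t / T)`. -/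
noncomputable def cosMode (T : ℝ) (k : ℕ) (t : ℝ) : ℝ := Real.cos (2 * Real.pi * k * t / T)

/-- The normalization of the cosine coefficients: `(∫₀ᵀ cos² (2 π k t / T) dt)⁻¹`. -/
noncomputable def cosWeight (T : ℝ) (k : ℕ) : ℝ := if k = 0 then 1 / T else 2 / T

/-- The `k`-th cosine coefficient of a function on `[0, T]`. -/
noncomputable def cosCoeff (T : ℝ) (k : ℕ) (w : ℝ → ℝ) : ℝ :=
  cosWeight T k * ∫ s in (0 : ℝ)..T, w s * cosMode T k s

/-- The even trigonometric polynomial with cosine coefficients `a`. -/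
noncomputable def cosSum (T : ℝ) (M : ℕ) : (Fin (M + 1) → ℝ) →ₗ[ℝ] (ℝ → ℝ) where
  toFun a t := ∑ k, a k * cosMode T k t
  map_add' a b := by ext t; simp [add_mul, Finset.sum_add_distrib]
  map_smul' c a := by ext t; simp [mul_assoc, Finset.mul_sum]

section
variable {T : ℝ} {M : ℕ}

theorem cosSum_apply (a : Fin (M + 1) → ℝ) (t : ℝ) :
    cosSum T M a t = ∑ k, a k * cosMode T k t := rfl

theorem contDiff_cosMode (T : ℝ) (k : ℕ) : ContDiff ℝ ∞ (cosMode T k) := by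
  unfold cosMode; fun_prop

theorem continuous_cosMode (T : ℝ) (k : ℕ) : Continuous (cosMode T k) :=
  (contDiff_cosMode T k).continuous

theorem abs_cosMode_le (T : ℝ) (k : ℕ) (t : ℝ) : |cosMode T k t| ≤ 1 := Real.abs_cos_le_one _

theorem cosMode_neg (T : ℝ) (k : ℕ) (t : ℝ) : cosMode T k (-t) = cosMode T k t := by
  rw [cosMode, cosMode, ← Real.cos_neg]; congr 1; ring

theorem cosMode_add_period (hT : 0 < T) (k : ℕ) (t : ℝ) :
    cosMode T k (t + T) = cosMode T k t := by
  have : 2 * Real.pi * k * (t + T) / T = 2 * Real.pi * k * t / T + k * (2 * Real.pi) := by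
    field_simp
  rw [cosMode, cosMode, this, Real.cos_add_nat_mul_two_pi]

theorem contDiff_cosSum (a : Fin (M + 1) → ℝ) : ContDiff ℝ ∞ (cosSum T M a) := by
  change ContDiff ℝ ∞ fun t => ∑ k : Fin (M + 1), a k * cosMode T k t
  exact ContDiff.sum fun k _ => contDiff_const.mul (contDiff_cosMode T k)

theorem continuous_cosSum (a : Fin (M + 1) → ℝ) : Continuous (cosSum T M a) :=
  (contDiff_cosSum a).continuous

theorem cosSum_neg_arg (a : Fin (M + 1) → ℝ) (t : ℝ) : cosSum T M a (-t) = cosSum T M a t := by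
  simp [cosSum_apply, cosMode_neg]

theorem cosSum_add_period (hT : 0 < T) (a : Fin (M + 1) → ℝ) (t : ℝ) :
    cosSum T M a (t + T) = cosSum T M a t := by
  simp [cosSum_apply, cosMode_add_period hT]

theorem abs_cosSum_le (a : Fin (M + 1) → ℝ) (t : ℝ) : |cosSum T M a t| ≤ (M + 1) * ‖a‖ := by
  calc |cosSum T M a t| ≤ ∑ k : Fin (M + 1), |a k * cosMode T k t| := by
        rw [cosSum_apply]; exact Finset.abs_sum_le_sum_abs _ _
    _ ≤ ∑ _k : Fin (M + 1), ‖a‖ := by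
        refine Finset.sum_le_sum fun k _ => ?_
        rw [abs_mul]
        exact (mul_le_mul (norm_le_pi_norm a k) (abs_cosMode_le T k t) (abs_nonneg _)
          (norm_nonneg _)).trans_eq (mul_one _)
    _ = (M + 1) * ‖a‖ := by simp

theorem integral_cos_int (hT : 0 < T) {n : ℤ} (hn : n ≠ 0) :
    ∫ t in (0 : ℝ)..T, Real.cos (2 * Real.pi * n * t / T) = 0 := by
  have hc : (2 * Real.pi * n / T : ℝ) ≠ 0 := by
    have := Real.pi_ne_zero
    have : (n : ℝ) ≠ 0 := by exact_mod_cast hn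
    positivity
  have h1 : ∀ t : ℝ, 2 * Real.pi * n * t / T = (2 * Real.pi * n / T) * t := fun t => by ring
  simp_rw [h1]
  rw [intervalIntegral.integral_comp_mul_left (fun x => Real.cos x) hc, integral_cos]
  have h2 : 2 * Real.pi * n / T * T = (2 * n : ℤ) * Real.pi := by
    push_cast; field_simp
  rw [h2, Real.sin_int_mul_pi]
  simp

theorem cosWeight_nonneg (hT : 0 < T) (k : ℕ) : 0 ≤ cosWeight T k := by
  unfold cosWeight; split_ifs <;> positivity

theorem cosWeight_pos (hT : 0 < T) (k : ℕ) : 0 < cosWeight T k := by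
  unfold cosWeight; split_ifs <;> positivity

theorem cosWeight_le (hT : 0 < T) (k : ℕ) : cosWeight T k ≤ 2 / T := by
  unfold cosWeight; split_ifs
  · gcongr; norm_num
  · exact le_rfl

theorem integral_cosMode_mul (hT : 0 < T) (j k : ℕ) :
    cosWeight T k * ∫ t in (0 : ℝ)..T, cosMode T j t * cosMode T k t = if j = k then 1 else 0 := by
  have h1 : ∀ t : ℝ, cosMode T j t * cosMode T k t =
      (Real.cos (2 * Real.pi * ((j - k : ℤ) : ℝ) * t / T) +
        Real.cos (2 * Real.pi * ((j + k : ℤ) : ℝ) * t / T)) * (1 / 2) := by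
    intro t
    have e1 : 2 * Real.pi * ((j - k : ℤ) : ℝ) * t / T
        = 2 * Real.pi * j * t / T - 2 * Real.pi * k * t / T := by push_cast; ring
    have e2 : 2 * Real.pi * ((j + k : ℤ) : ℝ) * t / T
        = 2 * Real.pi * j * t / T + 2 * Real.pi * k * t / T := by push_cast; ring
    rw [e1, e2, Real.cos_sub, Real.cos_add, cosMode, cosMode]
    ring
  simp_rw [h1]
  have hi : ∀ n : ℤ, IntervalIntegrable
      (fun t => Real.cos (2 * Real.pi * (n : ℝ) * t / T)) volume 0 T := fun n =>
    Continuous.intervalIntegrable (by fun_prop) _ _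
  rw [intervalIntegral.integral_mul_const, intervalIntegral.integral_add (hi _) (hi _)]
  by_cases hjk : j = k
  · subst hjk
    rw [if_pos rfl]
    by_cases hj : j = 0
    · subst hj
      simp only [cosWeight, if_true]
      simp
      field_simp; norm_num
    · rw [integral_cos_int (n := j + j) hT (by omega)]
      simp [cosWeight, hj]
      field_simp
  · rw [if_neg hjk, integral_cos_int (n := j - k) hT (by omega),
      integral_cos_int (n := j + k) hT (by omega)]
    simp

theorem intervalIntegrable_mul_cosMode {w : ℝ → ℝ} (hw : Continuous w) (k : ℕ) :
    IntervalIntegrable (fun s => w s * cosMode T k s) volume 0 T :=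
  (hw.mul (continuous_cosMode T k)).intervalIntegrable _ _

theorem cosCoeff_cosSum (hT : 0 < T) (a : Fin (M + 1) → ℝ) (k : Fin (M + 1)) :
    cosCoeff T k (cosSum T M a) = a k := by
  have h1 : ∀ s, cosSum T M a s * cosMode T k s
      = ∑ j, a j * (cosMode T j s * cosMode T k s) := by
    intro s
    rw [cosSum_apply, Finset.sum_mul]
    exact Finset.sum_congr rfl fun j _ => by ring
  rw [cosCoeff]
  simp_rw [h1]
  have hi : ∀ j ∈ (Finset.univ : Finset (Fin (M + 1))), IntervalIntegrable
      (fun s => a j * (cosMode T j s * cosMode T k s)) volume 0 T := fun j _ =>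
    (continuous_const.mul ((continuous_cosMode T j).mul
      (continuous_cosMode T k))).intervalIntegrable _ _
  rw [intervalIntegral.integral_finsetSum hi]
  simp_rw [intervalIntegral.integral_const_mul]
  rw [Finset.mul_sum]
  have h2 : ∀ j : Fin (M + 1), cosWeight T k *
      (a j * ∫ t in (0 : ℝ)..T, cosMode T j t * cosMode T k t) = if j = k then a j else 0 := by
    intro j
    rw [mul_left_comm, integral_cosMode_mul hT]
    simp [Fin.ext_iff]
  simp [h2]

/-- Parseval's inequality for a single coefficient. -/
theorem sq_le_integral_cosSum_sq (hT : 0 < T) (a : Fin (M + 1) → ℝ) (k : Fin (M + 1)) :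
    a k ^ 2 ≤ 2 / T * ∫ t in (0 : ℝ)..T, cosSum T M a t ^ 2 := by
  have h1 : ∀ s, cosSum T M a s ^ 2 = ∑ j, a j * (cosSum T M a s * cosMode T j s) := by
    intro s
    simp_rw [mul_left_comm (a _)]
    rw [← Finset.mul_sum, ← cosSum_apply, sq]
  simp_rw [h1]
  have hi : ∀ j ∈ (Finset.univ : Finset (Fin (M + 1))), IntervalIntegrable
      (fun s => a j * (cosSum T M a s * cosMode T j s)) volume 0 T := fun j _ =>
    (continuous_const.mul ((continuous_cosSum a).mul
      (continuous_cosMode T j))).intervalIntegrable _ _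
  rw [intervalIntegral.integral_finsetSum hi]
  simp_rw [intervalIntegral.integral_const_mul]
  have h2 : ∀ j : Fin (M + 1), a j * ∫ t in (0 : ℝ)..T, cosSum T M a t * cosMode T j t
      = a j ^ 2 / cosWeight T j := by
    intro j
    have := cosCoeff_cosSum hT a j
    rw [cosCoeff] at this
    rw [eq_div_iff (cosWeight_pos hT _).ne']
    calc _ = a j * (cosWeight T j * ∫ t in (0 : ℝ)..T, cosSum T M a t * cosMode T j t) := by ring
      _ = a j ^ 2 := by rw [this, sq]
  simp_rw [h2]
  have h3 : a k ^ 2 / cosWeight T k ≤ ∑ j : Fin (M + 1), a j ^ 2 / cosWeight T j :=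
    Finset.single_le_sum (f := fun j : Fin (M + 1) => a j ^ 2 / cosWeight T j)
      (fun j _ => div_nonneg (sq_nonneg _) (cosWeight_nonneg hT _)) (Finset.mem_univ k)
  have h4 := (div_le_iff₀ (cosWeight_pos hT k)).1 h3
  rw [mul_comm] at h4
  exact h4.trans (mul_le_mul_of_nonneg_right (cosWeight_le hT k)
    (Finset.sum_nonneg fun j _ => div_nonneg (sq_nonneg _) (cosWeight_nonneg hT _)))

/-! ### The space of even trigonometric polynomials and the projection onto it -/

theorem mode_eq (T : ℝ) (k : ℤ) (t : ℝ) :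
    mode T k t = ((1 / Real.sqrt T : ℝ) : ℂ) *
      ((Real.cos (2 * Real.pi * k * t / T) : ℂ) +
        (Real.sin (2 * Real.pi * k * t / T) : ℂ) * Complex.I) := by
  rw [mode, Complex.exp_mul_I, Complex.ofReal_cos, Complex.ofReal_sin]

theorem cos_int_eq_cosMode (T : ℝ) (k : ℤ) (t : ℝ) :
    Real.cos (2 * Real.pi * k * t / T) = cosMode T k.natAbs t := by
  rw [cosMode, ← Real.cos_abs]
  conv_rhs => rw [← Real.cos_abs]
  congr 1
  simp [abs_div, abs_mul]

theorem cosMode_mem_evenSpace (hT : 0 < T) {k : ℕ} (hk : k ≤ M) :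
    cosMode T k ∈ evenSpace T M := by
  refine ⟨?_, cosMode_neg T k⟩
  have hT' : (Real.sqrt T : ℂ) ≠ 0 := by
    exact_mod_cast (Real.sqrt_pos.2 hT).ne'
  have hmem : ∀ n : ℤ, n ∈ Set.Icc (-(M : ℤ)) M →
      mode T n ∈ Submodule.span ℂ (mode T '' Set.Icc (-(M : ℤ)) M) := fun n hn =>
    Submodule.subset_span ⟨n, hn, rfl⟩
  have h : (fun t => (cosMode T k t : ℂ)) =
      ((Real.sqrt T : ℂ) / 2) • (mode T k + mode T (-k : ℤ)) := by
    ext t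
    have e : 2 * Real.pi * ((-k : ℤ) : ℝ) * t / T = -(2 * Real.pi * k * t / T) := by
      push_cast; ring
    simp only [Pi.smul_apply, Pi.add_apply, mode_eq, smul_eq_mul, e, Real.cos_neg, Real.sin_neg,
      cosMode, Int.cast_natCast]
    push_cast
    field_simp
    ring
  change (fun t => (cosMode T k t : ℂ)) ∈ Submodule.span ℂ (mode T '' Set.Icc (-(M : ℤ)) M)
  rw [h]
  exact Submodule.smul_mem _ _ (add_mem (hmem _ ⟨by omega, by omega⟩) (hmem _ ⟨by omega, by omega⟩))

theorem cosSum_mem_evenSpace (hT : 0 < T) (a : Fin (M + 1) → ℝ) :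
    cosSum T M a ∈ evenSpace T M := by
  have h : cosSum T M a = ∑ k : Fin (M + 1), a k • cosMode T k := by
    ext t; simp [cosSum_apply]
  rw [h]
  exact sum_mem fun k _ =>
    Submodule.smul_mem _ _ (cosMode_mem_evenSpace hT (Nat.lt_succ_iff.1 k.2))

theorem exists_cosSum_of_mem_evenSpace {u : ℝ → ℝ} (hu : u ∈ evenSpace T M) :
    ∃ a, cosSum T M a = u := by
  have key : ∀ g ∈ Submodule.span ℂ (mode T '' Set.Icc (-(M : ℤ)) M),
      ∃ c : Fin (M + 1) → ℂ, ∀ t : ℝ, g t + g (-t) = ∑ k, c k * (cosMode T k t : ℂ) := by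
    intro g hg
    induction hg using Submodule.span_induction with
    | mem x hx =>
      obtain ⟨n, hn, rfl⟩ := hx
      refine ⟨Pi.single ⟨n.natAbs, by have := hn.1; have := hn.2; omega⟩
        (2 * ((1 / Real.sqrt T : ℝ) : ℂ)), fun t => ?_⟩
      rw [Finset.sum_eq_single ⟨n.natAbs, by have := hn.1; have := hn.2; omega⟩
        (fun b _ hb => by rw [Pi.single_eq_of_ne hb, zero_mul])
        (fun h => absurd (Finset.mem_univ _) h), Pi.single_eq_same]
      have e : 2 * Real.pi * (n : ℝ) * (-t) / T = -(2 * Real.pi * n * t / T) := by ring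
      rw [mode_eq, mode_eq, e, Real.cos_neg, Real.sin_neg, cos_int_eq_cosMode]
      push_cast
      ring
    | zero => exact ⟨0, by simp⟩
    | add x y _ _ hx hy =>
      obtain ⟨c, hc⟩ := hx
      obtain ⟨c', hc'⟩ := hy
      refine ⟨c + c', fun t => ?_⟩
      simp only [Pi.add_apply, add_mul, Finset.sum_add_distrib, ← hc, ← hc']
      ring
    | smul z x _ hx =>
      obtain ⟨c, hc⟩ := hx
      refine ⟨z • c, fun t => ?_⟩
      simp only [Pi.smul_apply, smul_eq_mul, mul_assoc, ← Finset.mul_sum, ← hc]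
      ring
  obtain ⟨c, hc⟩ := key (fun t => (u t : ℂ)) hu.1
  refine ⟨fun k => (c k).re / 2, ?_⟩
  ext t
  have h := congrArg Complex.re (hc t)
  rw [hu.2 t] at h
  simp only [Complex.add_re, Complex.ofReal_re, Complex.re_sum, Complex.re_mul_ofReal] at h
  rw [cosSum_apply]
  simp_rw [div_mul_eq_mul_div]
  rw [← Finset.sum_div, ← h]
  ring

theorem integral_mul_sin_eq_zero (hT : 0 < T) {w : ℝ → ℝ} (heven : ∀ t, w (-t) = w t)
    (hper : ∀ t, w (t + T) = w t) (k : ℤ) :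
    ∫ s in (0 : ℝ)..T, w s * Real.sin (2 * Real.pi * k * s / T) = 0 := by
  have h := intervalIntegral.integral_comp_sub_left (a := 0) (b := T)
    (fun s => w s * Real.sin (2 * Real.pi * k * s / T)) T
  have e : ∀ s : ℝ, w (T - s) * Real.sin (2 * Real.pi * k * (T - s) / T)
      = -(w s * Real.sin (2 * Real.pi * k * s / T)) := by
    intro s
    have e1 : w (T - s) = w s := by rw [← heven s, ← hper (-s)]; congr 1; ring
    have e2 : 2 * Real.pi * k * (T - s) / T = k * (2 * Real.pi) - 2 * Real.pi * k * s / T := by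
      field_simp
    rw [e1, e2, Real.sin_int_mul_two_pi_sub]
    ring
  simp only [e, sub_self, sub_zero, intervalIntegral.integral_neg] at h
  linarith

/-- On even periodic functions the projection `P_M` is given by the cosine coefficients. -/
theorem proj_eq_cosSum (hT : 0 < T) {w : ℝ → ℝ} (hw : Continuous w) (heven : ∀ t, w (-t) = w t)
    (hper : ∀ t, w (t + T) = w t) :
    proj T M w = cosSum T M (fun k => cosCoeff T k w) := by
  ext t
  have hsq : (1 / Real.sqrt T) * (1 / Real.sqrt T) = 1 / T := by
    rw [div_mul_div_comm, Real.mul_self_sqrt hT.le, one_mul]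
  have hint : ∀ k : ℤ, ∫ s in (0 : ℝ)..T, (w s : ℂ) * (starRingEnd ℂ) (mode T k s)
      = ((1 / Real.sqrt T * ∫ s in (0 : ℝ)..T, w s * cosMode T k.natAbs s : ℝ) : ℂ) := by
    intro k
    have e : ∀ s : ℝ, (w s : ℂ) * (starRingEnd ℂ) (mode T k s)
        = ((1 / Real.sqrt T * (w s * cosMode T k.natAbs s) : ℝ) : ℂ)
          - ((1 / Real.sqrt T * (w s * Real.sin (2 * Real.pi * k * s / T)) : ℝ) : ℂ)
            * Complex.I := by
      intro s
      rw [mode_eq, cos_int_eq_cosMode]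
      simp only [map_mul, map_add, Complex.conj_ofReal, Complex.conj_I]
      push_cast
      ring
    simp_rw [e]
    rw [intervalIntegral.integral_sub, intervalIntegral.integral_mul_const,
      intervalIntegral.integral_ofReal, intervalIntegral.integral_ofReal,
      intervalIntegral.integral_const_mul, intervalIntegral.integral_const_mul,
      integral_mul_sin_eq_zero hT heven hper]
    · simp
    · refine Continuous.intervalIntegrable (Complex.continuous_ofReal.comp ?_) _ _
      exact continuous_const.mul (hw.mul (continuous_cosMode T _))
    · refine Continuous.intervalIntegrable ((Complex.continuous_ofReal.comp ?_).mul
        continuous_const) _ _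
      exact continuous_const.mul (hw.mul (by fun_prop))
  have hterm : ∀ k : ℤ, ((∫ s in (0 : ℝ)..T, (w s : ℂ) * (starRingEnd ℂ) (mode T k s))
      * mode T k t).re = 1 / T * (∫ s in (0 : ℝ)..T, w s * cosMode T k.natAbs s)
        * cosMode T k.natAbs t := by
    intro k
    rw [hint, Complex.re_ofReal_mul, mode_eq, Complex.re_ofReal_mul, cos_int_eq_cosMode]
    simp only [Complex.add_re, Complex.ofReal_re, Complex.re_ofReal_mul, Complex.I_re, mul_zero,
      add_zero]
    rw [← hsq]; ring
  rw [proj, Complex.re_sum]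
  simp_rw [hterm]
  rw [Finset.sum_Icc_of_even_eq_range (fun k => by simp), cosSum_apply,
    Fin.sum_univ_eq_sum_range (fun k => cosCoeff T k w * cosMode T k t) (M + 1),
    Finset.sum_range_succ', Finset.sum_range_succ', nsmul_eq_mul]
  have h3 : ∀ k : ℕ, cosCoeff T (k + 1) w * cosMode T (k + 1) t
      = 2 * (1 / T * (∫ s in (0 : ℝ)..T, w s * cosMode T (k + 1) s) * cosMode T (k + 1) t) := by
    intro k
    simp only [cosCoeff, cosWeight, Nat.add_eq_zero_iff, one_ne_zero, and_false, if_false]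
    ring
  have h4 : cosCoeff T 0 w * cosMode T 0 t
      = 1 / T * (∫ s in (0 : ℝ)..T, w s * cosMode T 0 s) * cosMode T 0 t := by
    simp only [cosCoeff, cosWeight, if_true]
  simp only [h3, h4, ← Finset.mul_sum, Int.natAbs_natCast, Int.natAbs_zero, Nat.cast_ofNat]
  simp
  ring

end

/-! ### Smoothness of the truncated nonlinearity -/

theorem exists_taylor_bound {g : ℝ → ℝ} (hg : ContDiff ℝ 2 g) (R : ℝ) :
    ∃ L : ℝ, 0 ≤ L ∧
      (∀ x y z, |x| ≤ R → |y| ≤ R → |z| ≤ R →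
        |g y - g x - deriv g z * (y - x)| ≤ L * (|x - z| + |y - z|) * |y - x|) ∧
      ∀ x y, |x| ≤ R → |y| ≤ R → |deriv g x - deriv g y| ≤ L * |x - y| := by
  have hg1 : ContDiff ℝ 1 (deriv g) := (contDiff_succ_iff_deriv.1 hg).2.2
  have hd : Differentiable ℝ g := hg.differentiable (by norm_num)
  have hd1 : Differentiable ℝ (deriv g) := hg1.differentiable (by norm_num)
  obtain ⟨L, hL⟩ := (isCompact_Icc (a := -R) (b := R)).exists_bound_of_continuousOn
    (hg1.continuous_deriv (by norm_num)).continuousOn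
  have hlip : ∀ x y, |x| ≤ R → |y| ≤ R → |deriv g x - deriv g y| ≤ |L| * |x - y| := by
    intro x y hx hy
    exact (convex_Icc (-R) R).norm_image_sub_le_of_norm_deriv_le (fun t _ => hd1 t)
      (fun t ht => (hL t ht).trans (le_abs_self L)) (abs_le.1 hy) (abs_le.1 hx)
  refine ⟨|L|, abs_nonneg L, fun x y z hx hy hz => ?_, hlip⟩
  have hderiv : ∀ t ∈ Set.uIcc x y,
      HasDerivWithinAt (fun t => g t - deriv g z * t) (deriv g t - deriv g z) (Set.uIcc x y) t := by
    intro t _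
    have := ((hd t).hasDerivAt.fun_sub ((hasDerivAt_id' t).const_mul (deriv g z))).hasDerivWithinAt
      (s := Set.uIcc x y)
    rwa [mul_one] at this
  have hbound : ∀ t ∈ Set.uIcc x y, ‖deriv g t - deriv g z‖ ≤ |L| * (|x - z| + |y - z|) := by
    intro t ht
    have ht' : |t| ≤ R := by
      have := Set.uIcc_subset_Icc (abs_le.1 hx) (abs_le.1 hy) ht
      exact abs_le.2 this
    refine (hlip t z ht' hz).trans (mul_le_mul_of_nonneg_left ?_ (abs_nonneg _))
    rcases Set.mem_uIcc.1 ht with ⟨h1, h2⟩ | ⟨h1, h2⟩ <;>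
      rcases abs_cases (t - z) with ⟨h3, -⟩ | ⟨h3, -⟩ <;>
      linarith [le_abs_self (x - z), le_abs_self (y - z), neg_abs_le (x - z), neg_abs_le (y - z),
        abs_nonneg (x - z), abs_nonneg (y - z)]
  have := (convex_uIcc x y).norm_image_sub_le_of_norm_hasDerivWithin_le hderiv hbound
    Set.left_mem_uIcc Set.right_mem_uIcc
  simp only [Real.norm_eq_abs] at this
  convert this using 2
  ring

theorem IsC11.linear_add_comp {X Y : Type*} [NormedAddCommGroup X] [NormedSpace ℝ X]
    [NormedAddCommGroup Y] [NormedSpace ℝ Y] {S : Y → Y} {DS : Y → Y →L[ℝ] Y} (hS : IsC11 S DS)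
    (L : X →L[ℝ] X) (B : Y →L[ℝ] X) (A : X →L[ℝ] Y) :
    IsC11 (fun x => L x + B (S (A x))) (fun x => L + B ∘L DS (A x) ∘L A) := by
  intro R
  obtain ⟨K, hK, h1, h2⟩ := hS (‖A‖ * R)
  have hA : ∀ x, ‖x‖ ≤ R → ‖A x‖ ≤ ‖A‖ * R := fun x hx => A.le_opNorm_of_le hx
  have hsub : ∀ x y, ‖A x - A y‖ ≤ ‖A‖ * ‖x - y‖ := fun x y => by
    rw [← map_sub]; exact A.le_opNorm _
  refine ⟨‖B‖ * (K * ‖A‖ * ‖A‖), by positivity, fun x y z hx hy hz => ?_, fun x y hx hy => ?_⟩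
  · have e : L y + B (S (A y)) - (L x + B (S (A x))) - (L + B ∘L DS (A z) ∘L A) (y - x)
        = B (S (A y) - S (A x) - DS (A z) (A y - A x)) := by
      simp only [_root_.add_apply, ContinuousLinearMap.comp_apply, map_sub]
      abel
    rw [e]
    calc _ ≤ ‖B‖ * ‖S (A y) - S (A x) - DS (A z) (A y - A x)‖ := B.le_opNorm _
      _ ≤ ‖B‖ * (K * (‖A x - A z‖ + ‖A y - A z‖) * ‖A y - A x‖) := by
          gcongr; exact h1 _ _ _ (hA x hx) (hA y hy) (hA z hz)
      _ ≤ ‖B‖ * (K * (‖A‖ * ‖x - z‖ + ‖A‖ * ‖y - z‖) * (‖A‖ * ‖y - x‖)) := by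
          gcongr <;> apply hsub
      _ = _ := by ring
  · have e : (L + B ∘L DS (A x) ∘L A) - (L + B ∘L DS (A y) ∘L A)
        = B ∘L ((DS (A x) - DS (A y)) ∘L A) := by
      ext v
      simp only [_root_.add_apply, ContinuousLinearMap.comp_apply,
        _root_.sub_apply, map_sub]
      abel
    rw [e]
    calc _ ≤ ‖B‖ * ‖(DS (A x) - DS (A y)) ∘L A‖ := ContinuousLinearMap.opNorm_comp_le _ _
      _ ≤ ‖B‖ * (‖DS (A x) - DS (A y)‖ * ‖A‖) := by
          gcongr; exact ContinuousLinearMap.opNorm_comp_le _ _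
      _ ≤ ‖B‖ * (K * (‖A‖ * ‖x - y‖) * ‖A‖) := by
          gcongr; exact (h2 _ _ (hA x hx) (hA y hy)).trans (by gcongr; apply hsub)
      _ = _ := by ring

section
variable {T : ℝ} {M : ℕ}

theorem abs_cosCoeff_le (hT : 0 < T) (k : ℕ) {w : ℝ → ℝ} {C : ℝ} (h : ∀ s, |w s| ≤ C) :
    |cosCoeff T k w| ≤ 2 * C := by
  have hC : 0 ≤ C := (abs_nonneg _).trans (h 0)
  have h1 : ‖∫ s in (0 : ℝ)..T, w s * cosMode T k s‖ ≤ C * |T - 0| := by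
    refine intervalIntegral.norm_integral_le_of_norm_le_const fun s _ => ?_
    rw [norm_mul]
    exact (mul_le_mul (h s) (abs_cosMode_le T k s) (abs_nonneg _) hC).trans_eq (mul_one _)
  rw [sub_zero, abs_of_pos hT, Real.norm_eq_abs] at h1
  rw [cosCoeff, abs_mul, abs_of_nonneg (cosWeight_nonneg hT k)]
  calc _ ≤ 2 / T * (C * T) :=
        mul_le_mul (cosWeight_le hT k) h1 (abs_nonneg _) (by positivity)
    _ = 2 * C := by field_simp

theorem cosCoeff_add {v w : ℝ → ℝ} (hv : Continuous v) (hw : Continuous w) (k : ℕ) :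
    cosCoeff T k (fun s => v s + w s) = cosCoeff T k v + cosCoeff T k w := by
  simp only [cosCoeff, add_mul]
  rw [intervalIntegral.integral_add (intervalIntegrable_mul_cosMode hv k)
    (intervalIntegrable_mul_cosMode hw k), mul_add]

theorem cosCoeff_sub {v w : ℝ → ℝ} (hv : Continuous v) (hw : Continuous w) (k : ℕ) :
    cosCoeff T k (fun s => v s - w s) = cosCoeff T k v - cosCoeff T k w := by
  simp only [cosCoeff, sub_mul]
  rw [intervalIntegral.integral_sub (intervalIntegrable_mul_cosMode hv k)
    (intervalIntegrable_mul_cosMode hw k), mul_sub]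

theorem cosCoeff_const_mul (c : ℝ) (w : ℝ → ℝ) (k : ℕ) :
    cosCoeff T k (fun s => c * w s) = c * cosCoeff T k w := by
  simp only [cosCoeff, mul_assoc]
  rw [intervalIntegral.integral_const_mul]
  ring

theorem cosCoeff_neg (w : ℝ → ℝ) (k : ℕ) :
    cosCoeff T k (fun s => -w s) = -cosCoeff T k w := by
  simp [cosCoeff]

/-- The map `u ↦ P_M g(u)` in terms of cosine coefficients. -/
noncomputable def galerkin (T : ℝ) (M : ℕ) (g : ℝ → ℝ) (a : Fin (M + 1) → ℝ) : Fin (M + 1) → ℝ :=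
  fun k => cosCoeff T k fun s => g (cosSum T M a s)

/-- The derivative `v ↦ P_M (g'(u) v)` of `u ↦ P_M g(u)`, where `h` is the derivative of `g`, in
terms of cosine coefficients. -/
noncomputable def galerkinDeriv (T : ℝ) (M : ℕ) {h : ℝ → ℝ} (hh : Continuous h)
    (a : Fin (M + 1) → ℝ) : (Fin (M + 1) → ℝ) →L[ℝ] (Fin (M + 1) → ℝ) :=
  LinearMap.toContinuousLinearMap
    { toFun := fun v k => cosCoeff T k fun s => h (cosSum T M a s) * cosSum T M v s
      map_add' := fun v w => by
        ext k
        simp only [map_add, Pi.add_apply, mul_add]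
        exact cosCoeff_add ((hh.comp (continuous_cosSum a)).mul (continuous_cosSum v))
          ((hh.comp (continuous_cosSum a)).mul (continuous_cosSum w)) _
      map_smul' := fun c v => by
        ext k
        simp only [map_smul, Pi.smul_apply, smul_eq_mul, mul_left_comm _ c, RingHom.id_apply]
        exact cosCoeff_const_mul _ _ _ }

theorem galerkinDeriv_apply {h : ℝ → ℝ} (hh : Continuous h) (a v : Fin (M + 1) → ℝ)
    (k : Fin (M + 1)) : galerkinDeriv T M hh a v k
      = cosCoeff T k fun s => h (cosSum T M a s) * cosSum T M v s := rfl

theorem isC11_galerkin (hT : 0 < T) {g : ℝ → ℝ} (hg : ContDiff ℝ 2 g)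
    (hg' : Continuous (deriv g)) :
    IsC11 (galerkin T M g) (galerkinDeriv T M hg') := by
  intro R
  obtain ⟨L, hL, h1, h2⟩ := exists_taylor_bound hg ((M + 1) * R)
  set c : ℝ := M + 1 with hc
  have hc0 : 0 ≤ c := by positivity
  have hbd : ∀ a : Fin (M + 1) → ℝ, ‖a‖ ≤ R → ∀ s, |cosSum T M a s| ≤ c * R := fun a ha s =>
    (abs_cosSum_le a s).trans (by gcongr)
  have hsub : ∀ (a b : Fin (M + 1) → ℝ) s, |cosSum T M a s - cosSum T M b s| ≤ c * ‖a - b‖ := by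
    intro a b s
    have := abs_cosSum_le (T := T) (a - b) s
    rwa [map_sub, Pi.sub_apply] at this
  have hgc : ∀ a : Fin (M + 1) → ℝ, Continuous fun s => g (cosSum T M a s) := fun a =>
    hg.continuous.comp (continuous_cosSum a)
  have hgc' : ∀ a v : Fin (M + 1) → ℝ, Continuous fun s =>
      deriv g (cosSum T M a s) * cosSum T M v s := fun a v =>
    (hg'.comp (continuous_cosSum a)).mul (continuous_cosSum v)
  refine ⟨2 * (L * c * c), by positivity, fun x y z hx hy hz => ?_, fun x y hx hy => ?_⟩
  · refine (pi_norm_le_iff_of_nonneg (by positivity)).2 fun k => ?_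
    have e : (galerkin T M g y - galerkin T M g x - galerkinDeriv T M hg' z (y - x)) k
        = cosCoeff T k (fun s => g (cosSum T M y s) - g (cosSum T M x s)
          - deriv g (cosSum T M z s) * cosSum T M (y - x) s) := by
      have e1 := cosCoeff_sub (T := T) ((hgc y).sub (hgc x)) (hgc' z (y - x)) k
      have e2 := cosCoeff_sub (T := T) (hgc y) (hgc x) k
      exact (e1.trans (congrArg (· - _) e2)).symm
    rw [e, Real.norm_eq_abs]
    refine (abs_cosCoeff_le hT k (C := L * (c * ‖x - z‖ + c * ‖y - z‖) * (c * ‖y - x‖))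
      fun s => ?_).trans_eq (by ring)
    rw [map_sub, Pi.sub_apply]
    refine (h1 _ _ _ (hbd x hx s) (hbd y hy s) (hbd z hz s)).trans ?_
    gcongr <;> apply hsub
  · refine ContinuousLinearMap.opNorm_le_bound _ (by positivity) fun v => ?_
    refine (pi_norm_le_iff_of_nonneg (by positivity)).2 fun k => ?_
    have e : ((galerkinDeriv T M hg' x - galerkinDeriv T M hg' y) v) k
        = cosCoeff T k (fun s => deriv g (cosSum T M x s) * cosSum T M v s
          - deriv g (cosSum T M y s) * cosSum T M v s) := by
      rw [cosCoeff_sub (hgc' x v) (hgc' y v)]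
      rfl
    rw [e, Real.norm_eq_abs]
    refine (abs_cosCoeff_le hT k (C := L * (c * ‖x - y‖) * (c * ‖v‖))
      fun s => ?_).trans_eq (by ring)
    rw [← sub_mul, abs_mul]
    gcongr
    · exact (h2 _ _ (hbd x hx s) (hbd y hy s)).trans (by gcongr; apply hsub)
    · exact abs_cosSum_le v s

end

/-! ### Reversible maps in eigencoordinates -/

/-- The map `(p, q) ↦ (μ p + S(a), μ⁻¹ q - S(a))`, `a = μ p + μ⁻¹ q`, with its inverse
`(p, q) ↦ (μ⁻¹ (p - S(b)), μ (q + S(b)))`, `b = p + q`. It is the map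
`(a, b) ↦ ((μ + μ⁻¹) a + (μ - μ⁻¹) S(a) - b, a)`, written in the eigencoordinates of its
linearization at the origin. -/
noncomputable def eigenDiffeo {n : ℕ} {r : ℝ} (hr : 1 < r) (μ : Fin n → ℝ) (hμ : ∀ k, r ≤ |μ k|)
    (S : (Fin n → ℝ) → Fin n → ℝ) (DS : (Fin n → ℝ) → (Fin n → ℝ) →L[ℝ] (Fin n → ℝ))
    (hS : IsC11 S DS) (hS0 : S 0 = 0) (hDS0 : DS 0 = 0) :
    HypDiffeo ((Fin n → ℝ) × (Fin n → ℝ)) :=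
  letI Y := Fin n → ℝ
  letI m : Y → Y →L[ℝ] Y := fun c => ContinuousLinearMap.mul ℝ Y c
  letI π₁ := ContinuousLinearMap.fst ℝ Y Y
  letI π₂ := ContinuousLinearMap.snd ℝ Y Y
  letI A : Y × Y →L[ℝ] Y := m μ ∘L π₁ + m μ⁻¹ ∘L π₂
  letI A' : Y × Y →L[ℝ] Y := π₁ + π₂
  letI L : Y × Y →L[ℝ] Y × Y := (m μ ∘L π₁).prod (m μ⁻¹ ∘L π₂)
  letI L' : Y × Y →L[ℝ] Y × Y := (m μ⁻¹ ∘L π₁).prod (m μ ∘L π₂)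
  letI B : Y →L[ℝ] Y × Y := (m 1).prod (m (-1))
  letI B' : Y →L[ℝ] Y × Y := (m (-μ⁻¹)).prod (m μ)
  have hμ0 : ∀ k, μ k ≠ 0 := fun k h => by
    have := hμ k
    rw [h, abs_zero] at this
    linarith
  have hinv : μ⁻¹ * μ = 1 := by ext k; simp [hμ0 k]
  have hsmall : ∀ c : Y, ‖μ⁻¹ * c‖ ≤ r⁻¹ * ‖c‖ := fun c => by
    refine (pi_norm_le_iff_of_nonneg (by positivity)).2 fun k => ?_
    rw [Pi.mul_apply, Pi.inv_apply, norm_mul, norm_inv]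
    exact mul_le_mul (inv_anti₀ (by linarith) (hμ k)) (norm_le_pi_norm c k) (norm_nonneg _)
      (by positivity)
  { r := r
    one_lt := hr
    F := fun x => L x + B (S (A x))
    G := fun x => L' x + B' (S (A' x))
    DF := fun x => L + B ∘L DS (A x) ∘L A
    DG := fun x => L' + B' ∘L DS (A' x) ∘L A'
    P := (0 : Y × Y →L[ℝ] Y).prod π₂
    Pc := π₁.prod 0
    F_zero := by simp [hS0]
    left_inv := fun x => by
      have e : A' (L x + B (S (A x))) = A x := by
        simp [A, A', B, L, m, π₁, π₂]
        abel
      simp only [e]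
      ext1
      · simp only [L', B', L, B, A, m, π₁, π₂, ContinuousLinearMap.prod_apply, Prod.fst_add,
          ContinuousLinearMap.comp_apply, ContinuousLinearMap.coe_fst',
          ContinuousLinearMap.coe_snd', ContinuousLinearMap.mul_apply']
        linear_combination x.1 * hinv
      · simp only [L', B', L, B, A, m, π₁, π₂, ContinuousLinearMap.prod_apply, Prod.snd_add,
          ContinuousLinearMap.comp_apply, ContinuousLinearMap.coe_fst',
          ContinuousLinearMap.coe_snd', ContinuousLinearMap.mul_apply']
        linear_combination x.2 * hinv
    right_inv := fun x => by
      have e : A (L' x + B' (S (A' x))) = A' x := by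
        simp only [L', B', A', A, m, π₁, π₂, ContinuousLinearMap.prod_apply, Prod.fst_add,
          ContinuousLinearMap.comp_apply, ContinuousLinearMap.coe_fst', Prod.snd_add,
          ContinuousLinearMap.coe_snd', ContinuousLinearMap.mul_apply',
          _root_.add_apply]
        linear_combination (x.1 + x.2) * hinv
      simp only [e]
      ext1
      · simp only [L', B', L, B, A', m, π₁, π₂, ContinuousLinearMap.prod_apply, Prod.fst_add,
          ContinuousLinearMap.comp_apply, ContinuousLinearMap.coe_fst',
          ContinuousLinearMap.coe_snd', ContinuousLinearMap.mul_apply',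
          _root_.add_apply]
        linear_combination (x.1 - S (x.1 + x.2)) * hinv
      · simp only [L', B', L, B, A', m, π₁, π₂, ContinuousLinearMap.prod_apply, Prod.snd_add,
          ContinuousLinearMap.comp_apply, ContinuousLinearMap.coe_fst',
          ContinuousLinearMap.coe_snd', ContinuousLinearMap.mul_apply',
          _root_.add_apply]
        linear_combination (x.2 + S (x.1 + x.2)) * hinv
    c11F := hS.linear_add_comp L B A
    c11G := hS.linear_add_comp L' B' A'
    DG_DF := fun x v => by
      have e : A' (L x + B (S (A x))) = A x := by
        simp [A, A', B, L, m, π₁, π₂]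
        abel
      have e' : A' (L v + B (DS (A x) (A v))) = A v := by
        simp [A, A', B, L, m, π₁, π₂]
        abel
      simp only [_root_.add_apply, ContinuousLinearMap.comp_apply, e, e']
      ext1
      · simp only [L', B', L, B, m, π₁, π₂, ContinuousLinearMap.prod_apply, Prod.fst_add,
          ContinuousLinearMap.comp_apply, ContinuousLinearMap.coe_fst',
          ContinuousLinearMap.coe_snd', ContinuousLinearMap.mul_apply']
        linear_combination v.1 * hinv
      · simp only [L', B', L, B, m, π₁, π₂, ContinuousLinearMap.prod_apply, Prod.snd_add,
          ContinuousLinearMap.comp_apply, ContinuousLinearMap.coe_fst',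
          ContinuousLinearMap.coe_snd', ContinuousLinearMap.mul_apply']
        linear_combination v.2 * hinv
    DF_DG := fun x v => by
      have e0 : ∀ (y : Y × Y) (s : Y), A (L' y + B' s) = A' y := fun y s => by
        simp only [L', B', A', A, m, π₁, π₂, ContinuousLinearMap.prod_apply, Prod.fst_add,
          ContinuousLinearMap.comp_apply, ContinuousLinearMap.coe_fst', Prod.snd_add,
          ContinuousLinearMap.coe_snd', ContinuousLinearMap.mul_apply',
          _root_.add_apply]
        linear_combination (y.1 + y.2) * hinv
      have e1 : ∀ (y : Y × Y) (s : Y), L (L' y + B' s) + B s = y := fun y s => by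
        ext1
        · simp only [L', B', L, B, m, π₁, π₂, ContinuousLinearMap.prod_apply, Prod.fst_add,
            ContinuousLinearMap.comp_apply, ContinuousLinearMap.coe_fst',
            ContinuousLinearMap.coe_snd', ContinuousLinearMap.mul_apply']
          linear_combination (y.1 - s) * hinv
        · simp only [L', B', L, B, m, π₁, π₂, ContinuousLinearMap.prod_apply, Prod.snd_add,
            ContinuousLinearMap.comp_apply, ContinuousLinearMap.coe_fst',
            ContinuousLinearMap.coe_snd', ContinuousLinearMap.mul_apply']
          linear_combination (y.2 + s) * hinv
      simp only [_root_.add_apply, ContinuousLinearMap.comp_apply, e0]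
      exact e1 _ _
    P_add := fun x => by ext <;> simp [π₁, π₂]
    P_idem := fun x => by simp [π₂]
    P_comm := fun x => by simp [hDS0, L, π₁, π₂]
    Pc_comm := fun x => by simp [hDS0, L', π₁, π₂]
    norm_P := fun x => by simp [π₂, Prod.norm_def]
    norm_Pc := fun x => by simp [π₁, Prod.norm_def]
    contract := fun x => by simpa [hDS0, L, m, π₁, π₂, Prod.norm_def] using hsmall x.2
    expand := fun x => by simpa [hDS0, L', m, π₁, π₂, Prod.norm_def] using hsmall x.1 }

section
variable {n : ℕ} {r : ℝ} (hr : 1 < r) {μ : Fin n → ℝ} (hμ : ∀ k, r ≤ |μ k|)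
  {S : (Fin n → ℝ) → Fin n → ℝ} {DS : (Fin n → ℝ) → (Fin n → ℝ) →L[ℝ] (Fin n → ℝ)}
  (hS : IsC11 S DS) (hS0 : S 0 = 0) (hDS0 : DS 0 = 0)

theorem eigenDiffeo_F (x : (Fin n → ℝ) × (Fin n → ℝ)) :
    (eigenDiffeo hr μ hμ S DS hS hS0 hDS0).F x =
      (μ * x.1 + S (μ * x.1 + μ⁻¹ * x.2), μ⁻¹ * x.2 - S (μ * x.1 + μ⁻¹ * x.2)) := by
  ext1
  · simp [eigenDiffeo]
  · simp [eigenDiffeo, sub_eq_add_neg]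

theorem eigenDiffeo_isOdd (hS1 : ∀ a, S (-a) = -S a) (hS2 : ∀ a, DS (-a) = DS a) :
    (eigenDiffeo hr μ hμ S DS hS hS0 hDS0).IsOdd where
  F_neg x := by
    simp only [eigenDiffeo, map_neg, hS1]
    abel
  DF_neg x := by
    simp only [eigenDiffeo, map_neg, hS2]

end

/-! ### Spectral gap of the truncated linearization -/

section
variable {T : ℝ}

/-- Integration by parts for a function with `E'' = c E` over a period. -/
theorem integral_mul_deriv_deriv {E E' φ : ℝ → ℂ} {c : ℂ} (hE : ∀ t, HasDerivAt E (E' t) t)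
    (hE' : ∀ t, HasDerivAt E' (c * E t) t) (hEp : E T = E 0) (hEp' : E' T = E' 0)
    (hφ : ContDiff ℝ ∞ φ) (hφp : Function.Periodic φ T) :
    ∫ t in (0 : ℝ)..T, E t * deriv (deriv φ) t = c * ∫ t in (0 : ℝ)..T, E t * φ t := by
  have hφ1 : ContDiff ℝ ∞ (deriv φ) := (contDiff_infty_iff_deriv.1 hφ).2
  have hφ2 : ContDiff ℝ ∞ (deriv (deriv φ)) := (contDiff_infty_iff_deriv.1 hφ1).2
  have d0 : ∀ t, HasDerivAt φ (deriv φ t) t := fun t =>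
    (hφ.differentiable (by simp) t).hasDerivAt
  have d1 : ∀ t, HasDerivAt (deriv φ) (deriv (deriv φ) t) t := fun t =>
    (hφ1.differentiable (by simp) t).hasDerivAt
  have hEc : Continuous E := continuous_iff_continuousAt.2 fun t => (hE t).continuousAt
  have hd : ∀ t ∈ Set.uIcc 0 T, HasDerivAt (fun t => E t * deriv φ t - E' t * φ t)
      (E t * deriv (deriv φ) t - c * (E t * φ t)) t := by
    intro t _
    exact (((hE t).fun_mul (d1 t)).fun_sub ((hE' t).fun_mul (d0 t))).congr_deriv (by ring)
  have i1 : IntervalIntegrable (fun t => E t * deriv (deriv φ) t) volume 0 T :=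
    (hEc.mul hφ2.continuous).intervalIntegrable _ _
  have i2 : IntervalIntegrable (fun t => c * (E t * φ t)) volume 0 T :=
    (continuous_const.mul (hEc.mul hφ.continuous)).intervalIntegrable _ _
  have h := intervalIntegral.integral_eq_sub_of_hasDerivAt hd (i1.sub i2)
  have hp0 : φ T = φ 0 := by simpa using hφp 0
  have hp1 : deriv φ T = deriv φ 0 := by
    have h2 : (fun t => φ (t + T)) = φ := funext hφp
    have h3 := deriv_comp_add_const φ T 0
    rw [h2, zero_add] at h3
    exact h3.symm
  rw [intervalIntegral.integral_sub i1 i2, hEp, hEp', hp0, hp1, sub_self,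
    intervalIntegral.integral_const_mul] at h
  exact sub_eq_zero.1 h

/-- The exponentials `exp (i ω t)` with `ω T ∈ 2 π ℤ` are eigenfunctions of the weak second
derivative, with eigenvalue `- ω²`. -/
theorem exists_weak_eigenfunction (hT : 0 < T) (k : ℕ) :
    ∃ e : L2per T, e ≠ 0 ∧ ∀ c : ℂ,
      IsWeakSecondDeriv T (c • e) ((-(2 * Real.pi * k / T : ℝ) ^ 2 * c : ℂ) • e) := by
  set ν : ℝ := 2 * Real.pi * k / T with hν
  set E : ℝ → ℂ := fun t => Complex.exp ((t : ℂ) * (ν * Complex.I)) with hEdef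
  have hE : ∀ t, HasDerivAt E (E t * (ν * Complex.I)) t := fun t => by
    have h1 : HasDerivAt (fun t : ℝ => (t : ℂ) * (ν * Complex.I)) (1 * (ν * Complex.I)) t :=
      (Complex.ofRealCLM.hasDerivAt (x := t)).mul_const _
    simpa using h1.cexp
  have hE' : ∀ t, HasDerivAt (fun t => E t * (ν * Complex.I)) (-(ν : ℂ) ^ 2 * E t) t := fun t => by
    refine ((hE t).mul_const (ν * Complex.I)).congr_deriv ?_
    linear_combination ((ν : ℂ) ^ 2 * E t) * Complex.I_sq
  have hEc : Continuous E := continuous_iff_continuousAt.2 fun t => (hE t).continuousAt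
  have hEp : E T = E 0 := by
    have h1 : (T : ℂ) * (ν * Complex.I) = (k : ℤ) * (2 * Real.pi * Complex.I) := by
      have : (T : ℂ) ≠ 0 := by exact_mod_cast hT.ne'
      rw [hν]; push_cast; field_simp
    simp only [hEdef, h1, Complex.exp_int_mul_two_pi_mul_I]
    simp
  have hmem : MemLp E 2 (volume.restrict (Set.Ioc (0 : ℝ) T)) := by
    refine MemLp.of_bound hEc.aestronglyMeasurable 1 (ae_of_all _ fun t => ?_)
    have h1 : (t : ℂ) * (ν * Complex.I) = ((t * ν : ℝ) : ℂ) * Complex.I := by push_cast; ring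
    simp only [hEdef, h1, Complex.norm_exp_ofReal_mul_I, le_refl]
  have hae : ∀ c : ℂ, ⇑(c • hmem.toLp E) =ᵐ[volume.restrict (Set.Ioc (0 : ℝ) T)]
      fun t => c * E t := fun c => by
    filter_upwards [Lp.coeFn_smul c (hmem.toLp E), hmem.coeFn_toLp] with t h1 h2
    rw [h1, Pi.smul_apply, h2, smul_eq_mul]
  have hint : ∀ (c : ℂ) (ψ : ℝ → ℂ), ∫ t in (0 : ℝ)..T, (c • hmem.toLp E) t * ψ t
      = c * ∫ t in (0 : ℝ)..T, E t * ψ t := fun c ψ => by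
    rw [intervalIntegral.integral_of_le hT.le, intervalIntegral.integral_of_le hT.le,
      ← integral_const_mul]
    refine integral_congr_ae ?_
    filter_upwards [hae c] with t h1
    rw [h1, mul_assoc]
  refine ⟨hmem.toLp E, fun h => ?_, fun c φ hφ hφp => ?_⟩
  · have h1 : ∀ᵐ t ∂(volume.restrict (Set.Ioc (0 : ℝ) T)), False := by
      filter_upwards [hmem.coeFn_toLp, Lp.eq_zero_iff_ae_eq_zero.1 h] with t h2 h3
      rw [h3] at h2
      exact Complex.exp_ne_zero _ h2.symm
    rw [Filter.eventually_false_iff_eq_bot, ae_eq_bot, Measure.restrict_eq_zero,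
      Real.volume_Ioc, ENNReal.ofReal_eq_zero] at h1
    linarith
  · rw [hint, hint, integral_mul_deriv_deriv hE hE' hEp (by rw [hEp]) hφ hφp]
    ring

variable {V : ℝ → ℝ} {d : ℝ}

/-- A coefficient `r_k ∈ [-2, 2]` would yield an eigenvalue `ζ` of `DF(0)` on the unit circle, a
solution of `ζ² - r_k ζ + 1 = 0`. -/
theorem two_lt_abs_rCoeff (hT : 0 < T)
    (hhyp : BoundedAwayFromUnitCircle (DFZeroSpectrum V d T)) (k : ℕ) :
    2 < |rCoeff V d T k| := by
  by_contra! hcon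
  set ρ := rCoeff V d T k with hρ
  have hsq : 0 ≤ 1 - ρ ^ 2 / 4 := by
    have := sq_le_sq' (neg_le_of_abs_le hcon) (le_of_abs_le hcon)
    linarith
  have hroot := Real.sq_sqrt hsq
  set β := Real.sqrt (1 - ρ ^ 2 / 4) with hβ
  set ζ : ℂ := ⟨ρ / 2, β⟩ with hζ
  have hnorm : ‖ζ‖ = 1 := by
    rw [Complex.norm_def, Complex.normSq_apply, Real.sqrt_eq_one]
    simp only [hζ]
    linarith
  have hquad : ζ * ζ = ρ * ζ - 1 := by
    apply Complex.ext
    · simp [hζ]; linarith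
    · simp [hζ]; ring
  obtain ⟨ε, hε, hfar⟩ := hhyp
  have hspec : ζ ∈ DFZeroSpectrum V d T := by
    rintro ⟨R, hR, -⟩
    obtain ⟨e, he, hweak⟩ := exists_weak_eigenfunction hT k
    have hgraph : DFZeroGraph V d T (ζ • e, e) (ζ • (ζ • e, e)) := by
      refine ⟨_, hweak ζ, ?_, rfl⟩
      change ζ • ζ • e = _
      rw [smul_smul, smul_smul, smul_smul, ← add_smul]
      rw [hquad, sub_smul, one_smul]
      congr 2
      rw [hρ, rCoeff]
      push_cast
      ring
    have h := hR _ _ hgraph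
    rw [sub_self, map_zero] at h
    exact he (congrArg Prod.snd h).symm
  have := hfar ζ hspec ζ hnorm
  rw [sub_self, norm_zero] at this
  linarith

theorem eigenvalueAt_add_inv (k : ℕ) (h : 2 < |rCoeff V d T k|) :
    eigenvalueAt V d T k + (eigenvalueAt V d T k)⁻¹ = rCoeff V d T k ∧
      |eigenvalueAt V d T k| ≠ 1 ∧ eigenvalueAt V d T k ≠ 0 := by
  have h4 : 4 < rCoeff V d T k ^ 2 := by
    rw [← sq_abs]; nlinarith
  have hs := Real.sq_sqrt (show 0 ≤ rCoeff V d T k ^ 2 - 4 by linarith)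
  have hquad : eigenvalueAt V d T k * (rCoeff V d T k - eigenvalueAt V d T k) = 1 := by
    rw [eigenvalueAt]; linear_combination -hs / 4
  have hne : eigenvalueAt V d T k ≠ 0 := left_ne_zero_of_mul_eq_one hquad
  have hinv := eq_inv_of_mul_eq_one_right hquad
  refine ⟨by rw [← hinv]; ring, fun h1 => ?_, hne⟩
  have h2 : eigenvalueAt V d T k ^ 2 = 1 := by rw [← sq_abs, h1]; norm_num
  have h3 : rCoeff V d T k = 2 * eigenvalueAt V d T k := by
    have : eigenvalueAt V d T k * (rCoeff V d T k - 2 * eigenvalueAt V d T k) = 0 := by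
      linear_combination hquad - h2
    linarith [(mul_eq_zero.1 this).resolve_left hne]
  rw [h3] at h4
  nlinarith

/-- The eigenvalues outside the unit circle. -/
theorem exists_unstable_eigenvalues (hr : ∀ k, 2 < |rCoeff V d T k|) (M : ℕ) :
    1 < rate V d T M ∧ ∃ μ : Fin (M + 1) → ℝ, ∀ k,
      rate V d T M ≤ |μ k| ∧ μ k + (μ k)⁻¹ = rCoeff V d T k := by
  set S := {a | ∃ l ∈ eigenvalueSet V d T M, 1 < |l| ∧ a = |l|} with hS
  have hfin : S.Finite := by
    have h1 : (eigenvalueSet V d T M).Finite := by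
      refine (((Set.finite_Iic M).image (eigenvalueAt V d T)).union
        ((Set.finite_Iic M).image fun k => (eigenvalueAt V d T k)⁻¹)).subset ?_
      rintro l ⟨k, hk, rfl | rfl⟩
      · exact Or.inl ⟨k, hk, rfl⟩
      · exact Or.inr ⟨k, hk, rfl⟩
    refine (h1.image abs).subset ?_
    rintro a ⟨l, hl, -, rfl⟩
    exact ⟨l, hl, rfl⟩
  have hex : ∀ k : Fin (M + 1), ∃ μ : ℝ, |μ| ∈ S ∧ μ + μ⁻¹ = rCoeff V d T k := by
    intro k
    have hk : (k : ℕ) ≤ M := Nat.lt_succ_iff.1 k.2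
    obtain ⟨h1, h2, h3⟩ := eigenvalueAt_add_inv k (hr k)
    rcases lt_or_gt_of_ne h2 with h | h
    · refine ⟨(eigenvalueAt V d T k)⁻¹, ⟨_, ⟨k, hk, Or.inr rfl⟩, ?_, rfl⟩, ?_⟩
      · rw [abs_inv]
        exact (one_lt_inv₀ (abs_pos.2 h3)).2 h
      · rw [inv_inv, add_comm, h1]
    · exact ⟨_, ⟨_, ⟨k, hk, Or.inl rfl⟩, h, rfl⟩, h1⟩
  choose μ hμ hμ' using hex
  have hmem : sInf S ∈ S := Set.Nonempty.csInf_mem ⟨_, hμ 0⟩ hfin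
  refine ⟨?_, μ, fun k => ⟨csInf_le hfin.bddBelow (hμ k), hμ' k⟩⟩
  obtain ⟨l, -, hl, hl'⟩ := hmem
  change 1 < sInf S
  rw [hl']
  exact hl

end

/-! ### The lattice map in eigencoordinates -/

section
variable {T : ℝ} {M : ℕ}

theorem hasDerivAt_cosMode (T : ℝ) (k : ℕ) (t : ℝ) :
    HasDerivAt (cosMode T k)
      (-(2 * Real.pi * k / T) * Real.sin (2 * Real.pi * k / T * t)) t := by
  have h := ((hasDerivAt_id' t).const_mul (2 * Real.pi * k / T)).cos
  have e : cosMode T k = fun t => Real.cos (2 * Real.pi * k / T * t) := by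
    ext t; rw [cosMode]; congr 1; ring
  rw [e]
  exact h.congr_deriv (by ring)

theorem deriv_deriv_cosMode (T : ℝ) (k : ℕ) :
    deriv (deriv (cosMode T k)) = fun t => -(2 * Real.pi * k / T) ^ 2 * cosMode T k t := by
  have h1 : deriv (cosMode T k) = fun t =>
      -(2 * Real.pi * k / T) * Real.sin (2 * Real.pi * k / T * t) :=
    funext fun t => (hasDerivAt_cosMode T k t).deriv
  ext t
  have h2 := (((hasDerivAt_id' t).const_mul (2 * Real.pi * k / T)).sin).const_mul
    (-(2 * Real.pi * k / T))
  have e : 2 * Real.pi * k * t / T = 2 * Real.pi * k / T * t := by ring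
  rw [h1, h2.deriv, cosMode, e]
  ring

theorem iteratedDeriv_cosSum (j : ℕ) (a : Fin (M + 1) → ℝ) (t : ℝ) :
    iteratedDeriv j (cosSum T M a) t = ∑ k, a k * iteratedDeriv j (cosMode T k) t := by
  have e : cosSum T M a = fun t => ∑ k : Fin (M + 1), a k * cosMode T k t := rfl
  rw [e, iteratedDeriv_fun_sum]
  · simp only [iteratedDeriv_const_mul_field]
  · exact fun k _ => ((contDiff_const.mul (contDiff_cosMode T k)).of_le
      (by exact_mod_cast le_top)).contDiffAt

theorem deriv_deriv_cosSum (a : Fin (M + 1) → ℝ) :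
    deriv (deriv (cosSum T M a)) =
      cosSum T M (fun k => -(2 * Real.pi * k / T) ^ 2 * a k) := by
  have h2 : ∀ f : ℝ → ℝ, deriv (deriv f) = iteratedDeriv 2 f := fun f => by
    rw [iteratedDeriv_succ, iteratedDeriv_one]
  ext t
  rw [h2, iteratedDeriv_cosSum, cosSum_apply]
  refine Finset.sum_congr rfl fun k _ => ?_
  rw [← h2, deriv_deriv_cosMode]
  ring

theorem abs_iteratedDeriv_cosSum_le (T : ℝ) (M j : ℕ) :
    ∃ β : ℝ, 0 ≤ β ∧ ∀ (a : Fin (M + 1) → ℝ), ∀ t ∈ Set.Icc 0 T,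
      |iteratedDeriv j (cosSum T M a) t| ≤ β * ‖a‖ := by
  have hc : ∀ k : Fin (M + 1), ∃ C, ∀ t ∈ Set.Icc 0 T,
      ‖iteratedDeriv j (cosMode T k) t‖ ≤ C := fun k =>
    isCompact_Icc.exists_bound_of_continuousOn
      ((contDiff_cosMode T k).continuous_iteratedDeriv j
        (by exact_mod_cast le_top)).continuousOn
  choose C hC using hc
  refine ⟨∑ k, |C k|, Finset.sum_nonneg fun k _ => abs_nonneg _, fun a t ht => ?_⟩
  rw [iteratedDeriv_cosSum, Finset.sum_mul]
  refine (Finset.abs_sum_le_sum_abs _ _).trans (Finset.sum_le_sum fun k _ => ?_)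
  rw [abs_mul, mul_comm]
  exact mul_le_mul ((hC k t ht).trans (le_abs_self _)) (norm_le_pi_norm a k) (abs_nonneg _)
    (abs_nonneg _)

theorem l2norm_timeDeriv_cosSum_le (hT : 0 < T) (M j : ℕ) :
    ∃ β : ℝ, 0 ≤ β ∧ ∀ x : (Fin (M + 1) → ℝ) × (Fin (M + 1) → ℝ),
      l2norm T (timeDeriv j (cosSum T M x.1, cosSum T M x.2)) ≤ β * ‖x‖ := by
  obtain ⟨β, hβ, h⟩ := abs_iteratedDeriv_cosSum_le T M j
  refine ⟨Real.sqrt (2 * T) * β, by positivity, fun x => ?_⟩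
  have hsq : ∀ (a : Fin (M + 1) → ℝ), ‖a‖ ≤ ‖x‖ → ∀ t ∈ Set.Icc 0 T,
      iteratedDeriv j (cosSum T M a) t ^ 2 ≤ (β * ‖x‖) ^ 2 := fun a ha t ht => by
    rw [← sq_abs]
    gcongr
    exact (h a t ht).trans (by gcongr)
  have h1 : ‖∫ t in (0 : ℝ)..T, (iteratedDeriv j (cosSum T M x.1) t ^ 2
      + iteratedDeriv j (cosSum T M x.2) t ^ 2)‖ ≤ 2 * (β * ‖x‖) ^ 2 * |T - 0| := by
    refine intervalIntegral.norm_integral_le_of_norm_le_const fun t ht => ?_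
    rw [Set.uIoc_of_le hT.le] at ht
    have ht' : t ∈ Set.Icc 0 T := Set.Ioc_subset_Icc_self ht
    rw [Real.norm_of_nonneg (by positivity)]
    linarith [hsq x.1 (norm_fst_le x) t ht', hsq x.2 (norm_snd_le x) t ht']
  rw [sub_zero, abs_of_pos hT, Real.norm_eq_abs] at h1
  have h2 : (Real.sqrt (2 * T) * β * ‖x‖) ^ 2 = 2 * (β * ‖x‖) ^ 2 * T := by
    rw [mul_pow, mul_pow, Real.sq_sqrt (by positivity)]; ring
  rw [l2norm, Real.sqrt_le_left (by positivity), h2]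
  exact (le_abs_self _).trans h1

theorem norm_le_l2norm_cosSum (hT : 0 < T) (x : (Fin (M + 1) → ℝ) × (Fin (M + 1) → ℝ)) :
    ‖x‖ ≤ Real.sqrt (2 / T) * l2norm T (cosSum T M x.1, cosSum T M x.2) := by
  have hc : ∀ a : Fin (M + 1) → ℝ,
      IntervalIntegrable (fun t => cosSum T M a t ^ 2) volume 0 T := fun a =>
    ((continuous_cosSum a).pow 2).intervalIntegrable _ _
  have hpos : ∀ a : Fin (M + 1) → ℝ, 0 ≤ ∫ t in (0 : ℝ)..T, cosSum T M a t ^ 2 := fun a =>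
    intervalIntegral.integral_nonneg hT.le fun t _ => sq_nonneg _
  rw [l2norm, intervalIntegral.integral_add (hc _) (hc _), ← Real.sqrt_mul (by positivity)]
  have key : ∀ a : Fin (M + 1) → ℝ, (∫ t in (0 : ℝ)..T, cosSum T M a t ^ 2) ≤
      (∫ t in (0 : ℝ)..T, cosSum T M x.1 t ^ 2) + ∫ t in (0 : ℝ)..T, cosSum T M x.2 t ^ 2 →
      ‖a‖ ≤ Real.sqrt (2 / T * ((∫ t in (0 : ℝ)..T, cosSum T M x.1 t ^ 2)
        + ∫ t in (0 : ℝ)..T, cosSum T M x.2 t ^ 2)) := fun a ha => by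
    refine (pi_norm_le_iff_of_nonneg (Real.sqrt_nonneg _)).2 fun k => ?_
    rw [Real.norm_eq_abs]
    refine Real.abs_le_sqrt ((sq_le_integral_cosSum_sq hT a k).trans ?_)
    gcongr
  exact norm_prod_le_iff.2 ⟨key x.1 (le_add_of_nonneg_right (hpos _)),
    key x.2 (le_add_of_nonneg_left (hpos _))⟩

end

theorem l2norm_zero (T : ℝ) : l2norm T 0 = 0 := by simp [l2norm]

/-- Linear coordinates `χ` on `X_{M,e}²` in which the lattice map becomes an odd hyperbolic
diffeomorphism with rate `r_M` of a finite-dimensional space, together with the equivalence of the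
norms and the boundedness of all derivatives with respect to time. -/
structure TrigChart (V : ℝ → ℝ) (d T : ℝ) (M : ℕ) (X : Type*) [NormedAddCommGroup X]
    [NormedSpace ℝ X] where
  H : HypDiffeo X
  χ : X →ₗ[ℝ] State
  r_eq : H.r = rate V d T M
  isOdd : H.IsOdd
  mem : ∀ x, χ x ∈ phaseSpace T M
  surj : ∀ u ∈ phaseSpace T M, ∃ x, χ x = u
  conj : ∀ x, latticeMap V d T M (χ x) = χ (H.F x)
  norm_le : ∃ c : ℝ, 0 < c ∧ ∀ x, ‖x‖ ≤ c * l2norm T (χ x)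
  deriv_le : ∀ j, ∃ β : ℝ, 0 ≤ β ∧ ∀ x, l2norm T (timeDeriv j (χ x)) ≤ β * ‖x‖
  deriv_sub_smul : ∀ j x y (s : ℝ),
    timeDeriv j (χ x) - s • timeDeriv j (χ y) = timeDeriv j (χ (x - s • y))

/-- The coordinates are the coefficients, with respect to the eigenvectors of the linearization at
the origin, of the pair of vectors of cosine coefficients. -/
theorem exists_trigChart {V : ℝ → ℝ} (hV : ContDiff ℝ ∞ V) (hVeven : ∀ x, V (-x) = V x)
    {d T : ℝ} (hd : 0 < d) (hT : 0 < T)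
    (hhyp : BoundedAwayFromUnitCircle (DFZeroSpectrum V d T)) (M : ℕ) :
    Nonempty (TrigChart V d T M ((Fin (M + 1) → ℝ) × (Fin (M + 1) → ℝ))) := by
  have hg : ContDiff ℝ ∞ (deriv V) := (contDiff_infty_iff_deriv.1 hV).2
  have hgc : Continuous (deriv (deriv V)) := (contDiff_infty_iff_deriv.1 hg).2.continuous
  have hodd : ∀ x, deriv V (-x) = -deriv V x := fun x => by
    have h := deriv_comp_neg V x
    rw [funext hVeven] at h
    rw [h, neg_neg]
  have heven : ∀ x, deriv (deriv V) (-x) = deriv (deriv V) x := fun x => by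
    have h := deriv_comp_neg (deriv V) x
    have e : (fun x => deriv V (-x)) = -deriv V := funext hodd
    rw [e, deriv.neg] at h
    exact (neg_inj.1 h).symm
  have hzero : deriv V 0 = 0 := by
    have := hodd 0
    rw [neg_zero] at this
    linarith
  obtain ⟨hr, μ, hμ⟩ := exists_unstable_eigenvalues (two_lt_abs_rCoeff hT hhyp) M
  have hμ0 : ∀ k, μ k ≠ 0 := fun k h => by
    have := (hμ k).1
    rw [h, abs_zero] at this
    linarith
  have hΔ : ∀ k, μ k - (μ k)⁻¹ ≠ 0 := fun k h => by
    have h1 : μ k * μ k = 1 := by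
      have := sub_eq_zero.1 h
      nth_rewrite 2 [this]
      exact mul_inv_cancel₀ (hμ0 k)
    have h2 := (hμ k).1
    have h3 := abs_mul_abs_self (μ k)
    nlinarith
  -- `(μ - μ⁻¹) S(a) = d⁻¹ (P_M f(a) - f'(0) a)` is the nonlinear part of the lattice map; the
  -- factor `μ - μ⁻¹` comes from the passage to eigencoordinates
  set f0 := deriv (deriv V) 0 with hf0
  set c : Fin (M + 1) → ℝ := fun k => (d * (μ k - (μ k)⁻¹))⁻¹ with hc
  set L := ContinuousLinearMap.mul ℝ (Fin (M + 1) → ℝ) (-(f0 • c)) with hL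
  set B := ContinuousLinearMap.mul ℝ (Fin (M + 1) → ℝ) c with hB
  set ι := ContinuousLinearMap.id ℝ (Fin (M + 1) → ℝ) with hι
  set S : (Fin (M + 1) → ℝ) → (Fin (M + 1) → ℝ) :=
    fun a => L a + B (galerkin T M (deriv V) (ι a)) with hS
  set DS : (Fin (M + 1) → ℝ) → (Fin (M + 1) → ℝ) →L[ℝ] (Fin (M + 1) → ℝ) := fun a =>
    L + B ∘L galerkinDeriv T M hgc (ι a) ∘L ι with hDS
  have hS11 : IsC11 S DS := (isC11_galerkin hT (contDiff_infty.1 hg 2)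
    hgc).linear_add_comp L B ι
  have hN0 : galerkin T M (deriv V) 0 = 0 := by
    ext k
    simp [galerkin, cosCoeff, hzero]
  have hS0 : S 0 = 0 := by simp [hS, hN0]
  have hDS0 : DS 0 = 0 := by
    ext v k
    have h : galerkinDeriv T M hgc 0 v k = f0 * v k := by
      rw [galerkinDeriv_apply]
      simp only [map_zero, Pi.zero_apply]
      rw [cosCoeff_const_mul, cosCoeff_cosSum hT]
    simp only [hDS, hL, hB, _root_.add_apply, ContinuousLinearMap.comp_apply,
      hι, ContinuousLinearMap.id_apply, ContinuousLinearMap.mul_apply', Pi.add_apply, Pi.mul_apply,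
      Pi.neg_apply, Pi.smul_apply, smul_eq_mul, h, _root_.zero_apply, Pi.zero_apply]
    ring
  have hS1 : ∀ a, S (-a) = -S a := fun a => by
    have h : galerkin T M (deriv V) (-a) = -galerkin T M (deriv V) a := by
      ext k
      simp only [galerkin, map_neg, Pi.neg_apply, hodd, cosCoeff_neg]
    simp only [hS, hι, ContinuousLinearMap.id_apply, h, map_neg]
    abel
  have hS2 : ∀ a, DS (-a) = DS a := fun a => by
    have h : galerkinDeriv T M hgc (-a) = galerkinDeriv T M hgc a := by
      ext v k
      simp only [galerkinDeriv_apply, map_neg, Pi.neg_apply, heven]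
    simp only [hDS, hι, ContinuousLinearMap.id_apply, h]
  -- eigencoordinates to pairs of cosine coefficients
  set E : (Fin (M + 1) → ℝ) × (Fin (M + 1) → ℝ) →ₗ[ℝ] (Fin (M + 1) → ℝ) × (Fin (M + 1) → ℝ) :=
    { toFun := fun x => (μ * x.1 + μ⁻¹ * x.2, x.1 + x.2)
      map_add' := fun x y => by ext1 <;> simp only [Prod.fst_add, Prod.snd_add] <;> ring
      map_smul' := fun s x => by
        ext1 <;> simp [smul_add] } with hE
  have hEinj : LinearMap.ker E = ⊥ := by
    refine LinearMap.ker_eq_bot'.2 fun x hx => ?_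
    have h1 : μ * x.1 + μ⁻¹ * x.2 = 0 := congrArg Prod.fst hx
    have h2 : x.1 + x.2 = 0 := congrArg Prod.snd hx
    have h3 : x.1 = 0 := by
      ext k
      have h1k := congrFun h1 k
      have h2k := congrFun h2 k
      simp only [Pi.add_apply, Pi.mul_apply, Pi.inv_apply, Pi.zero_apply] at h1k h2k ⊢
      refine (mul_eq_zero.1 (?_ : (μ k - (μ k)⁻¹) * x.1 k = 0)).resolve_left (hΔ k)
      linear_combination h1k - (μ k)⁻¹ * h2k
    rw [h3, zero_add] at h2
    exact Prod.ext h3 h2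
  have hEsurj : Function.Surjective E :=
    LinearMap.injective_iff_surjective.1 (LinearMap.ker_eq_bot.1 hEinj)
  set χ : (Fin (M + 1) → ℝ) × (Fin (M + 1) → ℝ) →ₗ[ℝ] State :=
    ((cosSum T M).prodMap (cosSum T M)) ∘ₗ E with hχ
  have hχa : ∀ x, χ x = (cosSum T M (E x).1, cosSum T M (E x).2) := fun x => rfl
  refine ⟨
    { H := eigenDiffeo hr μ (fun k => (hμ k).1) S DS hS11 hS0 hDS0
      χ := χ
      r_eq := rfl
      isOdd := eigenDiffeo_isOdd hr _ hS11 hS0 hDS0 hS1 hS2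
      mem := fun x => ⟨cosSum_mem_evenSpace hT _, cosSum_mem_evenSpace hT _⟩
      surj := fun u hu => ?_
      conj := fun x => ?_
      norm_le := ?_
      deriv_le := fun j => ?_
      deriv_sub_smul := fun j x y s => ?_ }⟩
  · obtain ⟨a, ha⟩ := exists_cosSum_of_mem_evenSpace hu.1
    obtain ⟨b, hb⟩ := exists_cosSum_of_mem_evenSpace hu.2
    obtain ⟨x, hx⟩ := hEsurj (a, b)
    exact ⟨x, by rw [hχa, hx, ha, hb]⟩
  · rw [eigenDiffeo_F]
    set a := μ * x.1 + μ⁻¹ * x.2 with ha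
    have h2 : (E (μ * x.1 + S a, μ⁻¹ * x.2 - S a)).2 = a := by
      change μ * x.1 + S a + (μ⁻¹ * x.2 - S a) = a
      rw [ha]; ring
    have h1 : (E (μ * x.1 + S a, μ⁻¹ * x.2 - S a)).1 = (2 : ℝ) • a
        + (1 / d) • galerkin T M (deriv V) a
        + (1 / d) • (fun k : Fin (M + 1) => -(2 * Real.pi * k / T) ^ 2 * a k)
        - (x.1 + x.2) := by
      change μ * (μ * x.1 + S a) + μ⁻¹ * (μ⁻¹ * x.2 - S a) = _
      ext k
      have hk := (hμ k).2
      have hd0 := hd.ne'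
      have hm0 := hμ0 k
      have hSk : (μ k - (μ k)⁻¹) * S a k
          = (1 / d) * galerkin T M (deriv V) a k - f0 / d * a k := by
        simp only [hS, hL, hB, hc, ContinuousLinearMap.mul_apply', hι, ContinuousLinearMap.id_apply,
          Pi.add_apply, Pi.mul_apply, Pi.neg_apply, Pi.smul_apply, smul_eq_mul, mul_inv]
        have := mul_inv_cancel₀ (hΔ k)
        linear_combination (d⁻¹ * galerkin T M (deriv V) a k - f0 * d⁻¹ * a k) * this
      have hak : a k = μ k * x.1 k + (μ k)⁻¹ * x.2 k := rfl
      have hmi : μ k * (μ k)⁻¹ = 1 := mul_inv_cancel₀ hm0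
      have hrk : rCoeff V d T k = 2 + (1 / d) * -(2 * Real.pi * k / T) ^ 2 + f0 / d := by
        rw [rCoeff]; field_simp; ring
      rw [hrk] at hk
      simp only [Pi.add_apply, Pi.sub_apply, Pi.mul_apply, Pi.inv_apply, Pi.smul_apply,
        smul_eq_mul]
      linear_combination hSk + a k * hk - (x.1 k + x.2 k) * hmi
        - (μ k + (μ k)⁻¹) * hak
    have hproj : proj T M (fun s => deriv V (cosSum T M a s))
        = cosSum T M (galerkin T M (deriv V) a) :=
      proj_eq_cosSum hT (hg.continuous.comp (continuous_cosSum a))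
        (fun t => by rw [cosSum_neg_arg]) (fun t => by rw [cosSum_add_period hT])
    rw [hχa (μ * x.1 + S a, μ⁻¹ * x.2 - S a), h1, h2]
    refine Prod.ext ?_ rfl
    ext t
    change 2 * cosSum T M a t + 1 / d * proj T M (fun s => deriv V (cosSum T M a s)) t
      + 1 / d * deriv (deriv (cosSum T M a)) t - cosSum T M (x.1 + x.2) t = _
    rw [hproj, deriv_deriv_cosSum]
    simp only [map_add, map_sub, map_smul, Pi.add_apply, Pi.sub_apply, Pi.smul_apply, smul_eq_mul]
  · obtain ⟨K, hK, hanti⟩ := LinearMap.exists_antilipschitzWith E hEinj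
    have hTs : 0 < Real.sqrt (2 / T) := Real.sqrt_pos.2 (by positivity)
    refine ⟨K * Real.sqrt (2 / T), by positivity, fun x => ?_⟩
    have h1 : ‖x‖ ≤ K * ‖E x‖ := by
      have := hanti.le_mul_dist x 0
      simpa [dist_zero_right] using this
    refine h1.trans ?_
    rw [mul_assoc]
    exact mul_le_mul_of_nonneg_left (norm_le_l2norm_cosSum hT (E x)) K.2
  · obtain ⟨β, hβ, h⟩ := l2norm_timeDeriv_cosSum_le hT M j
    refine ⟨β * ‖LinearMap.toContinuousLinearMap E‖, by positivity, fun x => ?_⟩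
    rw [mul_assoc]
    exact (h (E x)).trans (mul_le_mul_of_nonneg_left
      ((LinearMap.toContinuousLinearMap E).le_opNorm x) hβ)
  · have key : ∀ a b : Fin (M + 1) → ℝ,
        iteratedDeriv j (cosSum T M a) - s • iteratedDeriv j (cosSum T M b)
          = iteratedDeriv j (cosSum T M (a - s • b)) := fun a b => by
      ext t
      simp only [Pi.sub_apply, Pi.smul_apply, smul_eq_mul, iteratedDeriv_cosSum, sub_mul,
        Finset.sum_sub_distrib, Finset.mul_sum, mul_assoc]
    simp only [hχa, map_sub, map_smul]
    exact Prod.ext (key _ _) (key _ _)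

/-! ### Orbits and tangent spaces in coordinates -/

theorem orbit_eq {X : Type*} {G : X → X} {q : ℤ → X} (hq : ∀ n, q (n + 1) = G (q n)) {γ : ℕ → X}
    (hγ : ∀ k, γ (k + 1) = G (γ k)) (h0 : γ 0 = q 0) (k : ℕ) : γ k = q k := by
  induction k with
  | zero => exact h0
  | succ k ih => rw [hγ, ih, Nat.cast_succ, hq]

namespace TrigChart

variable {V : ℝ → ℝ} {d T : ℝ} {M : ℕ} {X : Type*} [NormedAddCommGroup X] [NormedSpace ℝ X]
  (κ : TrigChart V d T M X)

theorem injective : Function.Injective κ.χ := by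
  obtain ⟨c, -, hc⟩ := κ.norm_le
  refine (injective_iff_map_eq_zero κ.χ).2 fun x hx => ?_
  have := hc x
  rw [hx, l2norm_zero, mul_zero] at this
  exact norm_le_zero_iff.1 this

theorem isEvenOrbit_comp {u : ℤ → X} (hu : ∀ n, u (n + 1) = κ.H.F (u n)) :
    IsEvenOrbit V d T M fun n => κ.χ (u n) := fun n =>
  ⟨κ.mem _, (congrArg κ.χ (hu n)).trans (κ.conj _).symm⟩

theorem exists_of_isEvenOrbit {U : ℤ → State} (hU : IsEvenOrbit V d T M U) :
    ∃ u : ℤ → X, (∀ n, U n = κ.χ (u n)) ∧ ∀ n, u (n + 1) = κ.H.F (u n) := by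
  choose u hu using fun n => κ.surj _ (hU n).1
  refine ⟨u, fun n => (hu n).symm, fun n => κ.injective ?_⟩
  rw [hu, (hU n).2, ← κ.conj, hu]

theorem exists_of_isForwardOrbit {Γ : ℕ → State} (hΓ : IsForwardOrbit V d T M Γ) :
    ∃ γ : ℕ → X, (∀ k, Γ k = κ.χ (γ k)) ∧ ∀ k, γ (k + 1) = κ.H.F (γ k) := by
  choose γ hγ using fun k => κ.surj _ (hΓ k).1
  refine ⟨γ, fun k => (hγ k).symm, fun k => κ.injective ?_⟩
  rw [hγ, (hΓ k).2, ← κ.conj, hγ]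

/-- Backward orbits of the lattice map are forward orbits of the inverse. -/
theorem exists_of_isBackwardOrbit {Γ : ℕ → State} (hΓ : IsBackwardOrbit V d T M Γ) :
    ∃ γ : ℕ → X, (∀ k, Γ k = κ.χ (γ k)) ∧ ∀ k, γ (k + 1) = κ.H.reverse.F (γ k) := by
  choose γ hγ using fun k => κ.surj _ (hΓ k).1
  refine ⟨γ, fun k => (hγ k).symm, fun k => ?_⟩
  have h : γ k = κ.H.F (γ (k + 1)) := κ.injective (by rw [hγ, (hΓ k).2, ← κ.conj, hγ])
  rw [h]
  exact (κ.H.left_inv _).symm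

theorem tendsto_of_l2norm {ι : Type*} {l : Filter ι} {γ : ι → X}
    (h : Tendsto (fun k => l2norm T (κ.χ (γ k))) l (𝓝 0)) : Tendsto γ l (𝓝 0) := by
  obtain ⟨c, -, hc⟩ := κ.norm_le
  refine squeeze_zero_norm (fun k => hc (γ k)) ?_
  simpa using h.const_mul c

theorem reverse_orbit {q : ℤ → X} (hq : ∀ n, q (n + 1) = κ.H.F (q n)) (n : ℤ) :
    q (-(n + 1)) = κ.H.reverse.F (q (-n)) := by
  have h := hq (-(n + 1))
  rw [show -(n + 1) + 1 = -n by ring] at h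
  rw [h]
  exact (κ.H.left_inv _).symm

theorem isHomoclinic {Q : ℤ → State} (hQ : IsTransverseHomoclinicOrbit V d T M Q) {q : ℤ → X}
    (hq : ∀ n, Q n = κ.χ (q n)) (hqo : ∀ n, q (n + 1) = κ.H.F (q n)) : κ.H.IsHomoclinic q := by
  obtain ⟨⟨Γ, hΓ, hΓ0, hΓl⟩, ⟨Δ, hΔ, hΔ0, hΔl⟩⟩ := hQ.mem_manifolds 0
  obtain ⟨γ, hγ, hγo⟩ := κ.exists_of_isForwardOrbit hΓ
  obtain ⟨η, hη, hηo⟩ := κ.exists_of_isBackwardOrbit hΔ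
  have hγq : ∀ k : ℕ, γ k = q k :=
    orbit_eq hqo hγo (κ.injective (by rw [← hγ, hΓ0, hq]))
  have hηq : ∀ k : ℕ, η k = q (-k) :=
    orbit_eq (q := fun n => q (-n)) (κ.reverse_orbit hqo) hηo
      (κ.injective (by rw [← hη, hΔ0, hq]; rfl))
  simp only [hγ, hγq] at hΓl
  simp only [hη, hηq] at hΔl
  obtain ⟨C, hC, hb⟩ := κ.H.exists_decay_bound hqo (κ.tendsto_of_l2norm hΓl)
  obtain ⟨D, hD, hb'⟩ := κ.H.reverse.exists_decay_bound (Q := fun n => q (-n))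
    (κ.reverse_orbit hqo) (κ.tendsto_of_l2norm hΔl)
  have hdec : ∀ n, 0 ≤ decay κ.H.r n := fun n => (decay_pos κ.H.one_lt n).le
  refine ⟨hqo, max C D, le_max_of_le_left hC, fun n => ?_⟩
  rcases le_total 0 n with hn | hn
  · exact (hb n hn).trans (mul_le_mul_of_nonneg_right (le_max_left _ _) (hdec n))
  · have h := hb' (-n) (by omega)
    rw [neg_neg] at h
    refine h.trans ?_
    change D * decay κ.H.r (-n) ≤ _
    rw [decay_neg]
    exact mul_le_mul_of_nonneg_right (le_max_right _ _) (hdec n)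

theorem exists_uniform {Γ : ℝ → ℕ → State} {γ : ℝ → ℕ → X} (hγ : ∀ s k, Γ s k = κ.χ (γ s k))
    (h : TendstoZeroUniformly T Γ) (ε : ℝ) (hε : 0 < ε) :
    ∃ K, ∀ k, K ≤ k → ∀ s, ‖γ s k‖ ≤ ε := by
  obtain ⟨c, hc0, hc⟩ := κ.norm_le
  obtain ⟨K, hK⟩ := h (ε / c) (by positivity)
  refine ⟨K, fun k hk s => (hc _).trans ?_⟩
  rw [← hγ]
  calc c * l2norm T (Γ s k) ≤ c * (ε / c) := by gcongr; exact (hK k hk s).le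
    _ = ε := by field_simp

theorem tendsto_velocity {g : ℝ → X} {v : X} (h : HasVelocity T (fun s => κ.χ (g s)) (κ.χ v)) :
    Tendsto (fun s : ℝ => s⁻¹ • (g s - g 0)) (𝓝[≠] 0) (𝓝 v) := by
  refine tendsto_sub_nhds_zero_iff.1 (κ.tendsto_of_l2norm ?_)
  simpa only [HasVelocity, map_sub, map_smul] using h

theorem mem_stableSpace {Q : ℤ → State} {q : ℤ → X} (hq : ∀ n, Q n = κ.χ (q n))
    (hqh : κ.H.IsHomoclinic q) {v : X} (hv : κ.χ v ∈ stableTangent V d T M (Q 0)) :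
    v ∈ κ.H.stableSpace q := by
  obtain ⟨-, Γ, hΓ, hunif, h0, hvel⟩ := hv
  choose γ hγ hγo using fun s => κ.exists_of_isForwardOrbit (hΓ s)
  have h00 : γ 0 0 = q 0 := κ.injective (by rw [← hγ, h0, hq])
  refine hqh.mem_stableSpace hγo (κ.exists_uniform hγ hunif)
    (orbit_eq hqh.orbit (hγo 0) h00) ?_
  simp only [hγ] at hvel
  rw [← h00]
  exact κ.tendsto_velocity (g := fun s => γ s 0) hvel

theorem mem_reverse_stableSpace {Q : ℤ → State} {q : ℤ → X} (hq : ∀ n, Q n = κ.χ (q n))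
    (hqh : κ.H.IsHomoclinic q) {v : X} (hv : κ.χ v ∈ unstableTangent V d T M (Q 0)) :
    v ∈ κ.H.reverse.stableSpace fun n => q (-n) := by
  obtain ⟨-, Γ, hΓ, hunif, h0, hvel⟩ := hv
  choose γ hγ hγo using fun s => κ.exists_of_isBackwardOrbit (hΓ s)
  have h00 : γ 0 0 = q (-0) := κ.injective (by rw [← hγ, h0, hq]; rfl)
  refine hqh.reverse.mem_stableSpace hγo (κ.exists_uniform hγ hunif)
    (orbit_eq (q := fun n => q (-n)) hqh.reverse.orbit (hγo 0) h00) ?_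
  simp only [hγ] at hvel
  rw [← h00]
  exact κ.tendsto_velocity (g := fun s => γ s 0) hvel

theorem stableSpace_sup {Q : ℤ → State} (hQ : IsTransverseHomoclinicOrbit V d T M Q) {q : ℤ → X}
    (hq : ∀ n, Q n = κ.χ (q n)) (hqh : κ.H.IsHomoclinic q) :
    κ.H.stableSpace q ⊔ κ.H.reverse.stableSpace (fun n => q (-n)) = ⊤ := by
  refine eq_top_iff.2 fun x _ => ?_
  obtain ⟨a, ha, b, hb, hab⟩ := hQ.transverse 0 (κ.χ x) (κ.mem x)
  obtain ⟨a, rfl⟩ := κ.surj a ha.1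
  obtain ⟨b, rfl⟩ := κ.surj b hb.1
  rw [← map_add] at hab
  rw [κ.injective hab]
  exact Submodule.add_mem_sup (κ.mem_stableSpace hq hqh ha) (κ.mem_reverse_stableSpace hq hqh hb)

end TrigChart

end DKG

open DKG
theorem theorem1 (V : ℝ → ℝ) (hV : ContDiff ℝ ∞ V) (hVeven : ∀ x, V (-x) = V x)
    (hV0 : V 0 = 0) (hV2 : 0 < deriv (deriv V) 0)
    (d T : ℝ) (hd : 0 < d) (hT : 0 < T)
    (hhyp : BoundedAwayFromUnitCircle (DFZeroSpectrum V d T))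
    (M₀ : ℕ) (hM₀ : 1 ≤ M₀) (Q : ℕ → ℤ → State)
    (hQ : ∀ M, M₀ ≤ M → IsTransverseHomoclinicOrbit V d T M (Q M))
    (M : ℕ) (hM : M₀ ≤ M) :
    ∃ Nstar : ℕ, 0 < Nstar ∧ ∃ δ : ℝ, 0 < δ ∧ ∃ B : ℕ → ℝ, ∃ C : ℕ → ℕ → ℝ,
      ∀ m : ℕ, 1 < m →
      ∀ N : ℕ → ℕ, (∀ i ∈ Set.Icc 1 (m - 1), Nstar ≤ N i) →
      ∀ σ : ℕ → ℝ, (∀ i ∈ Set.Icc 1 m, σ i = 1 ∨ σ i = -1) →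
      ∃ U : ℤ → State,
        -- a solution which is close to the chain, and the only one
        IsEvenOrbit V d T M U ∧
        (∀ i ∈ Set.Icc 1 m, ∀ n ∈ piece m N i, l2norm T (remainder (Q M) N σ U i n) ≤ δ) ∧
        (∀ U' : ℤ → State, IsEvenOrbit V d T M U' →
          (∀ i ∈ Set.Icc 1 m, ∀ n ∈ piece m N i, l2norm T (remainder (Q M) N σ U' i n) ≤ δ) →
          U' = U) ∧
        -- estimates of the remainders and of all their derivatives with respect to time
        ∀ j : ℕ,
          (∀ i ∈ Set.Icc 1 (m - 1),
            l2norm T (timeDeriv j (remainder (Q M) N σ U i (halfPlus N i))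
              - σ (i + 1) • timeDeriv j (Q M (-halfMinus N i)))
              ≤ B j * rate V d T M ^ (-minDist m N)) ∧
          (∀ i ∈ Set.Icc 1 (m - 1),
            l2norm T (timeDeriv j (remainder (Q M) N σ U (i + 1) (-halfMinus N i))
              - σ i • timeDeriv j (Q M (halfPlus N i)))
              ≤ B j * rate V d T M ^ (-minDist m N)) ∧
          (∀ n : ℤ, n ≤ 0 →
            l2norm T (timeDeriv j (remainder (Q M) N σ U 1 n))
              ≤ B j * (rate V d T M ^ (-minDist m N) * rate V d T M ^ n)) ∧
          (∀ n : ℤ, 0 ≤ n →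
            l2norm T (timeDeriv j (remainder (Q M) N σ U m n))
              ≤ B j * (rate V d T M ^ (-minDist m N) * rate V d T M ^ (-n))) ∧
          -- inner pieces, with a constant for all distances
          (∀ i ∈ Set.Icc 1 m, ∀ n ∈ piece m N i,
            l2norm T (timeDeriv j (remainder (Q M) N σ U i n))
              ≤ B j * ((if 1 < i then leftBound (rate V d T M) N i n else 0)
                + (if i < m then rightBound (rate V d T M) N i n else 0))) ∧
          -- inner pieces, with a constant depending on the spread `D` of the distances
          (∀ D : ℕ, (∀ i ∈ Set.Icc 1 (m - 1), (N i : ℤ) ≤ minDist m N + D) →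
            (∀ i ∈ Set.Icc 2 m, ∀ n ∈ Set.Icc (-halfMinus N (i - 1)) 0,
              l2norm T (timeDeriv j (remainder (Q M) N σ U i n))
                ≤ C D j * leftBound (rate V d T M) N i n) ∧
            (∀ i ∈ Set.Icc 1 (m - 1), ∀ n ∈ Set.Icc 0 (halfPlus N i),
              l2norm T (timeDeriv j (remainder (Q M) N σ U i n))
                ≤ C D j * rightBound (rate V d T M) N i n)) := by
  obtain ⟨κ⟩ := exists_trigChart hV hVeven hd hT hhyp M
  obtain ⟨q, hq, hqo⟩ := κ.exists_of_isEvenOrbit (hQ M hM).orbit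
  have hqh := κ.isHomoclinic (hQ M hM) hq hqo
  obtain ⟨K₀, δ₀, C₀, hδ₀, hC₀, hmain, hexist⟩ :=
    hqh.exists_multipulse κ.isOdd (κ.stableSpace_sup (hQ M hM) hq hqh)
  obtain ⟨c, hc0, hc⟩ := κ.norm_le
  choose β hβ0 hβ using κ.deriv_le
  have hr : 1 < κ.H.r := κ.H.one_lt
  have hr0 : 0 < κ.H.r := κ.H.r_pos
  rw [← κ.r_eq]
  set r := κ.H.r with hr_def
  -- `δ` is small enough for uniqueness in the coordinates; the solution itself is taken closer to
  -- the chain, so that it satisfies the bound by `δ` in the `L²` norm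
  set δ := δ₀ / c with hδ_def
  have hδ : 0 < δ := by positivity
  have hβ1 : 0 < β 0 + 1 := by linarith [hβ0 0]
  obtain ⟨K, hK⟩ := hexist (min δ₀ (δ / (β 0 + 1))) (lt_min hδ₀ (by positivity))
  -- the factor `r` accounts for odd distances, where `2 ⌊N_i / 2⌋ = N_i - 1`
  refine ⟨max K₀ K + 1, Nat.succ_pos _, δ, hδ, fun j => β j * C₀ * r,
    fun D j => β j * C₀ * (1 + r ^ (D + 2)), fun m hm N hN σ hσ => ?_⟩
  have hchain : ∀ K', K' ≤ max K₀ K → HypDiffeo.IsChain K' m N σ := fun K' hK' =>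
    ⟨hm, fun i h1 h2 => by
      have := hN i ⟨h1, by omega⟩
      omega, fun i h1 h2 => hσ i ⟨h1, h2⟩⟩
  obtain ⟨u, huo, hu⟩ := hK m N σ (hchain K (le_max_right _ _))
  have hrem : ∀ (w : ℤ → _) i n, remainder (Q M) N σ (fun n => κ.χ (w n)) i n
      = κ.χ (w (n + center N i) - σ i • q n) := fun w i n => by
    rw [remainder, hq, map_sub, map_smul]
  have hu₀ : ∀ i, 1 ≤ i → i ≤ m → ∀ n ∈ piece m N i, ‖u (n + center N i) - σ i • q n‖ ≤ δ₀ :=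
    fun i h1 h2 n hn => (hu i h1 h2 n hn).trans (min_le_left _ _)
  obtain ⟨huniq, hbound, hinter⟩ := hmain m N σ (hchain K₀ (le_max_left _ _)) u huo hu₀
  have hbd : ∀ j i, 1 ≤ i → i ≤ m → ∀ n ∈ piece m N i,
      l2norm T (timeDeriv j (remainder (Q M) N σ (fun n => κ.χ (u n)) i n))
        ≤ β j * C₀ * neighbourBound r m N i n := fun j i h1 h2 n hn => by
    rw [hrem, mul_assoc]
    exact (hβ j _).trans (mul_le_mul_of_nonneg_left (hbound i h1 h2 n hn) (hβ0 j))
  have hβC : ∀ j, 0 ≤ β j * C₀ := fun j => mul_nonneg (hβ0 j) hC₀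
  have hle : ∀ j, β j * C₀ ≤ β j * C₀ * r := fun j =>
    le_mul_of_one_le_right (hβC j) hr.le
  have hint : ∀ j i, 1 ≤ i → i < m → ∀ x : _, x = u (interface N i) - σ i • q (halfPlus N i)
      - σ (i + 1) • q (-halfMinus N i) →
      l2norm T (timeDeriv j (κ.χ x)) ≤ β j * C₀ * r * r ^ (-minDist m N) := by
    rintro j i h1 h2 x rfl
    refine (hβ j _).trans ((mul_le_mul_of_nonneg_left (hinter i h1 h2) (hβ0 j)).trans ?_)
    rw [← mul_assoc]
    exact mul_le_mul_of_nonneg_right (hle j) (by positivity)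
  refine ⟨fun n => κ.χ (u n), κ.isEvenOrbit_comp huo, fun i hi n hn => ?_, fun U' hU' hnear => ?_,
    fun j => ⟨fun i hi => ?_, fun i hi => ?_, fun n hn => ?_, fun n hn => ?_, fun i hi n hn => ?_,
      fun D hD => ⟨fun i hi n hn => ?_, fun i hi n hn => ?_⟩⟩⟩
  · have h := (hβ 0 _).trans (mul_le_mul_of_nonneg_left
      ((hu i hi.1 hi.2 n hn).trans (min_le_right _ _)) (hβ0 0))
    rw [← hrem] at h
    refine (le_of_eq ?_).trans (h.trans ?_)
    · simp [timeDeriv, iteratedDeriv_zero]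
    · rw [← mul_div_assoc, div_le_iff₀ hβ1]
      nlinarith
  · obtain ⟨u', hu', hu'o⟩ := κ.exists_of_isEvenOrbit hU'
    obtain rfl : U' = fun n => κ.χ (u' n) := funext hu'
    have : u' = u := huniq u' hu'o fun i h1 h2 n hn => by
      have h := hnear i ⟨h1, h2⟩ n hn
      rw [hrem] at h
      refine (hc _).trans ((mul_le_mul_of_nonneg_left h hc0.le).trans_eq ?_)
      rw [hδ_def]; field_simp
    rw [this]
  · rw [hrem, hq, κ.deriv_sub_smul]
    refine hint j i hi.1 (by have := hi.2; omega) _ ?_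
    rw [interface, add_comm (halfPlus N i)]
  · rw [hrem, hq, κ.deriv_sub_smul]
    refine hint j i hi.1 (by have := hi.2; omega) _ ?_
    rw [interface_eq hi.1, neg_add_eq_sub]
    abel
  · refine (hbd j 1 le_rfl hm.le n ⟨fun h => absurd h (lt_irrefl 1), fun _ =>
      hn.trans (halfPlus_nonneg 1)⟩).trans ?_
    rw [mul_assoc (β j * C₀)]
    exact mul_le_mul_of_nonneg_left (neighbourBound_one_le hr hm n) (hβC j)
  · refine (hbd j m hm.le le_rfl n ⟨fun _ => ?_, fun h => absurd h (lt_irrefl m)⟩).trans ?_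
    · have := halfMinus_nonneg (N := N) (m - 1)
      omega
    rw [mul_assoc (β j * C₀)]
    exact mul_le_mul_of_nonneg_left (neighbourBound_last_le hr hm n) (hβC j)
  · refine (hbd j i hi.1 hi.2 n hn).trans (mul_le_mul_of_nonneg_right (hle j) ?_)
    exact neighbourBound_nonneg hr0 i n
  · refine (hbd j i (by have := hi.1; omega) hi.2 n ⟨fun _ => hn.1, fun _ =>
      hn.2.trans (halfPlus_nonneg i)⟩).trans ?_
    rw [mul_assoc (β j * C₀)]
    exact mul_le_mul_of_nonneg_left (neighbourBound_le_leftBound hr hD hi.1 hn.2) (hβC j)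
  · refine (hbd j i hi.1 (by have := hi.2; omega) n ⟨fun _ => ?_, fun _ => hn.2⟩).trans ?_
    · have := halfMinus_nonneg (N := N) (i - 1)
      have := hn.1
      omega
    rw [mul_assoc (β j * C₀)]
    exact mul_le_mul_of_nonneg_left
      (neighbourBound_le_rightBound hr hD hi.1 (by have := hi.2; omega) hn.1) (hβC j)
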